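/- **Theorem (weak termination).** If $P$ is a well-typed process, say $\vdash^{n} P : \Gamma$, then $P$ has a finite run along which the measure decreases: there are $k\in\mathbb N$ and processes $P=P_0\to P_1\to\cdots\to P_k$ such that $P_k$ does not reduce, and there are measures $n=n_0>n_1>\cdots>n_k$ and contexts $\Gamma=\Gamma_0,\Gamma_1,\dots,\Gamma_k$ with $\vdash^{n_i}P_i:\Gamma_i$ for every $i\le k$. The notions are as follows. *Processes.* Over channels $x,y,z$, tags $a$ and process names $A$: $$P,Q ::= x\leftrightarrow y \mid \mathsf{close}\,x \mid x!a.P \mid x![y]P.Q \mid P\oplus Q \mid \mathsf{done} \mid A\langle\bar x\rangle \mid \mathsf{wait}\,x.P \mid x?\{a_i:P_i\}_{i\in I} \mid x?(y).P \mid (x)(P\mid Q)$$ with $I$ finite; $x![y]P.Q$ binds $y$ in $P$ only, $x?(y).P$ binds $y$ in $P$, and $(x)(P\mid Q)$ binds $x$ in $P$ and $Q$. Processes are identified up to renaming of bound channels; $\mathrm{fn}(P)$ is the set of free channels. Each name $A$ has one global definition $A(\bar x)=P$, with $\mathrm{fn}(P)=\{\bar x\}$. Buffers are $\mathcal B_x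 ::= [\,] \mid x!a.\mathcal B_x \mid x![y]P.\mathcal B_x$; $\mathcal B_y$ is $\mathcal B_x$ with $x$ replaced by $y$, and $\mathcal B_x[P]$ is $\mathcal B_x$ with the hole filled by $P$. *Structural pre-congruence* $\sqsupseteq$ is the least preorder that is closed under all process constructors and such that: - $A\langle\bar x\rangle\sqsupseteq P$ if $A(\bar x)=P$; $\;x\leftrightarrow y\sqsupseteq y\leftrightarrow x$; $\;(x)(P\mid Q)\sqsupseteq(x)(Q\mid P)$; - for $x\neq y$: $(x)(\mathcal B_x[\mathsf{wait}\,y.P]\mid Q)\sqsupseteq \mathsf{wait}\,y.(x)(\mathcal B_x[P]\mid Q)$; $\;(x)(\mathcal B_x[y?\{a_i:P_i\}_{i\in I}]\mid Q)\sqsupseteq y?\{a_i:(x)(\mathcal B_x[P_i]\mid Q)\}_{i\in I}$; $\;(x)(\mathcal B_x[y?(z).P]\mid Q)\sqsupseteq y?(z).(x)(\mathcal B_x[P]\mid Q)$ if $z\notin\mathrm{fn}(\mathcal B_x)$; - $(x)(\mathcal B_x[P]\mid\mathcal B'_x[x\leftrightarrow y])\sqsupseteq\mathcal B_y[(x)(P\mid\mathcal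 B'_x[x\leftrightarrow y])]$; - for $x\ne y$: $(x)(y![z]P.Q\mid R)\sqsupseteq y![z]\big((x)(P\mid R)\big).Q$ if $x\in\mathrm{fn}(P)\setminus\mathrm{fn}(Q)$; $\;(x)(\mathcal B_y[P]\mid Q)\sqsupseteq\mathcal B_y[(x)(P\mid Q)]$ if $x\notin\mathrm{fn}(\mathcal B_y)$; $\;\mathcal B_x[y![z]P.Q]\sqsupseteq y![z](\mathcal B_x[P]).Q$ and $\mathcal B_x[\mathcal B'_y[P]]\sqsupseteq\mathcal B'_y[\mathcal B_x[P]]$ if $x\in\mathrm{fn}(P)$. (Here and below, bound channels are renamed so as to avoid captures, and a channel never leaves the scope of its binder.) *Reduction* $\to$ is the least relation such that $P_1\oplus P_2\to P_k$ for $k\in\{1,2\}$; $(x)(x\leftrightarrow y\mid P)\to P\{y/x\}$; $(x)(\mathsf{close}\,x\mid\mathsf{wait}\,x.P)\to P$; $(x)(x!a_k.P\mid\mathcal B_x[x?\{a_i:Q_i\}_{i\in I}])\to(x)(P\mid\mathcal B_x[Q_k])$ for $k\in I$; $(x)(x![y]P.Q\mid\mathcal B_x[x?(y).R])\to(y)(P\mid(x)(Q\mid\mathcal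 B_x[R]))$; if $P\to Q$ then $(x)(P\mid R)\to(x)(Q\mid R)$ and $\mathcal B_x[P]\to\mathcal B_x[Q]$; and if $P\sqsupseteq R\to Q$ then $P\to Q$. A *finite run* of $P$ is a finite sequence of reductions from $P$ to a process that does not reduce. *Session types* are the regular, possibly infinite trees generated by $S,T::=\mathbf 1\mid\bot\mid\oplus\{[m_i]a_i:S_i\}_{i\in I}\mid\&\{[m_i]a_i:S_i\}_{i\in I}\mid S\otimes T\mid S\,⅋\,T$ with $I$ finite and nonempty, the $a_i$ distinct and $m_i\in\mathbb N$. Types starting with $\mathbf 1,\oplus,\otimes$ are positive. The dual $S^\perp$ exchanges, hereditarily, $\mathbf 1/\bot$, $\oplus/\&$, $\otimes/⅋$. Transitions $S\xrightarrow{\alpha}T$ have labels $\alpha={?}\sigma$ or ${!}\sigma$, where $\sigma$ is $*$, an annotated tag $[m]a$, or a session type. The rules are: - $\mathbf 1\xrightarrow{!*}\mathbf 1$, $\;\bot\xrightarrow{?*}\bot$, $\;\oplus\{[m_i]a_i:S_i\}\xrightarrow{![m_k]a_k}S_k$, $\;\&\{[m_i]a_i:S_i\}\xrightarrow{?[m_k]a_k}S_k$,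 $\;S\otimes T\xrightarrow{!S}T$, $\;S\,⅋\,T\xrightarrow{?S}T$; - if $S_i\xrightarrow{?\sigma}T_i$ for all $i\in I$, then $\oplus\{[m_i]a_i:S_i\}_{i\in I}\xrightarrow{?\sigma}\oplus\{[m_i]a_i:T_i\}_{i\in I}$; if $S\xrightarrow{?\sigma}T$, then $U\otimes S\xrightarrow{?\sigma}U\otimes T$; symmetrically for $\&$, $⅋$ and ${!}\sigma$. The corules are: if $S_k\xrightarrow{?\sigma}T_k$ for some $k\in I$, then $\oplus\{[m_i]a_i:S_i\}_{i\in I}\xrightarrow{?\sigma}\oplus\{[m_i]a_i:T_i\}_{i\in I}$, and symmetrically for $\&$ and ${!}\sigma$. A transition holds if it has a possibly infinite derivation with the rules in which every judgment also has a finite derivation with rules and corules. *Correct composition* $S\bowtie T$ is the largest relation such that $S\bowtie T$ implies: $S$ or $T$ is positive; if $\sigma$ is $*$ or an annotated tag and $T\xrightarrow{!\sigma}T'$, then $S\xrightarrow{?\sigma}S'$ with $S'\bowtie T'$ for some $S'$; if $T\xrightarrow{!T_1}T_2$, then $S\xrightarrow{?S_1}S_2$ with $S_1\bowtie T_1$ and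 $S_2\bowtie T_2$ for some $S_1,S_2$; and the same with $S$ and $T$ exchanged. *Subtyping*: $S\leqslant T$ iff $R\bowtie T$ implies $R\bowtie S$ for every session type $R$. *Typing.* Contexts $\Gamma,\Delta$ are partial maps from channels to session types, and "$,$" is union of contexts with disjoint domains. The judgments $\vdash^nP:\Gamma$ ($n\in\mathbb N$ is the measure) are those with a possibly infinite derivation by the rules: - $\vdash^n\mathsf{done}:\emptyset$; $\;\vdash^n x\leftrightarrow y:x:S,y:T$ if $S^\perp\leqslant T$ and $n\ge1$; $\;\vdash^n\mathsf{close}\,x:x:\mathbf 1$ if $n\ge1$; - $\vdash^nA\langle\bar x\rangle:\overline{x:S}$ if $A(\bar x)=P$ and $\vdash^mP:\overline{x:S}$ with $m\le n$; - $\vdash^{1+n_k}P_1\oplus P_2:\Gamma$ if $\vdash^{n_1}P_1:\Gamma$, $\vdash^{n_2}P_2:\Gamma$ and $k\in\{1,2\}$; - $\vdash^{m+n}(x)(P\mid Q):\Gamma,\Delta$ if $\vdash^mP:\Gamma,x:S$ and $\vdash^nQ:\Delta,x:T$ and $S\bowtie T$; - $\vdash^n\mathsf{wait}\,x.P:\Gamma,x:\bot$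 if $\vdash^nP:\Gamma$; - $\vdash^{1+m_k+n}x!a_k.P:\Gamma,x:\oplus\{[m_i]a_i:S_i\}_{i\in I}$ if $k\in I$ and $\vdash^nP:\Gamma,x:S_k$; - $\vdash^nx?\{a_j:P_j\}_{j\in J}:\Gamma,x:\&\{[m_i]a_i:S_i\}_{i\in I}$ if $I\subseteq J$, $\vdash^{n+m_i}P_i:\Gamma,x:S_i$ for all $i\in I$, and $\mathrm{fn}(P_j)\subseteq\mathrm{dom}(\Gamma)\cup\{x\}$ for all $j\in J$; - $\vdash^{1+m+n}x![y]P.Q:\Gamma,\Delta,x:S\otimes T$ if $\vdash^mP:\Gamma,y:S$ and $\vdash^nQ:\Delta,x:T$; - $\vdash^nx?(y).P:\Gamma,x:S\,⅋\,T$ if $\vdash^nP:\Gamma,y:S,x:T$. -/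

import Mathlib

/- A calculus of asynchronous processes, fair asynchronous subtyping, and the measured type system.
Channels are de Bruijn indices (natural numbers), so that processes are identified up to renaming
of bound channels. -/

namespace CaP

/-! ### Session types -/

/-- The topmost constructor of a session type. In `plus` and `amp` the finite nonempty set `I` holds
the tags of the choice and `m` gives the measure annotation of each tag. -/
inductive Shape (Tag : Type) : Type
  | one : Shape Tag
  | bot : Shape Tag
  | plus (I : Finset Tag) (hI : I.Nonempty) (m : I → ℕ) : Shape Tag
  | amp (I : Finset Tag) (hI : I.Nonempty) (m : I → ℕ) : Shape Tag
  | tensor : Shape Tag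
  | par : Shape Tag

def Shape.Arity {Tag : Type} : Shape Tag → Type
  | .one => Empty
  | .bot => Empty
  | .plus I _ _ => I
  | .amp I _ _ => I
  | .tensor => Bool
  | .par => Bool

def shapeFunctor (Tag : Type) : PFunctor.{0, 0} := ⟨Shape Tag, Shape.Arity⟩

/-- Possibly infinite session types, as coinductive trees. -/
def SType (Tag : Type) : Type := (shapeFunctor Tag).M

namespace SType

variable {Tag : Type}

/-- One layer of a session type: its topmost constructor and its immediate subtrees. -/
def dest (S : SType Tag) : (shapeFunctor Tag).Obj (SType Tag) := PFunctor.M.dest S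

def one : SType Tag := PFunctor.M.mk ⟨Shape.one, fun e : Empty => e.elim⟩

def bot : SType Tag := PFunctor.M.mk ⟨Shape.bot, fun e : Empty => e.elim⟩

def plus (I : Finset Tag) (hI : I.Nonempty) (m : I → ℕ) (S : I → SType Tag) : SType Tag :=
  PFunctor.M.mk ⟨Shape.plus I hI m, S⟩

def amp (I : Finset Tag) (hI : I.Nonempty) (m : I → ℕ) (S : I → SType Tag) : SType Tag :=
  PFunctor.M.mk ⟨Shape.amp I hI m, S⟩

def tensor (S T : SType Tag) : SType Tag :=
  PFunctor.M.mk ⟨Shape.tensor, fun b : Bool => if b then T else S⟩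

def par (S T : SType Tag) : SType Tag :=
  PFunctor.M.mk ⟨Shape.par, fun b : Bool => if b then T else S⟩

/-- Positive types are those that start with an output: `one`, `plus`, `tensor`. All the other types
are negative. -/
def Pos (S : SType Tag) : Prop :=
  match S.dest with
  | ⟨.one, _⟩ => True
  | ⟨.plus _ _ _, _⟩ => True
  | ⟨.tensor, _⟩ => True
  | ⟨.bot, _⟩ => False
  | ⟨.amp _ _ _, _⟩ => False
  | ⟨.par, _⟩ => False

/-- Exchange of the topmost constructor with its dual. -/
def dualNode {X : Type} : (shapeFunctor Tag).Obj X → (shapeFunctor Tag).Obj X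
  | ⟨.one, f⟩ => ⟨Shape.bot, f⟩
  | ⟨.bot, f⟩ => ⟨Shape.one, f⟩
  | ⟨.plus I hI m, f⟩ => ⟨Shape.amp I hI m, f⟩
  | ⟨.amp I hI m, f⟩ => ⟨Shape.plus I hI m, f⟩
  | ⟨.tensor, f⟩ => ⟨Shape.par, f⟩
  | ⟨.par, f⟩ => ⟨Shape.tensor, f⟩

/-- The dual of a session type, by corecursion. -/
def dual (S : SType Tag) : SType Tag :=
  PFunctor.M.corec (fun T : SType Tag => dualNode T.dest) S

/-- `Child T S`: the tree `T` is an immediate subtree of `S`. -/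
def Child (T S : SType Tag) : Prop :=
  ∃ i : (shapeFunctor Tag).B S.dest.1, T = S.dest.2 i

/-- A session type is regular if it has finitely many distinct subtrees. -/
def Regular (S : SType Tag) : Prop :=
  {T : SType Tag | Relation.ReflTransGen Child T S}.Finite

end SType

/-! ### Labelled transitions of session types -/

/-- Messages: the termination signal, an annotated tag, a channel of a given type. -/
inductive Msg (Tag : Type) : Type
  | star : Msg Tag
  | tag (m : ℕ) (a : Tag) : Msg Tag
  | chan (S : SType Tag) : Msg Tag

inductive Act (Tag : Type) : Type
  | inp (σ : Msg Tag) : Act Tag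
  | out (σ : Msg Tag) : Act Tag

/-- One application of a transition rule with premises in `R`: the immediate transitions, and the
late inputs and early outputs. -/
inductive TransRule {Tag : Type} (R : SType Tag → Act Tag → SType Tag → Prop) :
    SType Tag → Act Tag → SType Tag → Prop
  | must_one : TransRule R .one (.out .star) .one
  | must_bot : TransRule R .bot (.inp .star) .bot
  | must_plus (I : Finset Tag) (hI : I.Nonempty) (m : I → ℕ) (S : I → SType Tag) (k : I) :
      TransRule R (.plus I hI m S) (.out (.tag (m k) k)) (S k)
  | must_amp (I : Finset Tag) (hI : I.Nonempty) (m : I → ℕ) (S : I → SType Tag) (k : I) :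
      TransRule R (.amp I hI m S) (.inp (.tag (m k) k)) (S k)
  | must_tensor (S T : SType Tag) : TransRule R (.tensor S T) (.out (.chan S)) T
  | must_par (S T : SType Tag) : TransRule R (.par S T) (.inp (.chan S)) T
  | may_plus (I : Finset Tag) (hI : I.Nonempty) (m : I → ℕ) (S T : I → SType Tag) (σ : Msg Tag) :
      (∀ i, R (S i) (.inp σ) (T i)) → TransRule R (.plus I hI m S) (.inp σ) (.plus I hI m T)
  | may_amp (I : Finset Tag) (hI : I.Nonempty) (m : I → ℕ) (S T : I → SType Tag) (σ : Msg Tag) :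
      (∀ i, R (S i) (.out σ) (T i)) → TransRule R (.amp I hI m S) (.out σ) (.amp I hI m T)
  | may_tensor (U S T : SType Tag) (σ : Msg Tag) :
      R S (.inp σ) T → TransRule R (.tensor U S) (.inp σ) (.tensor U T)
  | may_par (U S T : SType Tag) (σ : Msg Tag) :
      R S (.out σ) T → TransRule R (.par U S) (.out σ) (.par U T)

/-- Inductive interpretation of the transition rules together with the corules `fair_plus` and
`fair_amp`, which ask for just one branch to perform the action. -/
inductive IndTrans {Tag : Type} : SType Tag → Act Tag → SType Tag → Prop
  | must_one : IndTrans .one (.out .star) .one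
  | must_bot : IndTrans .bot (.inp .star) .bot
  | must_plus (I : Finset Tag) (hI : I.Nonempty) (m : I → ℕ) (S : I → SType Tag) (k : I) :
      IndTrans (.plus I hI m S) (.out (.tag (m k) k)) (S k)
  | must_amp (I : Finset Tag) (hI : I.Nonempty) (m : I → ℕ) (S : I → SType Tag) (k : I) :
      IndTrans (.amp I hI m S) (.inp (.tag (m k) k)) (S k)
  | must_tensor (S T : SType Tag) : IndTrans (.tensor S T) (.out (.chan S)) T
  | must_par (S T : SType Tag) : IndTrans (.par S T) (.inp (.chan S)) T
  | may_plus (I : Finset Tag) (hI : I.Nonempty) (m : I → ℕ) (S T : I → SType Tag) (σ : Msg Tag) :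
      (∀ i, IndTrans (S i) (.inp σ) (T i)) → IndTrans (.plus I hI m S) (.inp σ) (.plus I hI m T)
  | may_amp (I : Finset Tag) (hI : I.Nonempty) (m : I → ℕ) (S T : I → SType Tag) (σ : Msg Tag) :
      (∀ i, IndTrans (S i) (.out σ) (T i)) → IndTrans (.amp I hI m S) (.out σ) (.amp I hI m T)
  | may_tensor (U S T : SType Tag) (σ : Msg Tag) :
      IndTrans S (.inp σ) T → IndTrans (.tensor U S) (.inp σ) (.tensor U T)
  | may_par (U S T : SType Tag) (σ : Msg Tag) :
      IndTrans S (.out σ) T → IndTrans (.par U S) (.out σ) (.par U T)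
  | fair_plus (I : Finset Tag) (hI : I.Nonempty) (m : I → ℕ) (S T : I → SType Tag) (σ : Msg Tag)
      (k : I) : IndTrans (S k) (.inp σ) (T k) → IndTrans (.plus I hI m S) (.inp σ) (.plus I hI m T)
  | fair_amp (I : Finset Tag) (hI : I.Nonempty) (m : I → ℕ) (S T : I → SType Tag) (σ : Msg Tag)
      (k : I) : IndTrans (S k) (.out σ) (T k) → IndTrans (.amp I hI m S) (.out σ) (.amp I hI m T)

/-- The transition relation, by bounded coinduction: there is a possibly infinite derivation with the
rules all of whose judgments have a finite derivation with the rules and the corules. -/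
def Trans {Tag : Type} (S : SType Tag) (α : Act Tag) (T : SType Tag) : Prop :=
  ∃ R : SType Tag → Act Tag → SType Tag → Prop,
    (∀ S α T, R S α T → TransRule R S α T ∧ IndTrans S α T) ∧ R S α T

/-! ### Correct composition and fair asynchronous subtyping -/

/-- The conditions that make `R` a correct asynchronous composition relation. -/
structure IsCorrectComposition {Tag : Type} (R : SType Tag → SType Tag → Prop) : Prop where
  pol : ∀ S T, R S T → S.Pos ∨ T.Pos
  inp_out : ∀ S T, R S T → ∀ σ T', (∀ U, σ ≠ Msg.chan U) → Trans T (.out σ) T' →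
    ∃ S', Trans S (.inp σ) S' ∧ R S' T'
  out_inp : ∀ S T, R S T → ∀ σ S', (∀ U, σ ≠ Msg.chan U) → Trans S (.out σ) S' →
    ∃ T', Trans T (.inp σ) T' ∧ R S' T'
  inp_out_chan : ∀ S T, R S T → ∀ T₁ T₂, Trans T (.out (.chan T₁)) T₂ →
    ∃ S₁ S₂, Trans S (.inp (.chan S₁)) S₂ ∧ R S₁ T₁ ∧ R S₂ T₂
  out_inp_chan : ∀ S T, R S T → ∀ S₁ S₂, Trans S (.out (.chan S₁)) S₂ →
    ∃ T₁ T₂, Trans T (.inp (.chan T₁)) T₂ ∧ R S₁ T₁ ∧ R S₂ T₂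

/-- The session types `S` and `T` compose correctly. -/
def Correct {Tag : Type} (S T : SType Tag) : Prop :=
  ∃ R : SType Tag → SType Tag → Prop, IsCorrectComposition R ∧ R S T

/-- Fair asynchronous subtyping. -/
def Sub {Tag : Type} (S T : SType Tag) : Prop :=
  ∀ R : SType Tag, R.Regular → Correct R T → Correct R S

/-! ### Processes -/

/-- Processes. `fork x P Q` binds index 0 in `P` (the channel sent on `x`) but not in `Q`, `join x P`
binds index 0 in `P`, and `cut P Q` binds index 0 both in `P` and in `Q`. -/
inductive Proc (Tag Name : Type) : Type
  | link (x y : ℕ) : Proc Tag Name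
  | close (x : ℕ) : Proc Tag Name
  | select (x : ℕ) (a : Tag) (P : Proc Tag Name) : Proc Tag Name
  | fork (x : ℕ) (P Q : Proc Tag Name) : Proc Tag Name
  | choice (P Q : Proc Tag Name) : Proc Tag Name
  | done : Proc Tag Name
  | call (A : Name) (xs : List ℕ) : Proc Tag Name
  | wait (x : ℕ) (P : Proc Tag Name) : Proc Tag Name
  | case (x : ℕ) (I : Finset Tag) (P : I → Proc Tag Name) : Proc Tag Name
  | join (x : ℕ) (P : Proc Tag Name) : Proc Tag Name
  | cut (P Q : Proc Tag Name) : Proc Tag Name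

/-- The renaming `ρ` under one binder. -/
def up (ρ : ℕ → ℕ) : ℕ → ℕ
  | 0 => 0
  | n + 1 => ρ n + 1

/-- Exchange of the two innermost bound channels. -/
def swap : ℕ → ℕ
  | 0 => 1
  | 1 => 0
  | n + 2 => n + 2

/-- Replacement of the innermost bound channel by `y`. -/
def inst (y : ℕ) : ℕ → ℕ
  | 0 => y
  | n + 1 => n

namespace Proc

variable {Tag Name : Type}

def rename : (ℕ → ℕ) → Proc Tag Name → Proc Tag Name
  | ρ, link x y => link (ρ x) (ρ y)
  | ρ, close x => close (ρ x)
  | ρ, select x a P => select (ρ x) a (rename ρ P)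
  | ρ, fork x P Q => fork (ρ x) (rename (up ρ) P) (rename ρ Q)
  | ρ, choice P Q => choice (rename ρ P) (rename ρ Q)
  | _, done => done
  | ρ, call A xs => call A (xs.map ρ)
  | ρ, wait x P => wait (ρ x) (rename ρ P)
  | ρ, case x I P => case (ρ x) I (fun i => rename ρ (P i))
  | ρ, join x P => join (ρ x) (rename (up ρ) P)
  | ρ, cut P Q => cut (rename (up ρ) P) (rename (up ρ) Q)

/-- Free channels. -/
def fn : Proc Tag Name → Set ℕ
  | link x y => {x, y}
  | close x => {x}
  | select x _ P => {x} ∪ fn P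
  | fork x P Q => {x} ∪ {n | n + 1 ∈ fn P} ∪ fn Q
  | choice P Q => fn P ∪ fn Q
  | done => ∅
  | call _ xs => {n | n ∈ xs}
  | wait x P => {x} ∪ fn P
  | case x _ P => {x} ∪ ⋃ i, fn (P i)
  | join x P => {x} ∪ {n | n + 1 ∈ fn P}
  | cut P Q => {n | n + 1 ∈ fn P ∨ n + 1 ∈ fn Q}

end Proc

/-- The global process definitions: the parameters of `A` are the channels `0, …, arity A - 1`, and
they are exactly the free channels of its body. -/
structure Program (Tag Name : Type) : Type where
  arity : Name → ℕ
  body : Name → Proc Tag Name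
  fn_body : ∀ A, (body A).fn = {i | i < arity A}

/-- The body of `A` where the parameters are replaced by the channels `xs`. -/
def Program.unfold {Tag Name : Type} (prog : Program Tag Name) (A : Name) (xs : List ℕ) :
    Proc Tag Name :=
  (prog.body A).rename (fun i => xs.getD i 0)

/-- A message in a buffer: a tag, or a fresh channel (index 0 in `P`) with its process `P`. -/
inductive BufMsg (Tag Name : Type) : Type
  | tag (a : Tag) : BufMsg Tag Name
  | chan (P : Proc Tag Name) : BufMsg Tag Name

/-- Buffers, abstracted from the channel the messages are sent on; the first message of the list is
the outermost one, and the empty list is the hole. -/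
abbrev Buffer (Tag Name : Type) : Type := List (BufMsg Tag Name)

namespace Buffer

variable {Tag Name : Type}

/-- `plug x B P` is the buffer `B` on the channel `x` with its hole filled by `P`. -/
def plug (x : ℕ) : Buffer Tag Name → Proc Tag Name → Proc Tag Name
  | [], P => P
  | .tag a :: B, P => .select x a (plug x B P)
  | .chan R :: B, P => .fork x R (plug x B P)

def rename (ρ : ℕ → ℕ) (B : Buffer Tag Name) : Buffer Tag Name :=
  B.map fun
    | .tag a => .tag a
    | .chan R => .chan (R.rename (up ρ))

end Buffer

/-! ### Operational semantics -/

open Proc Buffer in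
/-- Structural pre-congruence: the least preorder that is closed under all process constructors and
contains the axioms. Renamings by `Nat.succ` express that a channel does not occur free. -/
inductive PreCong {Tag Name : Type} (prog : Program Tag Name) :
    Proc Tag Name → Proc Tag Name → Prop
  | refl (P) : PreCong prog P P
  | trans {P Q R} : PreCong prog P Q → PreCong prog Q R → PreCong prog P R
  | cong_select (x a) {P P'} : PreCong prog P P' → PreCong prog (select x a P) (select x a P')
  | cong_fork (x) {P P' Q Q'} : PreCong prog P P' → PreCong prog Q Q' →
      PreCong prog (fork x P Q) (fork x P' Q')
  | cong_choice {P P' Q Q'} : PreCong prog P P' → PreCong prog Q Q' →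
      PreCong prog (choice P Q) (choice P' Q')
  | cong_wait (x) {P P'} : PreCong prog P P' → PreCong prog (wait x P) (wait x P')
  | cong_case (x) (I : Finset Tag) {P P' : I → Proc Tag Name} : (∀ i, PreCong prog (P i) (P' i)) →
      PreCong prog (case x I P) (case x I P')
  | cong_join (x) {P P'} : PreCong prog P P' → PreCong prog (join x P) (join x P')
  | cong_cut {P P' Q Q'} : PreCong prog P P' → PreCong prog Q Q' →
      PreCong prog (cut P Q) (cut P' Q')
  | s_call (A) (xs : List ℕ) : xs.length = prog.arity A →
      PreCong prog (call A xs) (prog.unfold A xs)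
  | s_link (x y) : PreCong prog (link x y) (link y x)
  | s_comm (P Q) : PreCong prog (cut P Q) (cut Q P)
  | s_wait (B : Buffer Tag Name) (y P Q) :
      PreCong prog (cut (plug 0 B (wait (y + 1) P)) Q) (wait y (cut (plug 0 B P) Q))
  | s_case (B : Buffer Tag Name) (y) (I : Finset Tag) (P : I → Proc Tag Name) (Q) :
      PreCong prog (cut (plug 0 B (case (y + 1) I P)) Q)
        (case y I (fun i => cut (plug 0 B (P i)) Q))
  | s_join (B : Buffer Tag Name) (y P Q) :
      PreCong prog (cut (plug 0 B (join (y + 1) P)) Q)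
        (join y (cut (plug 0 (B.rename (up Nat.succ)) (P.rename swap)) (Q.rename (up Nat.succ))))
  | s_pull_0 (B B' : Buffer Tag Name) (y P) :
      PreCong prog (cut (plug 0 B P) (plug 0 B' (link 0 (y + 1))))
        (plug y (B.rename (inst y)) (cut P (plug 0 B' (link 0 (y + 1)))))
  | s_pull_1 (y P Q R) : 1 ∈ P.fn →
      PreCong prog (cut (fork (y + 1) P (Q.rename Nat.succ)) R)
        (fork y (cut (P.rename swap) (R.rename (up Nat.succ))) Q)
  | s_pull_2 (B : Buffer Tag Name) (y P Q) :
      PreCong prog (cut (plug (y + 1) (B.rename Nat.succ) P) Q) (plug y B (cut P Q))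
  | s_pull_3 (B : Buffer Tag Name) (x y P Q) : x ≠ y → x + 1 ∈ P.fn →
      PreCong prog (plug x B (fork y P Q)) (fork y (plug (x + 1) (B.rename Nat.succ) P) Q)
  | s_pull_4 (B B' : Buffer Tag Name) (x y P) : x ≠ y → x ∈ P.fn →
      PreCong prog (plug x B (plug y B' P)) (plug y B' (plug x B P))

open Proc Buffer in
/-- Reduction of processes. -/
inductive Red {Tag Name : Type} (prog : Program Tag Name) : Proc Tag Name → Proc Tag Name → Prop
  | r_choice_left (P Q) : Red prog (choice P Q) P
  | r_choice_right (P Q) : Red prog (choice P Q) Q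
  | r_link (y P) : Red prog (cut (link 0 (y + 1)) P) (P.rename (inst y))
  | r_close (P) : Red prog (cut (close 0) (wait 0 (P.rename Nat.succ))) P
  | r_select (B : Buffer Tag Name) (P) (I : Finset Tag) (Q : I → Proc Tag Name) (k : I) :
      Red prog (cut (select 0 k P) (plug 0 B (case 0 I Q))) (cut P (plug 0 B (Q k)))
  | r_fork (B : Buffer Tag Name) (P Q R) :
      Red prog (cut (fork 0 (P.rename (up Nat.succ)) Q) (plug 0 B (join 0 R)))
        (cut P (cut (Q.rename (up Nat.succ))
          (plug 0 (B.rename (up Nat.succ)) (R.rename swap))))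
  | r_cut {P Q} (R) : Red prog P Q → Red prog (cut P R) (cut Q R)
  | r_buffer (x) (B : Buffer Tag Name) {P Q} : Red prog P Q → Red prog (plug x B P) (plug x B Q)
  | r_str {P R Q} : PreCong prog P R → Red prog R Q → Red prog P Q

/-- `IsFiniteRun prog P k run`: the sequence `run 0, …, run k` is a finite run of `P`, that is, a
sequence of reductions that starts from `P` and ends in a process that does not reduce. A process
that has a finite run is weakly terminating. -/
def IsFiniteRun {Tag Name : Type} (prog : Program Tag Name) (P : Proc Tag Name) (k : ℕ)
    (run : ℕ → Proc Tag Name) : Prop :=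
  run 0 = P ∧ (∀ i < k, Red prog (run i) (run (i + 1))) ∧ ∀ Q, ¬ Red prog (run k) Q

/-! ### Typing -/

/-- Typing contexts: partial maps from channels to session types. -/
abbrev Ctx (Tag : Type) : Type := ℕ → Option (SType Tag)

namespace Ctx

variable {Tag : Type}

def dom (Γ : Ctx Tag) : Set ℕ := {x | Γ x ≠ none}

def empty : Ctx Tag := fun _ => none

/-- The context `Γ` where the type of `x` is set to `S`. -/
def set (Γ : Ctx Tag) (x : ℕ) (S : SType Tag) : Ctx Tag := fun z => if z = x then some S else Γ z

/-- The context `Γ` without the channel `x`. -/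
def erase (Γ : Ctx Tag) (x : ℕ) : Ctx Tag := fun z => if z = x then none else Γ z

/-- The context `Γ` extended, under a binder, with type `S` for the bound channel. -/
def cons (S : SType Tag) (Γ : Ctx Tag) : Ctx Tag
  | 0 => some S
  | n + 1 => Γ n

/-- `Γ` is the union of the contexts `Γ₁` and `Γ₂`, which have disjoint domains. -/
def Split (Γ Γ₁ Γ₂ : Ctx Tag) : Prop :=
  ∀ x, (Γ₁ x = Γ x ∧ Γ₂ x = none) ∨ (Γ₁ x = none ∧ Γ₂ x = Γ x)

def Regular (Γ : Ctx Tag) : Prop := ∀ x S, Γ x = some S → S.Regular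

end Ctx

open Proc in
/-- One application of a typing rule with premises in `R`, where `R n P Γ` stands for the judgment
that `P` has measure `n` in the context `Γ`. -/
inductive TypingRule {Tag Name : Type} (prog : Program Tag Name)
    (R : ℕ → Proc Tag Name → Ctx Tag → Prop) : ℕ → Proc Tag Name → Ctx Tag → Prop
  | done (n) : TypingRule prog R n done .empty
  | link (n x y) (S T : SType Tag) : 1 ≤ n → x ≠ y → Sub S.dual T →
      TypingRule prog R n (link x y) ((Ctx.empty.set x S).set y T)
  | call (m n A) (xs : List ℕ) (Γ : Ctx Tag) : xs.length = prog.arity A → xs.Nodup →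
      Γ.dom = {x | x ∈ xs} → R m (prog.unfold A xs) Γ → m ≤ n →
      TypingRule prog R n (call A xs) Γ
  | choice_left (m n P Q) (Γ : Ctx Tag) : R m P Γ → R n Q Γ →
      TypingRule prog R (1 + m) (choice P Q) Γ
  | choice_right (m n P Q) (Γ : Ctx Tag) : R m P Γ → R n Q Γ →
      TypingRule prog R (1 + n) (choice P Q) Γ
  | cut (m n P Q) (S T : SType Tag) (Γ Γ₁ Γ₂ : Ctx Tag) : Γ.Split Γ₁ Γ₂ → Correct S T →
      R m P (Γ₁.cons S) → R n Q (Γ₂.cons T) → TypingRule prog R (m + n) (cut P Q) Γ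
  | close (n x) : 1 ≤ n → TypingRule prog R n (close x) (Ctx.empty.set x .one)
  | wait (n x P) (Γ : Ctx Tag) : Γ x = some .bot → R n P (Γ.erase x) →
      TypingRule prog R n (wait x P) Γ
  | select (n x P) (Γ : Ctx Tag) (I : Finset Tag) (hI : I.Nonempty) (m : I → ℕ)
      (S : I → SType Tag) (k : I) : Γ x = some (.plus I hI m S) → R n P (Γ.set x (S k)) →
      TypingRule prog R (1 + m k + n) (select x k P) Γ
  -- The process may offer more tags than its type; only the tags of the type are typed, but all the
  -- free channels of the process belong to the context.
  | case (n x) (Γ : Ctx Tag) (I J : Finset Tag) (hI : I.Nonempty) (m : I → ℕ)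
      (S : I → SType Tag) (hIJ : I ⊆ J) (P : J → Proc Tag Name) : Γ x = some (.amp I hI m S) →
      (∀ i : I, R (n + m i) (P ⟨i, hIJ i.2⟩) (Γ.set x (S i))) → (∀ j, (P j).fn ⊆ Γ.dom) →
      TypingRule prog R n (case x J P) Γ
  | fork (m n x P Q) (S T : SType Tag) (Γ Γ₁ Γ₂ : Ctx Tag) : Γ x = some (.tensor S T) →
      (Γ.erase x).Split Γ₁ Γ₂ → R m P (Γ₁.cons S) → R n Q (Γ₂.set x T) →
      TypingRule prog R (1 + m + n) (fork x P Q) Γ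
  | join (n x P) (S T : SType Tag) (Γ : Ctx Tag) : Γ x = some (.par S T) →
      R n P ((Γ.set x T).cons S) → TypingRule prog R n (join x P) Γ

/-- `Typed prog n P Γ`: the process `P` is well typed in `Γ` with measure `n`, that is, there is a
possibly infinite derivation built with the typing rules, where all session types are regular. -/
def Typed {Tag Name : Type} (prog : Program Tag Name) (n : ℕ) (P : Proc Tag Name)
    (Γ : Ctx Tag) : Prop :=
  ∃ R : ℕ → Proc Tag Name → Ctx Tag → Prop,
    (∀ n P Γ, R n P Γ → Γ.Regular ∧ TypingRule prog R n P Γ) ∧ R n P Γ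

end CaP

/-!
A reduction of a well-typed process can always be replaced by one that decreases the measure and
leads to a well-typed process; the theorem then follows by induction on the measure. The replacement
is needed because a reduction may pick the branch of a choice that the measure does not count, and
because structural pre-congruence does not preserve typing: it may rewrite one branch of a case in a
way that changes the type of a free channel, while the other branches keep the old type.

The second difficulty is met with skeletons. `Skel M P` says that `M` and `P` agree outside choices
and outside the prefixes that block reduction, whose contents are only required to have the same
free channels. No reduction depends on those contents, so a well-typed `M` with the skeleton of `P`
can follow the structural steps of `P` (`PreCong.simulate`), skipping those that take place under a
blocking prefix, and whenever `P` reduces, `M` has a reduction with a smaller measure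
(`Red.simulate`). Free channels matter for the steps that require a channel not to occur. A case
without branches can absorb free channels, but this does not happen in the processes that are
reached from a well-typed one: they are good in the sense of `Proc.Good`, and structural
pre-congruence preserves the free channels of good processes (`PreCong.good`).

Contexts change only in the passage through a link, where types become smaller. That the new types
fit rests on four properties of session types: correct composition is closed under composition along
a type and its dual (`Correct.cut`), inputs and outputs of a type commute (`Trans.diamond`), hence
outputs can be anticipated in a subtype (`sub_of_trans_tag`, `sub_of_trans_chan`), and transitions
preserve regularity (`Trans.regular`). Messages in buffers are handled by `BufTyped`, which
separates the typing of a buffer from that of the process in its hole.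
-/

namespace CaP

/-! ### Session types: case analysis and duality -/

namespace SType

variable {Tag : Type}

theorem mk_dest (S : SType Tag) : (PFunctor.M.mk S.dest : SType Tag) = S := PFunctor.M.mk_dest S

theorem mk_tensor (f : Bool → SType Tag) :
    (PFunctor.M.mk ⟨Shape.tensor, f⟩ : SType Tag) = tensor (f false) (f true) := by
  have : f = fun b : Bool => if b then f true else f false := by
    funext b; cases b <;> rfl
  conv_lhs => rw [this]
  rfl

theorem mk_par (f : Bool → SType Tag) :
    (PFunctor.M.mk ⟨Shape.par, f⟩ : SType Tag) = par (f false) (f true) := by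
  have : f = fun b : Bool => if b then f true else f false := by
    funext b; cases b <;> rfl
  conv_lhs => rw [this]
  rfl

theorem mk_one (f : Empty → SType Tag) : (PFunctor.M.mk ⟨Shape.one, f⟩ : SType Tag) = one := by
  have : f = fun e : Empty => e.elim := by funext e; exact e.elim
  rw [this]; rfl

theorem mk_bot (f : Empty → SType Tag) : (PFunctor.M.mk ⟨Shape.bot, f⟩ : SType Tag) = bot := by
  have : f = fun e : Empty => e.elim := by funext e; exact e.elim
  rw [this]; rfl

/-- Case analysis on the topmost constructor of a session type. -/
@[elab_as_elim]
theorem shape_cases {motive : SType Tag → Prop} (S : SType Tag) (one : motive one)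
    (bot : motive bot) (plus : ∀ I hI m S, motive (plus I hI m S))
    (amp : ∀ I hI m S, motive (amp I hI m S)) (tensor : ∀ S T, motive (tensor S T))
    (par : ∀ S T, motive (par S T)) : motive S := by
  rw [← mk_dest S]
  rcases S.dest with ⟨s, f⟩
  cases s with
  | one => exact (mk_one (Tag := Tag) f).symm ▸ one
  | bot => exact (mk_bot (Tag := Tag) f).symm ▸ bot
  | plus I hI m => exact plus I hI m f
  | amp I hI m => exact amp I hI m f
  | tensor => exact (mk_tensor (Tag := Tag) f).symm ▸ tensor _ _
  | par => exact (mk_par (Tag := Tag) f).symm ▸ par _ _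

theorem dual_eq (S : SType Tag) :
    S.dual = PFunctor.M.mk ((shapeFunctor Tag).map dual (dualNode S.dest)) :=
  PFunctor.M.corec_def _ _

@[simp] theorem dual_one : (one : SType Tag).dual = bot := (dual_eq _).trans (mk_bot _)
@[simp] theorem dual_bot : (bot : SType Tag).dual = one := (dual_eq _).trans (mk_one _)
@[simp] theorem dual_plus (I : Finset Tag) (hI m S) :
    (plus I hI m S).dual = amp I hI m fun i => (S i).dual := dual_eq _
@[simp] theorem dual_amp (I : Finset Tag) (hI m S) :
    (amp I hI m S).dual = plus I hI m fun i => (S i).dual := dual_eq _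
@[simp] theorem dual_tensor (S T : SType Tag) : (tensor S T).dual = par S.dual T.dual :=
  (dual_eq _).trans (mk_par _)
@[simp] theorem dual_par (S T : SType Tag) : (par S T).dual = tensor S.dual T.dual :=
  (dual_eq _).trans (mk_tensor _)

theorem pos_dual (S : SType Tag) : S.dual.Pos ↔ ¬ S.Pos := by
  refine shape_cases S ?_ ?_ ?_ ?_ ?_ ?_ <;> intros <;>
    simp only [dual_one, dual_bot, dual_plus, dual_amp, dual_tensor, dual_par] <;>
    first
    | exact ⟨fun h => False.elim h, fun h => h trivial⟩
    | exact ⟨fun _ h => h, fun _ => trivial⟩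

/-- Coinduction on session types, in terms of the six type constructors. -/
theorem eq_of_bisim (R : SType Tag → SType Tag → Prop)
    (h : ∀ S T, R S T → S = T ∨
      (∃ I hI m f g, S = plus I hI m f ∧ T = plus I hI m g ∧ ∀ i, R (f i) (g i)) ∨
      (∃ I hI m f g, S = amp I hI m f ∧ T = amp I hI m g ∧ ∀ i, R (f i) (g i)) ∨
      (∃ S₁ S₂ T₁ T₂, S = tensor S₁ S₂ ∧ T = tensor T₁ T₂ ∧ (S₁ = T₁ ∨ R S₁ T₁) ∧ R S₂ T₂) ∨
      (∃ S₁ S₂ T₁ T₂, S = par S₁ S₂ ∧ T = par T₁ T₂ ∧ (S₁ = T₁ ∨ R S₁ T₁) ∧ R S₂ T₂))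
    {S T : SType Tag} (hST : R S T) : S = T := by
  refine PFunctor.M.bisim (fun S T => S = T ∨ R S T) ?_ S T (.inr hST)
  intro S T hST
  have hrefl : ∀ U : SType Tag, ∃ a f f', PFunctor.M.dest U = ⟨a, f⟩ ∧ PFunctor.M.dest U = ⟨a, f'⟩ ∧
      ∀ i, f i = f' i ∨ R (f i) (f' i) :=
    fun U => ⟨U.dest.1, U.dest.2, U.dest.2, rfl, rfl, fun _ => .inl rfl⟩
  rcases hST with rfl | hST
  · exact hrefl S
  rcases h S T hST with rfl | ⟨I, hI, m, f, g, rfl, rfl, hR⟩ | ⟨I, hI, m, f, g, rfl, rfl, hR⟩ |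
    ⟨S₁, S₂, T₁, T₂, rfl, rfl, h1, h2⟩ | ⟨S₁, S₂, T₁, T₂, rfl, rfl, h1, h2⟩
  · exact hrefl S
  · exact ⟨Shape.plus I hI m, f, g, rfl, rfl, fun i => .inr (hR i)⟩
  · exact ⟨Shape.amp I hI m, f, g, rfl, rfl, fun i => .inr (hR i)⟩
  · refine ⟨Shape.tensor, _, _, rfl, rfl, fun i => ?_⟩
    cases i
    · exact h1
    · exact .inr h2
  · refine ⟨Shape.par, _, _, rfl, rfl, fun i => ?_⟩
    cases i
    · exact h1
    · exact .inr h2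

@[simp] theorem dual_dual (S : SType Tag) : S.dual.dual = S := by
  refine eq_of_bisim (fun U S => U = S.dual.dual) ?_ rfl
  rintro _ S rfl
  refine shape_cases S ?_ ?_ ?_ ?_ ?_ ?_
  · simp
  · simp
  · intro I hI m S
    exact .inr (.inl ⟨I, hI, m, _, S, by simp, rfl, fun i => rfl⟩)
  · intro I hI m S
    exact .inr (.inr (.inl ⟨I, hI, m, _, S, by simp, rfl, fun i => rfl⟩))
  · intro S T
    exact .inr (.inr (.inr (.inl
      ⟨_, _, S, T, by simp only [dual_tensor, dual_par], rfl, .inr rfl, rfl⟩)))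
  · intro S T
    exact .inr (.inr (.inr (.inr
      ⟨_, _, S, T, by simp only [dual_tensor, dual_par], rfl, .inr rfl, rfl⟩)))

/-! ### Regular session types -/

theorem Regular.child {S T : SType Tag} (hS : S.Regular) (h : Child T S) : T.Regular :=
  hS.subset fun _ hU => hU.tail h

theorem regular_of_children {S : SType Tag}
    (h : ∃ F : Set (SType Tag), F.Finite ∧ ∀ T, Child T S → T.Regular ∧ T ∈ F) : S.Regular := by
  obtain ⟨F, hF, h⟩ := h
  refine ((hF.sep Regular).biUnion (t := fun T => {U | Relation.ReflTransGen Child U T})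
    (fun T hT => hT.2) |>.insert S).subset ?_
  intro U hU
  rcases Relation.ReflTransGen.cases_tail hU with rfl | ⟨T, hUT, hT⟩
  · exact .inl rfl
  · exact .inr (Set.mem_biUnion (x := T) ⟨(h T hT).2, (h T hT).1⟩ hUT)

theorem child_plus (I : Finset Tag) (hI m S) (k : I) : Child (S k) (plus I hI m S) := ⟨k, rfl⟩
theorem child_amp (I : Finset Tag) (hI m S) (k : I) : Child (S k) (amp I hI m S) := ⟨k, rfl⟩
theorem child_tensor_left (S T : SType Tag) : Child S (tensor S T) := ⟨false, rfl⟩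
theorem child_tensor_right (S T : SType Tag) : Child T (tensor S T) := ⟨true, rfl⟩
theorem child_par_left (S T : SType Tag) : Child S (par S T) := ⟨false, rfl⟩
theorem child_par_right (S T : SType Tag) : Child T (par S T) := ⟨true, rfl⟩

theorem not_child_one (T : SType Tag) : ¬ Child T one := fun ⟨i, _⟩ => Empty.elim i
theorem not_child_bot (T : SType Tag) : ¬ Child T bot := fun ⟨i, _⟩ => Empty.elim i
theorem child_tensor_iff {S T U : SType Tag} : Child U (tensor S T) ↔ U = S ∨ U = T :=
  ⟨fun ⟨i, h⟩ => by cases i; exacts [.inl h, .inr h],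
    fun h => h.elim (fun h => ⟨false, h⟩) (fun h => ⟨true, h⟩)⟩
theorem child_par_iff {S T U : SType Tag} : Child U (par S T) ↔ U = S ∨ U = T :=
  ⟨fun ⟨i, h⟩ => by cases i; exacts [.inl h, .inr h],
    fun h => h.elim (fun h => ⟨false, h⟩) (fun h => ⟨true, h⟩)⟩

theorem regular_singleton_plus {a : Tag} {m : ℕ} {S : SType Tag} (hS : S.Regular) :
    (plus {a} (Finset.singleton_nonempty a) (fun _ => m) fun _ => S).Regular :=
  regular_of_children ⟨{S}, Set.finite_singleton S, by rintro _ ⟨_, rfl⟩; exact ⟨hS, rfl⟩⟩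

theorem regular_tensor {S T : SType Tag} (hS : S.Regular) (hT : T.Regular) :
    (tensor S T).Regular :=
  regular_of_children ⟨{S, T}, Set.toFinite _, by
    intro U hU
    rcases child_tensor_iff.1 hU with rfl | rfl
    · exact ⟨hS, .inl rfl⟩
    · exact ⟨hT, .inr rfl⟩⟩

theorem child_dual {S T : SType Tag} (h : Child T S.dual) : ∃ U, Child U S ∧ T = U.dual := by
  revert h
  refine shape_cases S ?_ ?_ ?_ ?_ ?_ ?_
  · intro h; rw [dual_one] at h; exact (not_child_bot _ h).elim
  · intro h; rw [dual_bot] at h; exact (not_child_one _ h).elim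
  · intro I hI m S h
    rw [dual_plus] at h
    obtain ⟨k, rfl⟩ := h
    exact ⟨_, child_plus I hI m S k, rfl⟩
  · intro I hI m S h
    rw [dual_amp] at h
    obtain ⟨k, rfl⟩ := h
    exact ⟨_, child_amp I hI m S k, rfl⟩
  · intro S T h
    rw [dual_tensor, child_par_iff] at h
    rcases h with rfl | rfl
    · exact ⟨_, child_tensor_left _ _, rfl⟩
    · exact ⟨_, child_tensor_right _ _, rfl⟩
  · intro S T h
    rw [dual_par, child_tensor_iff] at h
    rcases h with rfl | rfl
    · exact ⟨_, child_par_left _ _, rfl⟩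
    · exact ⟨_, child_par_right _ _, rfl⟩

theorem Regular.dual {S : SType Tag} (hS : S.Regular) : S.dual.Regular := by
  refine (Set.Finite.image SType.dual hS).subset ?_
  intro U hU
  induction hU using Relation.ReflTransGen.head_induction_on with
  | refl => exact ⟨S, .refl, rfl⟩
  | head h _ ih =>
    obtain ⟨V, hV, rfl⟩ := ih
    obtain ⟨W, hW, rfl⟩ := child_dual h
    exact ⟨W, .head hW hV, rfl⟩

end SType

/-! ### Transitions -/

section Transitions

variable {Tag : Type}

theorem TransRule.mono {R R' : SType Tag → Act Tag → SType Tag → Prop}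
    (h : ∀ S α T, R S α T → R' S α T) {S α T} (hS : TransRule R S α T) : TransRule R' S α T := by
  cases hS with
  | must_one => exact .must_one
  | must_bot => exact .must_bot
  | must_plus => exact .must_plus _ _ _ _ _
  | must_amp => exact .must_amp _ _ _ _ _
  | must_tensor => exact .must_tensor _ _
  | must_par => exact .must_par _ _
  | may_plus I hI m S T σ hR => exact .may_plus I hI m S T σ fun i => h _ _ _ (hR i)
  | may_amp I hI m S T σ hR => exact .may_amp I hI m S T σ fun i => h _ _ _ (hR i)
  | may_tensor U S T σ hR => exact .may_tensor U S T σ (h _ _ _ hR)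
  | may_par U S T σ hR => exact .may_par U S T σ (h _ _ _ hR)

theorem Trans.rule {S : SType Tag} {α T} (h : Trans S α T) : TransRule Trans S α T := by
  obtain ⟨R, hR, h⟩ := h
  exact (hR _ _ _ h).1.mono fun _ _ _ h' => ⟨R, hR, h'⟩

theorem Trans.ind {S : SType Tag} {α T} (h : Trans S α T) : IndTrans S α T := by
  obtain ⟨R, hR, h⟩ := h
  exact (hR _ _ _ h).2

theorem TransRule.trans {S : SType Tag} {α T} (h : TransRule Trans S α T) : Trans S α T := by
  refine ⟨fun S α T => TransRule Trans S α T,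
    fun S α T h => ⟨h.mono fun _ _ _ => Trans.rule, ?_⟩, h⟩
  cases h with
  | must_one => exact .must_one
  | must_bot => exact .must_bot
  | must_plus => exact .must_plus _ _ _ _ _
  | must_amp => exact .must_amp _ _ _ _ _
  | must_tensor => exact .must_tensor _ _
  | must_par => exact .must_par _ _
  | may_plus I hI m S T σ hR => exact .may_plus I hI m S T σ fun i => (hR i).ind
  | may_amp I hI m S T σ hR => exact .may_amp I hI m S T σ fun i => (hR i).ind
  | may_tensor U S T σ hR => exact .may_tensor U S T σ hR.ind
  | may_par U S T σ hR => exact .may_par U S T σ hR.ind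

/-- What the transition rules say about a source type with the given topmost constructor. -/
def TransInv : (shapeFunctor Tag).Obj (SType Tag) → Act Tag → SType Tag → Prop
  | ⟨.one, _⟩, α, T => α = .out .star ∧ T = .one
  | ⟨.bot, _⟩, α, T => α = .inp .star ∧ T = .bot
  | ⟨.plus I hI m, f⟩, α, T => (∃ k : I, α = .out (.tag (m k) k) ∧ T = f k) ∨
      ∃ (σ : _) (T' : I → SType Tag), α = .inp σ ∧ (∀ i : I, Trans (f i) (.inp σ) (T' i)) ∧
        T = .plus I hI m T'
  | ⟨.amp I hI m, f⟩, α, T => (∃ k : I, α = .inp (.tag (m k) k) ∧ T = f k) ∨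
      ∃ (σ : _) (T' : I → SType Tag), α = .out σ ∧ (∀ i : I, Trans (f i) (.out σ) (T' i)) ∧
        T = .amp I hI m T'
  | ⟨.tensor, f⟩, α, T => (α = .out (.chan (f false)) ∧ T = f true) ∨
      ∃ σ T', α = .inp σ ∧ Trans (f true) (.inp σ) T' ∧ T = .tensor (f false) T'
  | ⟨.par, f⟩, α, T => (α = .inp (.chan (f false)) ∧ T = f true) ∨
      ∃ σ T', α = .out σ ∧ Trans (f true) (.out σ) T' ∧ T = .par (f false) T'

theorem Trans.inv {S : SType Tag} {α T} (h : Trans S α T) : TransInv S.dest α T := by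
  cases h.rule with
  | must_one => exact ⟨rfl, rfl⟩
  | must_bot => exact ⟨rfl, rfl⟩
  | must_plus I hI m S k => exact .inl ⟨k, rfl, rfl⟩
  | must_amp I hI m S k => exact .inl ⟨k, rfl, rfl⟩
  | must_tensor => exact .inl ⟨rfl, rfl⟩
  | must_par => exact .inl ⟨rfl, rfl⟩
  | may_plus I hI m S T σ hR => exact .inr ⟨σ, T, rfl, hR, rfl⟩
  | may_amp I hI m S T σ hR => exact .inr ⟨σ, T, rfl, hR, rfl⟩
  | may_tensor U S T σ hR => exact .inr ⟨σ, T, rfl, hR, rfl⟩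
  | may_par U S T σ hR => exact .inr ⟨σ, T, rfl, hR, rfl⟩

theorem Trans.plus {I : Finset Tag} {hI m S α} {T : SType Tag} (h : Trans (.plus I hI m S) α T) :
    (∃ k : I, α = .out (.tag (m k) k) ∧ T = S k) ∨
      ∃ σ T', α = .inp σ ∧ (∀ i, Trans (S i) (.inp σ) (T' i)) ∧ T = .plus I hI m T' := h.inv

theorem Trans.amp {I : Finset Tag} {hI m S α} {T : SType Tag} (h : Trans (.amp I hI m S) α T) :
    (∃ k : I, α = .inp (.tag (m k) k) ∧ T = S k) ∨
      ∃ σ T', α = .out σ ∧ (∀ i, Trans (S i) (.out σ) (T' i)) ∧ T = .amp I hI m T' := h.inv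

theorem Trans.tensor {U S α} {T : SType Tag} (h : Trans (.tensor U S) α T) :
    (α = .out (.chan U) ∧ T = S) ∨
      ∃ σ T', α = .inp σ ∧ Trans S (.inp σ) T' ∧ T = .tensor U T' := h.inv

theorem Trans.par {U S α} {T : SType Tag} (h : Trans (.par U S) α T) :
    (α = .inp (.chan U) ∧ T = S) ∨
      ∃ σ T', α = .out σ ∧ Trans S (.out σ) T' ∧ T = .par U T' := h.inv

theorem trans_one_iff {α} {T : SType Tag} : Trans .one α T ↔ α = .out .star ∧ T = .one :=
  ⟨fun h => h.inv, by rintro ⟨rfl, rfl⟩; exact (TransRule.must_one).trans⟩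

theorem trans_bot_iff {α} {T : SType Tag} : Trans .bot α T ↔ α = .inp .star ∧ T = .bot :=
  ⟨fun h => h.inv, by rintro ⟨rfl, rfl⟩; exact (TransRule.must_bot).trans⟩

theorem trans_plus_out_iff {I : Finset Tag} {hI m S σ} {T : SType Tag} :
    Trans (.plus I hI m S) (.out σ) T ↔ ∃ k : I, σ = .tag (m k) k ∧ T = S k := by
  constructor
  · intro h
    rcases h.plus with ⟨k, e, rfl⟩ | ⟨_, _, e, _⟩
    · exact ⟨k, Act.out.inj e, rfl⟩
    · cases e
  · rintro ⟨k, rfl, rfl⟩; exact (TransRule.must_plus ..).trans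

theorem trans_amp_inp_iff {I : Finset Tag} {hI m S σ} {T : SType Tag} :
    Trans (.amp I hI m S) (.inp σ) T ↔ ∃ k : I, σ = .tag (m k) k ∧ T = S k := by
  constructor
  · intro h
    rcases h.amp with ⟨k, e, rfl⟩ | ⟨_, _, e, _⟩
    · exact ⟨k, Act.inp.inj e, rfl⟩
    · cases e
  · rintro ⟨k, rfl, rfl⟩; exact (TransRule.must_amp ..).trans

theorem trans_plus_inp_iff {I : Finset Tag} {hI m S σ} {T : SType Tag} :
    Trans (.plus I hI m S) (.inp σ) T ↔
      ∃ T', (∀ i, Trans (S i) (.inp σ) (T' i)) ∧ T = .plus I hI m T' := by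
  constructor
  · intro h
    rcases h.plus with ⟨k, e, rfl⟩ | ⟨_, T', e, h', rfl⟩
    · cases e
    · cases e; exact ⟨T', h', rfl⟩
  · rintro ⟨T', h, rfl⟩; exact (TransRule.may_plus _ _ _ _ _ _ h).trans

theorem trans_amp_out_iff {I : Finset Tag} {hI m S σ} {T : SType Tag} :
    Trans (.amp I hI m S) (.out σ) T ↔
      ∃ T', (∀ i, Trans (S i) (.out σ) (T' i)) ∧ T = .amp I hI m T' := by
  constructor
  · intro h
    rcases h.amp with ⟨k, e, rfl⟩ | ⟨_, T', e, h', rfl⟩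
    · cases e
    · cases e; exact ⟨T', h', rfl⟩
  · rintro ⟨T', h, rfl⟩; exact (TransRule.may_amp _ _ _ _ _ _ h).trans

theorem trans_tensor_out_iff {U S σ} {T : SType Tag} :
    Trans (.tensor U S) (.out σ) T ↔ σ = .chan U ∧ T = S := by
  constructor
  · intro h
    rcases h.tensor with ⟨e, rfl⟩ | ⟨_, _, e, _⟩
    · exact ⟨Act.out.inj e, rfl⟩
    · cases e
  · rintro ⟨rfl, rfl⟩; exact (TransRule.must_tensor ..).trans

theorem trans_par_inp_iff {U S σ} {T : SType Tag} :
    Trans (.par U S) (.inp σ) T ↔ σ = .chan U ∧ T = S := by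
  constructor
  · intro h
    rcases h.par with ⟨e, rfl⟩ | ⟨_, _, e, _⟩
    · exact ⟨Act.inp.inj e, rfl⟩
    · cases e
  · rintro ⟨rfl, rfl⟩; exact (TransRule.must_par ..).trans

theorem trans_tensor_inp_iff {U S σ} {T : SType Tag} :
    Trans (.tensor U S) (.inp σ) T ↔ ∃ T', Trans S (.inp σ) T' ∧ T = .tensor U T' := by
  constructor
  · intro h
    rcases h.tensor with ⟨e, rfl⟩ | ⟨_, T', e, h', rfl⟩
    · cases e
    · cases e; exact ⟨T', h', rfl⟩
  · rintro ⟨T', h, rfl⟩; exact (TransRule.may_tensor _ _ _ _ h).trans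

theorem trans_par_out_iff {U S σ} {T : SType Tag} :
    Trans (.par U S) (.out σ) T ↔ ∃ T', Trans S (.out σ) T' ∧ T = .par U T' := by
  constructor
  · intro h
    rcases h.par with ⟨e, rfl⟩ | ⟨_, T', e, h', rfl⟩
    · cases e
    · cases e; exact ⟨T', h', rfl⟩
  · rintro ⟨T', h, rfl⟩; exact (TransRule.may_par _ _ _ _ h).trans

/-- A type and an action determine the target: the targets of two transitions are bisimilar. -/
theorem Trans.unique {S : SType Tag} {α T T'} (h : Trans S α T) (h' : Trans S α T') : T = T' := by
  refine SType.eq_of_bisim (fun T T' => T = T' ∨ ∃ S α, Trans S α T ∧ Trans S α T') ?_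
    (.inr ⟨S, α, h, h'⟩)
  rintro T T' (h | ⟨S, α, h, h'⟩)
  · exact .inl h
  revert h h'
  refine SType.shape_cases S ?_ ?_ ?_ ?_ ?_ ?_
  · intro h h'
    exact .inl ((trans_one_iff.1 h).2.trans (trans_one_iff.1 h').2.symm)
  · intro h h'
    exact .inl ((trans_bot_iff.1 h).2.trans (trans_bot_iff.1 h').2.symm)
  · intro I hI m S h h'
    rcases α with σ | σ
    · obtain ⟨U, hU, rfl⟩ := trans_plus_inp_iff.1 h
      obtain ⟨U', hU', rfl⟩ := trans_plus_inp_iff.1 h'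
      exact .inr (.inl ⟨_, _, _, _, _, rfl, rfl, fun i => .inr ⟨_, _, hU i, hU' i⟩⟩)
    · obtain ⟨k, rfl, rfl⟩ := trans_plus_out_iff.1 h
      obtain ⟨k', hk, rfl⟩ := trans_plus_out_iff.1 h'
      rw [Subtype.ext (Msg.tag.inj hk).2]
      exact .inl rfl
  · intro I hI m S h h'
    rcases α with σ | σ
    · obtain ⟨k, rfl, rfl⟩ := trans_amp_inp_iff.1 h
      obtain ⟨k', hk, rfl⟩ := trans_amp_inp_iff.1 h'
      rw [Subtype.ext (Msg.tag.inj hk).2]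
      exact .inl rfl
    · obtain ⟨U, hU, rfl⟩ := trans_amp_out_iff.1 h
      obtain ⟨U', hU', rfl⟩ := trans_amp_out_iff.1 h'
      exact .inr (.inr (.inl ⟨_, _, _, _, _, rfl, rfl, fun i => .inr ⟨_, _, hU i, hU' i⟩⟩))
  · intro U S h h'
    rcases α with σ | σ
    · obtain ⟨V, hV, rfl⟩ := trans_tensor_inp_iff.1 h
      obtain ⟨V', hV', rfl⟩ := trans_tensor_inp_iff.1 h'
      exact .inr (.inr (.inr (.inl ⟨_, _, _, _, rfl, rfl, .inl rfl, .inr ⟨_, _, hV, hV'⟩⟩)))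
    · exact .inl ((trans_tensor_out_iff.1 h).2.trans (trans_tensor_out_iff.1 h').2.symm)
  · intro U S h h'
    rcases α with σ | σ
    · exact .inl ((trans_par_inp_iff.1 h).2.trans (trans_par_inp_iff.1 h').2.symm)
    · obtain ⟨V, hV, rfl⟩ := trans_par_out_iff.1 h
      obtain ⟨V', hV', rfl⟩ := trans_par_out_iff.1 h'
      exact .inr (.inr (.inr (.inr ⟨_, _, _, _, rfl, rfl, .inl rfl, .inr ⟨_, _, hV, hV'⟩⟩)))

/-- A transition rewrites a type along a path from its root, so a subtree of the target either
occurs in the source or is itself the target of a transition of a subtree of the source. -/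
theorem Trans.child {S : SType Tag} {α T T'} (h : Trans S α T) (hT : SType.Child T' T) :
    SType.Child T S ∨ SType.Child T' S ∨ ∃ S', SType.Child S' S ∧ Trans S' α T' := by
  revert h
  refine SType.shape_cases S ?_ ?_ ?_ ?_ ?_ ?_
  · intro h
    obtain ⟨-, rfl⟩ := trans_one_iff.1 h
    exact .inr (.inl hT)
  · intro h
    obtain ⟨-, rfl⟩ := trans_bot_iff.1 h
    exact .inr (.inl hT)
  · intro I hI m S h
    rcases α with σ | σ
    · obtain ⟨U, hU, rfl⟩ := trans_plus_inp_iff.1 h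
      obtain ⟨k, rfl⟩ := hT
      exact .inr (.inr ⟨_, SType.child_plus _ _ _ _ k, hU k⟩)
    · obtain ⟨k, rfl, rfl⟩ := trans_plus_out_iff.1 h
      exact .inl (SType.child_plus _ _ _ _ k)
  · intro I hI m S h
    rcases α with σ | σ
    · obtain ⟨k, rfl, rfl⟩ := trans_amp_inp_iff.1 h
      exact .inl (SType.child_amp _ _ _ _ k)
    · obtain ⟨U, hU, rfl⟩ := trans_amp_out_iff.1 h
      obtain ⟨k, rfl⟩ := hT
      exact .inr (.inr ⟨_, SType.child_amp _ _ _ _ k, hU k⟩)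
  · intro U S h
    rcases α with σ | σ
    · obtain ⟨V, hV, rfl⟩ := trans_tensor_inp_iff.1 h
      rcases SType.child_tensor_iff.1 hT with rfl | rfl
      · exact .inr (.inl (SType.child_tensor_left _ _))
      · exact .inr (.inr ⟨_, SType.child_tensor_right _ _, hV⟩)
    · obtain ⟨-, rfl⟩ := trans_tensor_out_iff.1 h
      exact .inl (SType.child_tensor_right _ _)
  · intro U S h
    rcases α with σ | σ
    · obtain ⟨-, rfl⟩ := trans_par_inp_iff.1 h
      exact .inl (SType.child_par_right _ _)
    · obtain ⟨V, hV, rfl⟩ := trans_par_out_iff.1 h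
      rcases SType.child_par_iff.1 hT with rfl | rfl
      · exact .inr (.inl (SType.child_par_left _ _))
      · exact .inr (.inr ⟨_, SType.child_par_right _ _, hV⟩)

/-- Since transitions are deterministic, the subtrees of the target are subtrees of the source or
targets of transitions of such subtrees, so there are finitely many of them. -/
theorem Trans.regular {S : SType Tag} {α T} (h : Trans S α T) (hS : S.Regular) : T.Regular := by
  classical
  let F : Set (SType Tag) := {U | Relation.ReflTransGen SType.Child U S}
  let f : SType Tag → SType Tag := fun U => if hU : ∃ V, Trans U α V then hU.choose else U
  have hf : ∀ {U V}, Trans U α V → V = f U := by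
    intro U V hV
    have hU : ∃ V, Trans U α V := ⟨V, hV⟩
    simp only [f, dif_pos hU]
    exact hV.unique hU.choose_spec
  have hF : F.Finite := hS
  refine (hF.union (hF.image f)).subset ?_
  intro U hU
  have key : U ∈ F ∨ ∃ V ∈ F, Trans V α U := by
    induction hU using Relation.ReflTransGen.head_induction_on with
    | refl => exact .inr ⟨S, .refl, h⟩
    | head hc _ ih =>
      rcases ih with ih | ⟨V, hV, hVU⟩
      · exact .inl (.head hc ih)
      · rcases hVU.child hc with h1 | h1 | ⟨W, hW, h1⟩
        · exact .inl (.head hc (.head h1 hV))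
        · exact .inl (.head h1 hV)
        · exact .inr ⟨W, .head hW hV, h1⟩
  rcases key with h1 | ⟨V, hV, h1⟩
  · exact .inl h1
  · exact .inr ⟨V, hV, (hf h1).symm⟩

/-- The type received in an input occurs in the source; the finite derivation of the transition
leads to an occurrence. -/
theorem Trans.regular_msg {S : SType Tag} {U T} (h : Trans S (.inp (.chan U)) T)
    (hS : S.Regular) : U.Regular := by
  have key : ∀ {S α T}, IndTrans S α T → α = .inp (.chan U) → S.Regular → U.Regular := by
    intro S α T h
    induction h with
    | must_one => intro h; cases h
    | must_bot => intro h; cases h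
    | must_plus => intro h; cases h
    | must_amp => intro h; cases h
    | must_tensor => intro h; cases h
    | must_par => intro h hS; cases h; exact hS.child (SType.child_par_left _ _)
    | may_plus I hI m S T σ _ ih =>
      exact fun h hS => ih ⟨_, hI.choose_spec⟩ h (hS.child (SType.child_plus ..))
    | may_amp I hI m S T σ _ ih =>
      exact fun h hS => ih ⟨_, hI.choose_spec⟩ h (hS.child (SType.child_amp ..))
    | may_tensor U S T σ _ ih => exact fun h hS => ih h (hS.child (SType.child_tensor_right ..))
    | may_par U S T σ _ ih => exact fun h hS => ih h (hS.child (SType.child_par_right ..))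
    | fair_plus I hI m S T σ k _ ih => exact fun h hS => ih h (hS.child (SType.child_plus ..))
    | fair_amp I hI m S T σ k _ ih => exact fun h hS => ih h (hS.child (SType.child_amp ..))
  exact key h.ind rfl hS

/-- Inputs and outputs of the same type commute. -/
theorem Trans.diamond {S : SType Tag} {σ τ S₁ S₂} (h₁ : Trans S (.inp σ) S₁)
    (h₂ : Trans S (.out τ) S₂) : ∃ T, Trans S₁ (.out τ) T ∧ Trans S₂ (.inp σ) T := by
  revert h₁ h₂
  refine SType.shape_cases S ?_ ?_ ?_ ?_ ?_ ?_
  · intro h; cases (trans_one_iff.1 h).1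
  · intro _ h; cases (trans_bot_iff.1 h).1
  · intro I hI m S h₁ h₂
    obtain ⟨U, hU, rfl⟩ := trans_plus_inp_iff.1 h₁
    obtain ⟨k, rfl, rfl⟩ := trans_plus_out_iff.1 h₂
    exact ⟨U k, trans_plus_out_iff.2 ⟨k, rfl, rfl⟩, hU k⟩
  · intro I hI m S h₁ h₂
    obtain ⟨U, hU, rfl⟩ := trans_amp_out_iff.1 h₂
    obtain ⟨k, rfl, rfl⟩ := trans_amp_inp_iff.1 h₁
    exact ⟨U k, hU k, trans_amp_inp_iff.2 ⟨k, rfl, rfl⟩⟩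
  · intro U S h₁ h₂
    obtain ⟨V, hV, rfl⟩ := trans_tensor_inp_iff.1 h₁
    obtain ⟨rfl, rfl⟩ := trans_tensor_out_iff.1 h₂
    exact ⟨V, trans_tensor_out_iff.2 ⟨rfl, rfl⟩, hV⟩
  · intro U S h₁ h₂
    obtain ⟨V, hV, rfl⟩ := trans_par_out_iff.1 h₂
    obtain ⟨rfl, rfl⟩ := trans_par_inp_iff.1 h₁
    exact ⟨V, hV, trans_par_inp_iff.2 ⟨rfl, rfl⟩⟩

/-- The message exchanged by the dual type. Only the type of a transmitted channel changes, because
duality is hereditary on both components of `⊗` and `⅋`. -/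
def Msg.dual : Msg Tag → Msg Tag
  | .star => .star
  | .tag m a => .tag m a
  | .chan S => .chan S.dual

/-- The action of the dual type: inputs and outputs are exchanged. -/
def Act.dual : Act Tag → Act Tag
  | .inp σ => .out σ.dual
  | .out σ => .inp σ.dual

theorem Msg.dual_of_ne {σ : Msg Tag} (h : ∀ U, σ ≠ .chan U) : σ.dual = σ := by
  cases σ with
  | star => rfl
  | tag => rfl
  | chan U => exact (h U rfl).elim

theorem IndTrans.dual {S : SType Tag} {α T} (h : IndTrans S α T) :
    IndTrans S.dual α.dual T.dual := by
  induction h with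
  | must_one => simpa [Act.dual, Msg.dual] using IndTrans.must_bot
  | must_bot => simpa [Act.dual, Msg.dual] using IndTrans.must_one
  | must_plus I hI m S k =>
    simpa [Act.dual, Msg.dual] using IndTrans.must_amp I hI m (fun i => (S i).dual) k
  | must_amp I hI m S k =>
    simpa [Act.dual, Msg.dual] using IndTrans.must_plus I hI m (fun i => (S i).dual) k
  | must_tensor S T => simpa [Act.dual, Msg.dual] using IndTrans.must_par S.dual T.dual
  | must_par S T => simpa [Act.dual, Msg.dual] using IndTrans.must_tensor S.dual T.dual
  | may_plus I hI m S T σ _ ih => simpa [Act.dual, Msg.dual] using IndTrans.may_amp I hI m _ _ _ ih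
  | may_amp I hI m S T σ _ ih => simpa [Act.dual, Msg.dual] using IndTrans.may_plus I hI m _ _ _ ih
  | may_tensor U S T σ _ ih => simpa [Act.dual, Msg.dual] using IndTrans.may_par _ _ _ _ ih
  | may_par U S T σ _ ih => simpa [Act.dual, Msg.dual] using IndTrans.may_tensor _ _ _ _ ih
  | fair_plus I hI m S T σ k _ ih =>
    simpa [Act.dual, Msg.dual] using
      IndTrans.fair_amp I hI m (fun i => (S i).dual) (fun i => (T i).dual) _ k ih
  | fair_amp I hI m S T σ k _ ih =>
    simpa [Act.dual, Msg.dual] using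
      IndTrans.fair_plus I hI m (fun i => (S i).dual) (fun i => (T i).dual) _ k ih

theorem Trans.dual {S : SType Tag} {α T} (h : Trans S α T) : Trans S.dual α.dual T.dual := by
  refine ⟨fun S' α' T' => ∃ S α T, Trans S α T ∧ S' = S.dual ∧ α' = α.dual ∧ T' = T.dual, ?_,
    S, α, T, h, rfl, rfl, rfl⟩
  rintro _ _ _ ⟨S, α, T, h, rfl, rfl, rfl⟩
  refine ⟨?_, h.ind.dual⟩
  cases h.rule with
  | must_one => simpa [Act.dual, Msg.dual] using TransRule.must_bot
  | must_bot => simpa [Act.dual, Msg.dual] using TransRule.must_one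
  | must_plus I hI m S k =>
    simpa [Act.dual, Msg.dual] using TransRule.must_amp I hI m (fun i => (S i).dual) k
  | must_amp I hI m S k =>
    simpa [Act.dual, Msg.dual] using TransRule.must_plus I hI m (fun i => (S i).dual) k
  | must_tensor S T => simpa [Act.dual, Msg.dual] using TransRule.must_par S.dual T.dual
  | must_par S T => simpa [Act.dual, Msg.dual] using TransRule.must_tensor S.dual T.dual
  | may_plus I hI m S T σ hR =>
    rw [SType.dual_plus, SType.dual_plus]
    exact TransRule.may_amp I hI m _ _ _ fun i => ⟨_, _, _, hR i, rfl, rfl, rfl⟩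
  | may_amp I hI m S T σ hR =>
    rw [SType.dual_amp, SType.dual_amp]
    exact TransRule.may_plus I hI m _ _ _ fun i => ⟨_, _, _, hR i, rfl, rfl, rfl⟩
  | may_tensor U S T σ hR =>
    rw [SType.dual_tensor, SType.dual_tensor]
    exact TransRule.may_par _ _ _ _ ⟨_, _, _, hR, rfl, rfl, rfl⟩
  | may_par U S T σ hR =>
    rw [SType.dual_par, SType.dual_par]
    exact TransRule.may_tensor _ _ _ _ ⟨_, _, _, hR, rfl, rfl, rfl⟩

theorem Trans.dual_out {S : SType Tag} {σ T} (h : Trans S.dual (.out σ) T) :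
    Trans S (.inp σ.dual) T.dual := by
  simpa [Act.dual] using h.dual

theorem Trans.dual_inp {S : SType Tag} {σ T} (h : Trans S.dual (.inp σ) T) :
    Trans S (.out σ.dual) T.dual := by
  simpa [Act.dual] using h.dual

end Transitions

/-! ### Correct composition and subtyping -/

section Composition

variable {Tag : Type}

theorem isCorrectComposition_correct : IsCorrectComposition (Correct (Tag := Tag)) where
  pol := fun _ _ ⟨_, hR, h⟩ => hR.pol _ _ h
  inp_out := fun _ _ ⟨R, hR, h⟩ σ T' hσ hT =>
    (hR.inp_out _ _ h σ T' hσ hT).imp fun _ h => ⟨h.1, R, hR, h.2⟩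
  out_inp := fun _ _ ⟨R, hR, h⟩ σ T' hσ hT =>
    (hR.out_inp _ _ h σ T' hσ hT).imp fun _ h => ⟨h.1, R, hR, h.2⟩
  inp_out_chan := fun _ _ ⟨R, hR, h⟩ T₁ T₂ hT => by
    obtain ⟨S₁, S₂, h1, h2, h3⟩ := hR.inp_out_chan _ _ h T₁ T₂ hT
    exact ⟨S₁, S₂, h1, ⟨R, hR, h2⟩, ⟨R, hR, h3⟩⟩
  out_inp_chan := fun _ _ ⟨R, hR, h⟩ T₁ T₂ hT => by
    obtain ⟨S₁, S₂, h1, h2, h3⟩ := hR.out_inp_chan _ _ h T₁ T₂ hT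
    exact ⟨S₁, S₂, h1, ⟨R, hR, h2⟩, ⟨R, hR, h3⟩⟩

theorem IsCorrectComposition.flip {R : SType Tag → SType Tag → Prop}
    (hR : IsCorrectComposition R) : IsCorrectComposition fun S T => R T S where
  pol := fun S T h => (hR.pol T S h).symm
  inp_out := fun S T h => hR.out_inp T S h
  out_inp := fun S T h => hR.inp_out T S h
  inp_out_chan := fun S T h => hR.out_inp_chan T S h
  out_inp_chan := fun S T h => hR.inp_out_chan T S h

theorem Correct.symm {S T : SType Tag} : Correct S T → Correct T S :=
  fun ⟨_, hR, h⟩ => ⟨_, hR.flip, h⟩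

theorem correct_dual (S : SType Tag) : Correct S S.dual := by
  refine ⟨fun S T => T = S.dual, ⟨?_, ?_, ?_, ?_, ?_⟩, rfl⟩
  · rintro S _ rfl
    rw [SType.pos_dual]
    exact em _
  · rintro S _ rfl σ T' hσ h
    refine ⟨T'.dual, ?_, by simp⟩
    simpa [Msg.dual_of_ne hσ] using h.dual_out
  · rintro S _ rfl σ T' hσ h
    refine ⟨T'.dual, ?_, rfl⟩
    simpa [Act.dual, Msg.dual_of_ne hσ] using h.dual
  · rintro S _ rfl T₁ T₂ h
    exact ⟨T₁.dual, T₂.dual, h.dual_out, by simp, by simp⟩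
  · rintro S _ rfl T₁ T₂ h
    exact ⟨T₁.dual, T₂.dual, h.dual, rfl, rfl⟩

/-- Correct composition is closed under composition along a type and its dual, like a cut. -/
theorem Correct.cut {A B C : SType Tag} (h₁ : Correct A B) (h₂ : Correct B.dual C) :
    Correct A C := by
  have hc := isCorrectComposition_correct (Tag := Tag)
  refine ⟨fun A C => ∃ B, Correct A B ∧ Correct B.dual C, ⟨?_, ?_, ?_, ?_, ?_⟩, B, h₁, h₂⟩
  · rintro A C ⟨B, h₁, h₂⟩
    have h3 := hc.pol _ _ h₁
    have h4 := hc.pol _ _ h₂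
    rw [SType.pos_dual] at h4
    tauto
  · rintro A C ⟨B, h₁, h₂⟩ σ C' hσ hC
    obtain ⟨D, hD, hDC⟩ := hc.inp_out _ _ h₂ σ C' hσ hC
    have hB := hD.dual_inp
    rw [Msg.dual_of_ne hσ] at hB
    obtain ⟨A', hA, hAD⟩ := hc.inp_out _ _ h₁ σ _ hσ hB
    exact ⟨A', hA, D.dual, hAD, by simpa using hDC⟩
  · rintro A C ⟨B, h₁, h₂⟩ σ A' hσ hA
    obtain ⟨D, hD, hAD⟩ := hc.out_inp _ _ h₁ σ A' hσ hA
    have hB := hD.dual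
    simp only [Act.dual, Msg.dual_of_ne hσ] at hB
    obtain ⟨C', hC, hDC⟩ := hc.out_inp _ _ h₂ σ _ hσ hB
    exact ⟨C', hC, D, hAD, hDC⟩
  · rintro A C ⟨B, h₁, h₂⟩ C₁ C₂ hC
    obtain ⟨D₁, D₂, hD, h3, h4⟩ := hc.inp_out_chan _ _ h₂ C₁ C₂ hC
    obtain ⟨A₁, A₂, hA, h5, h6⟩ := hc.inp_out_chan _ _ h₁ _ _ hD.dual_inp
    exact ⟨A₁, A₂, hA, ⟨D₁.dual, h5, by simpa using h3⟩, ⟨D₂.dual, h6, by simpa using h4⟩⟩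
  · rintro A C ⟨B, h₁, h₂⟩ A₁ A₂ hA
    obtain ⟨D₁, D₂, hD, h3, h4⟩ := hc.out_inp_chan _ _ h₁ A₁ A₂ hA
    obtain ⟨C₁, C₂, hC, h5, h6⟩ := hc.out_inp_chan _ _ h₂ _ _ hD.dual
    exact ⟨C₁, C₂, hC, ⟨D₁, h3, h5⟩, ⟨D₂, h4, h6⟩⟩

theorem Sub.refl (S : SType Tag) : Sub S S := fun _ _ h => h

theorem Sub.trans {S T U : SType Tag} (h₁ : Sub S T) (h₂ : Sub T U) : Sub S U :=
  fun R hR h => h₁ R hR (h₂ R hR h)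

theorem Correct.mono {S T S' T' : SType Tag} (h : Correct S T) (hS : Sub S' S) (hT : Sub T' T)
    (hS' : S'.Regular) (hT' : T.Regular) : Correct S' T' :=
  hT _ hS' (hS _ hT' h.symm).symm

theorem Correct.sub_dual {S T : SType Tag} (h : Correct S T) : Sub S T.dual :=
  fun _ _ hR => hR.cut (by simpa using h.symm)

theorem Sub.dual_symm {S T : SType Tag} (h : Sub S.dual T) (hT : T.Regular) : Sub T.dual S := by
  intro R _ hRS
  exact hRS.cut (h _ hT.dual (correct_dual T).symm).symm

/-- A type that can receive a tag `a` and then compose with `S` composes with the type that sends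
`a` first and continues as `S`, because its inputs commute with its outputs. -/
theorem correct_singleton_plus {R R' S : SType Tag} {m : ℕ} {a : Tag}
    (h : Trans R (.inp (.tag m a)) R') (hS : Correct R' S) :
    Correct R (.plus {a} (Finset.singleton_nonempty a) (fun _ => m) fun _ => S) := by
  have hc := isCorrectComposition_correct (Tag := Tag)
  have hp : ∀ {S S' σ}, Trans S (.inp σ) S' →
      Trans (.plus {a} (Finset.singleton_nonempty a) (fun _ => m) fun _ => S) (.inp σ)
        (.plus {a} (Finset.singleton_nonempty a) (fun _ => m) fun _ => S') :=
    fun h => trans_plus_inp_iff.2 ⟨_, fun _ => h, rfl⟩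
  refine ⟨fun R T => Correct R T ∨ ∃ R' S, Trans R (.inp (.tag m a)) R' ∧ Correct R' S ∧
      T = .plus {a} (Finset.singleton_nonempty a) (fun _ => m) fun _ => S, ⟨?_, ?_, ?_, ?_, ?_⟩,
      .inr ⟨R', S, h, hS, rfl⟩⟩
  · rintro R T (h | ⟨R', S, h, hS, rfl⟩)
    · exact hc.pol _ _ h
    · exact .inr trivial
  · rintro R T (h | ⟨R', S, h, hS, rfl⟩) σ T' hσ hT
    · exact (hc.inp_out _ _ h _ _ hσ hT).imp fun _ h => ⟨h.1, .inl h.2⟩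
    · obtain ⟨⟨k, hk⟩, rfl, rfl⟩ := trans_plus_out_iff.1 hT
      obtain rfl := Finset.mem_singleton.1 hk
      exact ⟨R', h, .inl hS⟩
  · rintro R T (h | ⟨R', S, h, hS, rfl⟩) σ T' hσ hT
    · exact (hc.out_inp _ _ h _ _ hσ hT).imp fun _ h => ⟨h.1, .inl h.2⟩
    · obtain ⟨U, h1, h2⟩ := h.diamond hT
      obtain ⟨S', h3, h4⟩ := hc.out_inp _ _ hS _ _ hσ h1
      exact ⟨_, hp h3, .inr ⟨U, S', h2, h4, rfl⟩⟩
  · rintro R T (h | ⟨R', S, h, hS, rfl⟩) T₁ T₂ hT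
    · obtain ⟨S₁, S₂, h1, h2, h3⟩ := hc.inp_out_chan _ _ h _ _ hT
      exact ⟨S₁, S₂, h1, .inl h2, .inl h3⟩
    · obtain ⟨k, hk, -⟩ := trans_plus_out_iff.1 hT
      cases hk
  · rintro R T (h | ⟨R', S, h, hS, rfl⟩) T₁ T₂ hT
    · obtain ⟨S₁, S₂, h1, h2, h3⟩ := hc.out_inp_chan _ _ h _ _ hT
      exact ⟨S₁, S₂, h1, .inl h2, .inl h3⟩
    · obtain ⟨U, h1, h2⟩ := h.diamond hT
      obtain ⟨S₁, S₂, h3, h4, h5⟩ := hc.out_inp_chan _ _ hS _ _ h1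
      exact ⟨S₁, _, hp h3, .inl h4, .inr ⟨U, S₂, h2, h5, rfl⟩⟩

/-- The analogue of `correct_singleton_plus` for the output of a channel. -/
theorem correct_tensor {R R₁ R₂ S₁ S₂ : SType Tag}
    (h : Trans R (.inp (.chan R₁)) R₂) (hS₁ : Correct R₁ S₁) (hS₂ : Correct R₂ S₂) :
    Correct R (.tensor S₁ S₂) := by
  have hc := isCorrectComposition_correct (Tag := Tag)
  refine ⟨fun R T => Correct R T ∨ ∃ R₁ R₂ S, Trans R (.inp (.chan R₁)) R₂ ∧ Correct R₁ S₁ ∧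
      Correct R₂ S ∧ T = .tensor S₁ S, ⟨?_, ?_, ?_, ?_, ?_⟩, .inr ⟨R₁, R₂, S₂, h, hS₁, hS₂, rfl⟩⟩
  · rintro R T (h | ⟨R₁, R₂, S, h, hS₁, hS, rfl⟩)
    · exact hc.pol _ _ h
    · exact .inr trivial
  · rintro R T (h | ⟨R₁, R₂, S, h, hS₁, hS, rfl⟩) σ T' hσ hT
    · exact (hc.inp_out _ _ h _ _ hσ hT).imp fun _ h => ⟨h.1, .inl h.2⟩
    · exact (hσ _ (trans_tensor_out_iff.1 hT).1).elim
  · rintro R T (h | ⟨R₁, R₂, S, h, hS₁, hS, rfl⟩) σ T' hσ hT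
    · exact (hc.out_inp _ _ h _ _ hσ hT).imp fun _ h => ⟨h.1, .inl h.2⟩
    · obtain ⟨U, h1, h2⟩ := h.diamond hT
      obtain ⟨S', h3, h4⟩ := hc.out_inp _ _ hS _ _ hσ h1
      exact ⟨_, trans_tensor_inp_iff.2 ⟨S', h3, rfl⟩, .inr ⟨R₁, U, S', h2, hS₁, h4, rfl⟩⟩
  · rintro R T (h | ⟨R₁, R₂, S, h, hS₁, hS, rfl⟩) T₁ T₂ hT
    · obtain ⟨S₁, S₂, h1, h2, h3⟩ := hc.inp_out_chan _ _ h _ _ hT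
      exact ⟨S₁, S₂, h1, .inl h2, .inl h3⟩
    · obtain ⟨hk, rfl⟩ := trans_tensor_out_iff.1 hT
      cases hk
      exact ⟨R₁, R₂, h, .inl hS₁, .inl hS⟩
  · rintro R T (h | ⟨R₁, R₂, S, h, hS₁, hS, rfl⟩) T₁ T₂ hT
    · obtain ⟨S₁, S₂, h1, h2, h3⟩ := hc.out_inp_chan _ _ h _ _ hT
      exact ⟨S₁, S₂, h1, .inl h2, .inl h3⟩
    · obtain ⟨U, h1, h2⟩ := h.diamond hT
      obtain ⟨S', S₂', h3, h4, h5⟩ := hc.out_inp_chan _ _ hS _ _ h1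
      exact ⟨S', _, trans_tensor_inp_iff.2 ⟨_, h3, rfl⟩, .inl h4,
        .inr ⟨R₁, U, S₂', h2, hS₁, h5, rfl⟩⟩

/-- Outputs may be anticipated: if `V` can send `a` and become `V'`, then sending `a` first and
continuing as a subtype of `V'` is a subtype of `V`. -/
theorem sub_of_trans_tag {V V' S : SType Tag} {m : ℕ} {a : Tag}
    (h : Trans V (.out (.tag m a)) V') (hS : Sub S V') :
    Sub (.plus {a} (Finset.singleton_nonempty a) (fun _ => m) fun _ => S) V := by
  intro R hR hRV
  obtain ⟨R', h1, h2⟩ := isCorrectComposition_correct.inp_out _ _ hRV _ _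
    (fun U h => by cases h) h
  exact correct_singleton_plus h1 (hS _ (h1.regular hR) h2)

theorem sub_of_trans_chan {V V₁ V₂ S₁ S₂ : SType Tag}
    (h : Trans V (.out (.chan V₁)) V₂) (hS₁ : Sub S₁ V₁) (hS₂ : Sub S₂ V₂) :
    Sub (.tensor S₁ S₂) V := by
  intro R hR hRV
  obtain ⟨R₁, R₂, h1, h2, h3⟩ := isCorrectComposition_correct.inp_out_chan _ _ hRV _ _ h
  exact correct_tensor h1 (hS₁ _ (h1.regular_msg hR) h2) (hS₂ _ (h1.regular hR) h3)

end Composition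

variable {Tag Name : Type}

/-! ### Renamings and free channels -/

@[simp] theorem up_zero (ρ : ℕ → ℕ) : up ρ 0 = 0 := rfl
@[simp] theorem up_succ (ρ : ℕ → ℕ) (n : ℕ) : up ρ (n + 1) = ρ n + 1 := rfl
@[simp] theorem swap_zero : swap 0 = 1 := rfl
@[simp] theorem swap_one : swap 1 = 0 := rfl
@[simp] theorem swap_add_two (n : ℕ) : swap (n + 2) = n + 2 := rfl
@[simp] theorem inst_zero (y : ℕ) : inst y 0 = y := rfl
@[simp] theorem inst_succ (y n : ℕ) : inst y (n + 1) = n := rfl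

theorem up_comp (ρ ρ' : ℕ → ℕ) : up ρ' ∘ up ρ = up (ρ' ∘ ρ) := by
  funext n; cases n <;> rfl

theorem up_id : up id = id := by
  funext n; cases n <;> rfl

namespace Proc

theorem rename_rename (P : Proc Tag Name) :
    ∀ ρ ρ' : ℕ → ℕ, (P.rename ρ).rename ρ' = P.rename (ρ' ∘ ρ) := by
  induction P <;> intro ρ ρ' <;> simp_all [rename, up_comp]

theorem rename_congr (P : Proc Tag Name) :
    ∀ {ρ ρ' : ℕ → ℕ}, (∀ n ∈ P.fn, ρ n = ρ' n) → P.rename ρ = P.rename ρ' := by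
  have hup : ∀ {s : Set ℕ} {ρ ρ' : ℕ → ℕ}, (∀ n, n + 1 ∈ s → ρ n = ρ' n) →
      ∀ n ∈ s, up ρ n = up ρ' n := by
    intro s ρ ρ' h n hn
    cases n with
    | zero => rfl
    | succ n => exact congrArg (· + 1) (h n hn)
  induction P with
  | link x y => intro ρ ρ' h; simp [rename, h x (by simp [fn]), h y (by simp [fn])]
  | close x => intro ρ ρ' h; simp [rename, h x (by simp [fn])]
  | select x a P ih =>
    intro ρ ρ' h
    simp [rename, h x (by simp [fn]), ih fun n hn => h n (by simp [fn, hn])]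
  | fork x P Q ihP ihQ =>
    intro ρ ρ' h
    simp [rename, h x (by simp [fn]), ihP (hup fun n hn => h n (by simp [fn, hn])),
      ihQ fun n hn => h n (by simp [fn, hn])]
  | choice P Q ihP ihQ =>
    intro ρ ρ' h
    simp [rename, ihP fun n hn => h n (by simp [fn, hn]), ihQ fun n hn => h n (by simp [fn, hn])]
  | done => intro ρ ρ' h; rfl
  | call A xs => intro ρ ρ' h; simp only [rename, call.injEq, true_and]; exact List.map_congr_left h
  | wait x P ih =>
    intro ρ ρ' h
    simp [rename, h x (by simp [fn]), ih fun n hn => h n (by simp [fn, hn])]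
  | case x I P ih =>
    intro ρ ρ' h
    simp only [rename, h x (by simp [fn])]
    congr 1
    funext i
    exact ih i fun n hn => h n (.inr (Set.mem_iUnion.2 ⟨i, hn⟩))
  | join x P ih =>
    intro ρ ρ' h
    simp [rename, h x (by simp [fn]), ih (hup fun n hn => h n (by simp [fn, hn]))]
  | cut P Q ihP ihQ =>
    intro ρ ρ' h
    simp [rename, ihP (hup fun n hn => h n (by simp [fn, hn])),
      ihQ (hup fun n hn => h n (by simp [fn, hn]))]

theorem rename_id (P : Proc Tag Name) : P.rename id = P := by
  induction P <;> simp_all [rename, up_id]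

theorem rename_eq_self {P : Proc Tag Name} {ρ : ℕ → ℕ} (h : ∀ n ∈ P.fn, ρ n = n) :
    P.rename ρ = P :=
  (P.rename_congr h).trans P.rename_id

theorem mem_fn_rename (P : Proc Tag Name) :
    ∀ {ρ : ℕ → ℕ} {n : ℕ}, n ∈ (P.rename ρ).fn ↔ ∃ m ∈ P.fn, ρ m = n := by
  have hup : ∀ {s : Set ℕ} {ρ : ℕ → ℕ} {n : ℕ},
      (∃ m ∈ s, up ρ m = n + 1) ↔ ∃ m, m + 1 ∈ s ∧ ρ m = n := by
    intro s ρ n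
    constructor
    · rintro ⟨m, hm, h⟩
      cases m with
      | zero => cases h
      | succ m => exact ⟨m, hm, Nat.succ_injective h⟩
    · rintro ⟨m, hm, rfl⟩; exact ⟨m + 1, hm, rfl⟩
  induction P with
  | link x y => intro ρ n; simp [rename, fn, eq_comm]
  | close x => intro ρ n; simp [rename, fn, eq_comm]
  | select x a P ih => intro ρ n; simp [rename, fn, ih, eq_comm]
  | fork x P Q ihP ihQ =>
    intro ρ n
    simp only [rename, fn, Set.mem_union, Set.mem_singleton_iff, Set.mem_ofPred_eq, ihP, ihQ, hup,
      or_and_right, exists_or, exists_eq_left, eq_comm (a := n)]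
  | choice P Q ihP ihQ => intro ρ n; simp [rename, fn, ihP, ihQ, or_and_right, exists_or]
  | done => intro ρ n; simp [rename, fn]
  | call A xs => intro ρ n; simp [rename, fn]
  | wait x P ih => intro ρ n; simp [rename, fn, ih, eq_comm]
  | case x I P ih =>
    intro ρ n
    simp only [rename, fn, Set.mem_union, Set.mem_singleton_iff, Set.mem_iUnion, ih,
      or_and_right, exists_or, exists_eq_left, eq_comm (a := n)]
    exact or_congr_right ⟨fun ⟨i, m, h, e⟩ => ⟨m, ⟨i, h⟩, e⟩, fun ⟨m, ⟨i, h⟩, e⟩ => ⟨i, m, h, e⟩⟩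
  | join x P ih =>
    intro ρ n
    simp only [rename, fn, Set.mem_union, Set.mem_singleton_iff, Set.mem_ofPred_eq, ih, hup,
      or_and_right, exists_or, exists_eq_left, eq_comm (a := n)]
  | cut P Q ihP ihQ =>
    intro ρ n
    simp only [rename, fn, Set.mem_ofPred_eq, ihP, ihQ, hup, or_and_right, exists_or]

theorem fn_rename (P : Proc Tag Name) (ρ : ℕ → ℕ) : (P.rename ρ).fn = ρ '' P.fn :=
  Set.ext fun _ => P.mem_fn_rename

@[simp] theorem mem_fn_link {n x y : ℕ} : n ∈ (link x y : Proc Tag Name).fn ↔ n = x ∨ n = y :=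
  Iff.rfl
@[simp] theorem mem_fn_close {n x : ℕ} : n ∈ (close x : Proc Tag Name).fn ↔ n = x := Iff.rfl
@[simp] theorem mem_fn_select {n x : ℕ} {a : Tag} {P : Proc Tag Name} :
    n ∈ (select x a P).fn ↔ n = x ∨ n ∈ P.fn := Iff.rfl
@[simp] theorem mem_fn_fork {n x : ℕ} {P Q : Proc Tag Name} :
    n ∈ (fork x P Q).fn ↔ n = x ∨ n + 1 ∈ P.fn ∨ n ∈ Q.fn := by
  simp [fn, or_assoc]
@[simp] theorem mem_fn_choice {n : ℕ} {P Q : Proc Tag Name} :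
    n ∈ (choice P Q).fn ↔ n ∈ P.fn ∨ n ∈ Q.fn := Iff.rfl
@[simp] theorem mem_fn_done {n : ℕ} : n ∈ (done : Proc Tag Name).fn ↔ False := Iff.rfl
@[simp] theorem mem_fn_call {n : ℕ} {A : Name} {xs : List ℕ} :
    n ∈ (call A xs : Proc Tag Name).fn ↔ n ∈ xs := Iff.rfl
@[simp] theorem mem_fn_wait {n x : ℕ} {P : Proc Tag Name} :
    n ∈ (wait x P).fn ↔ n = x ∨ n ∈ P.fn := Iff.rfl
@[simp] theorem mem_fn_case {n x : ℕ} {I : Finset Tag} {P : I → Proc Tag Name} :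
    n ∈ (case x I P).fn ↔ n = x ∨ ∃ i, n ∈ (P i).fn := by
  simp [fn]
@[simp] theorem mem_fn_join {n x : ℕ} {P : Proc Tag Name} :
    n ∈ (join x P).fn ↔ n = x ∨ n + 1 ∈ P.fn := Iff.rfl
@[simp] theorem mem_fn_cut {n : ℕ} {P Q : Proc Tag Name} :
    n ∈ (cut P Q).fn ↔ n + 1 ∈ P.fn ∨ n + 1 ∈ Q.fn := Iff.rfl

variable {P : Proc Tag Name}

@[simp] theorem zero_mem_fn_rename_succ : 0 ∈ (P.rename Nat.succ).fn ↔ False := by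
  simp [mem_fn_rename]
@[simp] theorem succ_mem_fn_rename_succ {n : ℕ} : n + 1 ∈ (P.rename Nat.succ).fn ↔ n ∈ P.fn := by
  simp [mem_fn_rename]
theorem succ_mem_fn_rename_up {ρ : ℕ → ℕ} {n : ℕ} :
    n + 1 ∈ (P.rename (up ρ)).fn ↔ ∃ m, m + 1 ∈ P.fn ∧ ρ m = n := by
  rw [mem_fn_rename]
  constructor
  · rintro ⟨_ | m, h, h'⟩
    · cases h'
    · exact ⟨m, h, Nat.succ_injective h'⟩
  · rintro ⟨m, h, rfl⟩; exact ⟨m + 1, h, rfl⟩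
@[simp] theorem add_two_mem_fn_rename_up_succ {n : ℕ} :
    n + 1 + 1 ∈ (P.rename (up Nat.succ)).fn ↔ n + 1 ∈ P.fn := by
  rw [succ_mem_fn_rename_up]; simp
@[simp] theorem add_two_mem_fn_rename_swap {n : ℕ} :
    n + 1 + 1 ∈ (P.rename swap).fn ↔ n + 1 + 1 ∈ P.fn := by
  rw [mem_fn_rename]
  refine ⟨?_, fun h => ⟨n + 2, h, rfl⟩⟩
  rintro ⟨_ | _ | m, h, h'⟩
  · cases h'
  · cases h'
  · rw [swap_add_two] at h'; exact h' ▸ h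
theorem rename_pred_succ (P : Proc Tag Name) : (P.rename Nat.succ).rename Nat.pred = P := by
  rw [rename_rename]; exact rename_eq_self fun _ _ => rfl

theorem rename_succ_pred (h : 0 ∉ P.fn) : (P.rename Nat.pred).rename Nat.succ = P := by
  rw [rename_rename]
  refine rename_eq_self fun n hn => ?_
  cases n with
  | zero => exact (h hn).elim
  | succ n => rfl

theorem rename_up_succ_pred (h : 1 ∉ P.fn) :
    (P.rename (up Nat.pred)).rename (up Nat.succ) = P := by
  rw [rename_rename, up_comp]
  refine rename_eq_self fun n hn => ?_
  rcases n with _ | _ | n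
  · rfl
  · exact (h hn).elim
  · rfl

end Proc

theorem Program.unfold_rename (prog : Program Tag Name) (A : Name) (xs : List ℕ) (ρ : ℕ → ℕ)
    (h : xs.length = prog.arity A) :
    (prog.unfold A xs).rename ρ = prog.unfold A (xs.map ρ) := by
  rw [unfold, unfold, Proc.rename_rename]
  refine Proc.rename_congr _ fun n hn => ?_
  rw [prog.fn_body] at hn
  have hn : n < xs.length := h ▸ hn
  simp [hn]

theorem Program.fn_unfold (prog : Program Tag Name) (A : Name) (xs : List ℕ)
    (h : xs.length = prog.arity A) : (prog.unfold A xs).fn = {n | n ∈ xs} := by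
  ext n
  rw [unfold, Proc.mem_fn_rename, prog.fn_body, Set.mem_ofPred_eq, List.mem_iff_getElem]
  constructor
  · rintro ⟨m, hm, rfl⟩
    have hm : m < xs.length := h ▸ hm
    exact ⟨m, hm, by simp [hm]⟩
  · rintro ⟨m, hm, rfl⟩
    exact ⟨m, h ▸ hm, by simp [hm]⟩

namespace Buffer

/-- The free channels of the processes in a buffer. -/
def fn : Buffer Tag Name → Set ℕ
  | [] => ∅
  | .tag _ :: B => fn B
  | .chan R :: B => {n | n + 1 ∈ R.fn} ∪ fn B

@[simp] theorem mem_fn_nil {n : ℕ} : n ∈ fn ([] : Buffer Tag Name) ↔ False := Iff.rfl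
@[simp] theorem mem_fn_tag {n : ℕ} {a : Tag} {B : Buffer Tag Name} :
    n ∈ fn (.tag a :: B) ↔ n ∈ fn B := Iff.rfl
@[simp] theorem mem_fn_chan {n : ℕ} {R : Proc Tag Name} {B : Buffer Tag Name} :
    n ∈ fn (.chan R :: B) ↔ n + 1 ∈ R.fn ∨ n ∈ fn B := Iff.rfl

@[simp] theorem rename_nil (ρ : ℕ → ℕ) : rename ρ ([] : Buffer Tag Name) = [] := rfl
@[simp] theorem rename_tag (ρ : ℕ → ℕ) (a : Tag) (B : Buffer Tag Name) :
    rename ρ (.tag a :: B) = .tag a :: rename ρ B := rfl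
@[simp] theorem rename_chan (ρ : ℕ → ℕ) (R : Proc Tag Name) (B : Buffer Tag Name) :
    rename ρ (.chan R :: B) = .chan (R.rename (up ρ)) :: rename ρ B := rfl
@[simp] theorem rename_eq_nil {ρ : ℕ → ℕ} {B : Buffer Tag Name} : rename ρ B = [] ↔ B = [] :=
  List.map_eq_nil_iff

theorem mem_fn_rename {B : Buffer Tag Name} {ρ : ℕ → ℕ} {n : ℕ} :
    n ∈ fn (rename ρ B) ↔ ∃ m ∈ fn B, ρ m = n := by
  induction B with
  | nil => simp
  | cons b B ih =>
    cases b with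
    | tag a => simp [ih]
    | chan R => simp [ih, Proc.succ_mem_fn_rename_up, or_and_right, exists_or]

@[simp] theorem zero_mem_fn_rename_succ {B : Buffer Tag Name} :
    0 ∈ fn (rename Nat.succ B) ↔ False := by simp [mem_fn_rename]
@[simp] theorem succ_mem_fn_rename_succ {B : Buffer Tag Name} {n : ℕ} :
    n + 1 ∈ fn (rename Nat.succ B) ↔ n ∈ fn B := by simp [mem_fn_rename]
@[simp] theorem add_two_mem_fn_rename_up_succ {B : Buffer Tag Name} {n : ℕ} :
    n + 1 + 1 ∈ fn (rename (up Nat.succ) B) ↔ n + 1 ∈ fn B := by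
  rw [mem_fn_rename]
  refine ⟨?_, fun h => ⟨n + 1, h, rfl⟩⟩
  rintro ⟨_ | m, h, h'⟩
  · cases h'
  · cases h'; exact h
@[simp] theorem mem_fn_rename_inst {B : Buffer Tag Name} {n y : ℕ} :
    n ∈ fn (rename (inst y) B) ↔ (n = y ∧ 0 ∈ fn B) ∨ n + 1 ∈ fn B := by
  rw [mem_fn_rename]
  constructor
  · rintro ⟨_ | m, h, rfl⟩
    · exact .inl ⟨rfl, h⟩
    · exact .inr h
  · rintro (⟨rfl, h⟩ | h)
    · exact ⟨0, h, rfl⟩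
    · exact ⟨n + 1, h, rfl⟩

@[simp] theorem mem_fn_plug {x n : ℕ} {B : Buffer Tag Name} {P : Proc Tag Name} :
    n ∈ (plug x B P).fn ↔ n ∈ fn B ∨ n ∈ P.fn ∨ (n = x ∧ B ≠ []) := by
  induction B with
  | nil => simp [plug]
  | cons b B ih => cases b <;> simp [plug, ih] <;> tauto

theorem rename_succ_pred {B : Buffer Tag Name} (h : 0 ∉ fn B) :
    rename Nat.succ (rename Nat.pred B) = B := by
  induction B with
  | nil => rfl
  | cons b B ih =>
    cases b with
    | tag a => simp only [rename_tag, ih h]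
    | chan R =>
      rw [mem_fn_chan, not_or] at h
      simp only [rename_chan, ih h.2, Proc.rename_up_succ_pred h.1]

theorem rename_pred_succ (B : Buffer Tag Name) : rename Nat.pred (rename Nat.succ B) = B := by
  induction B with
  | nil => rfl
  | cons b B ih =>
    cases b with
    | tag a => simp only [rename_tag, ih]
    | chan R =>
      simp only [rename_chan, ih, Proc.rename_rename, up_comp]
      rw [Proc.rename_eq_self]
      rintro (_ | n) _ <;> rfl

end Buffer

/-! ### Processes whose free channels are stable -/

/-- A process is good, relative to a predicate `C` on process names, if it calls only names in `C`
and every case has a good branch in which all the free channels of the other branches occur. Typing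
ensures this, and structural pre-congruence cannot discard a free channel of a good process. -/
def Proc.Good (prog : Program Tag Name) (C : Name → Prop) : Proc Tag Name → Prop
  | link _ _ => True
  | close _ => True
  | select _ _ P => Good prog C P
  | fork _ P Q => Good prog C P ∧ Good prog C Q
  | choice P Q => Good prog C P ∧ Good prog C Q
  | done => True
  | call A xs => C A ∧ xs.length = prog.arity A
  | wait _ P => Good prog C P
  | case x _ P => ∃ j, Good prog C (P j) ∧ ∀ i, ∀ n ∈ (P i).fn, n = x ∨ n ∈ (P j).fn
  | join _ P => Good prog C P
  | cut P Q => Good prog C P ∧ Good prog C Q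

/-- A buffer is good if the processes it holds are. -/
def Buffer.Good (prog : Program Tag Name) (C : Name → Prop) : Buffer Tag Name → Prop
  | [] => True
  | .tag _ :: B => Good prog C B
  | .chan R :: B => R.Good prog C ∧ Good prog C B

section Good

open Proc

variable {prog : Program Tag Name} {C : Name → Prop}

theorem Proc.Good.rename {P : Proc Tag Name} : ∀ {ρ}, P.Good prog C → (P.rename ρ).Good prog C := by
  induction P with
  | case x I P ih =>
    rintro ρ ⟨j, h, h'⟩
    refine ⟨j, ih j h, fun i n hn => ?_⟩
    obtain ⟨m, hm, rfl⟩ := (mem_fn_rename _).1 hn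
    rcases h' i m hm with rfl | hm
    · exact .inl rfl
    · exact .inr ((mem_fn_rename _).2 ⟨m, hm, rfl⟩)
  | _ => intro ρ h; simp_all [Proc.Good, Proc.rename]

theorem Buffer.Good.rename {B : Buffer Tag Name} {ρ} (h : B.Good prog C) :
    (B.rename ρ).Good prog C := by
  induction B with
  | nil => trivial
  | cons b B ih =>
    cases b with
    | tag => exact ih h
    | chan => exact ⟨h.1.rename, ih h.2⟩

theorem good_plug {x : ℕ} {B : Buffer Tag Name} {P : Proc Tag Name} :
    (B.plug x P).Good prog C ↔ B.Good prog C ∧ P.Good prog C := by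
  induction B with
  | nil => simp [Buffer.plug, Buffer.Good]
  | cons b B ih => cases b <;> simp [Buffer.plug, Buffer.Good, Proc.Good, ih, and_assoc]

/-- Structural pre-congruence creates no free channels, whereas a case without branches may absorb
some. -/
theorem PreCong.fn_subset {P Q : Proc Tag Name} (h : PreCong prog P Q) : Q.fn ⊆ P.fn := by
  intro n
  induction h generalizing n with
  | refl => exact id
  | trans _ _ ih₁ ih₂ => exact fun h => ih₁ (ih₂ h)
  | cong_select x a _ ih => simp only [mem_fn_select]; exact Or.imp_right (@ih _)
  | cong_fork x _ _ ih₁ ih₂ =>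
    simp only [mem_fn_fork]
    exact Or.imp_right (Or.imp (@ih₁ _) (@ih₂ _))
  | cong_choice _ _ ih₁ ih₂ => simp only [mem_fn_choice]; exact Or.imp (@ih₁ _) (@ih₂ _)
  | cong_wait x _ ih => simp only [mem_fn_wait]; exact Or.imp_right (@ih _)
  | cong_case x I _ ih =>
    simp only [mem_fn_case]; exact Or.imp_right (Exists.imp fun i => @ih i _)
  | cong_join x _ ih => simp only [mem_fn_join]; exact Or.imp_right (@ih _)
  | cong_cut _ _ ih₁ ih₂ => simp only [mem_fn_cut]; exact Or.imp (@ih₁ _) (@ih₂ _)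
  | s_call A xs hA => rw [prog.fn_unfold A xs hA]; exact id
  | s_link => simp only [mem_fn_link]; exact Or.symm
  | s_comm => simp only [mem_fn_cut]; exact Or.symm
  | s_wait => simp; tauto
  | s_case =>
    simp only [mem_fn_case, mem_fn_cut, Buffer.mem_fn_plug, Nat.add_right_cancel_iff]
    rintro (h | ⟨i, (h | h | h) | h⟩)
    · exact .inl (.inr (.inl (.inl h)))
    · exact .inl (.inl h)
    · exact .inl (.inr (.inl (.inr ⟨i, h⟩)))
    · exact .inl (.inr (.inr h))
    · exact .inr h
  | s_join => simp; tauto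
  | s_pull_0 => simp; tauto
  | s_pull_1 => simp; tauto
  | s_pull_2 => simp; tauto
  | s_pull_3 => simp; tauto
  | s_pull_4 => simp; tauto

/-- Structural pre-congruence discards no free channel of a good process, and leads to a good
process. -/
theorem PreCong.good {P Q : Proc Tag Name} (h : PreCong prog P Q)
    (hC : ∀ A, C A → (prog.body A).Good prog C) (hP : P.Good prog C) :
    Q.Good prog C ∧ Q.fn = P.fn := by
  suffices Q.Good prog C ∧ P.fn ⊆ Q.fn from ⟨this.1, h.fn_subset.antisymm this.2⟩
  induction h with
  | refl => exact ⟨hP, fun _ => id⟩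
  | trans _ _ ih₁ ih₂ =>
    obtain ⟨h₁, h₁'⟩ := ih₁ hP
    obtain ⟨h₂, h₂'⟩ := ih₂ h₁
    exact ⟨h₂, h₁'.trans h₂'⟩
  | cong_select x a _ ih =>
    obtain ⟨h, h'⟩ := ih hP
    exact ⟨h, fun n => Or.imp_right (@h' n)⟩
  | cong_fork x _ _ ih₁ ih₂ =>
    obtain ⟨h₁, h₁'⟩ := ih₁ hP.1
    obtain ⟨h₂, h₂'⟩ := ih₂ hP.2
    refine ⟨⟨h₁, h₂⟩, fun n => ?_⟩
    simp only [mem_fn_fork]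
    exact Or.imp_right (Or.imp (@h₁' _) (@h₂' _))
  | cong_choice _ _ ih₁ ih₂ =>
    obtain ⟨h₁, h₁'⟩ := ih₁ hP.1
    obtain ⟨h₂, h₂'⟩ := ih₂ hP.2
    exact ⟨⟨h₁, h₂⟩, fun n => Or.imp (@h₁' n) (@h₂' n)⟩
  | cong_wait x _ ih =>
    obtain ⟨h, h'⟩ := ih hP
    exact ⟨h, fun n => Or.imp_right (@h' n)⟩
  | cong_case x I hI ih =>
    obtain ⟨j, hj, hfn⟩ := hP
    obtain ⟨h, h'⟩ := ih j hj
    have key := fun i n (hn : n ∈ _) => Or.imp_right (@h' n) (hfn i n hn)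
    refine ⟨⟨j, h, fun i n hn => key i n ((hI i).fn_subset hn)⟩, fun n => ?_⟩
    simp only [mem_fn_case]
    rintro (rfl | ⟨i, hi⟩)
    · exact .inl rfl
    · exact (key i n hi).imp_right fun h => ⟨j, h⟩
  | cong_join x _ ih =>
    obtain ⟨h, h'⟩ := ih hP
    exact ⟨h, fun n => Or.imp_right (@h' _)⟩
  | cong_cut _ _ ih₁ ih₂ =>
    obtain ⟨h₁, h₁'⟩ := ih₁ hP.1
    obtain ⟨h₂, h₂'⟩ := ih₂ hP.2
    exact ⟨⟨h₁, h₂⟩, fun n => Or.imp (@h₁' _) (@h₂' _)⟩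
  | s_call A xs hA =>
    exact ⟨(hC A hP.1).rename, (prog.fn_unfold A xs hA).symm.subset⟩
  | s_link => exact ⟨trivial, fun n => Or.symm⟩
  | s_comm => exact ⟨hP.symm, fun n => Or.symm⟩
  | s_wait B y P Q =>
    simp only [Proc.Good, good_plug] at hP ⊢
    exact ⟨hP, fun n => by simp; tauto⟩
  | s_case B y I P Q =>
    simp only [Proc.Good, good_plug] at hP ⊢
    obtain ⟨⟨hB, j, hj, hfn⟩, hQ⟩ := hP
    refine ⟨⟨j, ⟨⟨hB, hj⟩, hQ⟩, fun i n => ?_⟩, fun n => ?_⟩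
    · have := hfn i (n + 1)
      simp only [mem_fn_cut, Buffer.mem_fn_plug] at this ⊢
      grind
    · simp only [mem_fn_case, mem_fn_cut, Buffer.mem_fn_plug, Nat.add_right_cancel_iff]
      rintro ((h | (h | ⟨i, h⟩) | h) | h)
      · exact .inr ⟨j, .inl (.inl h)⟩
      · exact .inl h
      · exact .inr ⟨i, .inl (.inr (.inl h))⟩
      · exact .inr ⟨j, .inl (.inr (.inr h))⟩
      · exact .inr ⟨j, .inr h⟩
  | s_join B y P Q =>
    simp only [Proc.Good, good_plug] at hP ⊢
    exact ⟨⟨⟨hP.1.1.rename, hP.1.2.rename⟩, hP.2.rename⟩, fun n => by simp; tauto⟩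
  | s_pull_0 B B' y P =>
    simp only [Proc.Good, good_plug] at hP ⊢
    exact ⟨⟨hP.1.1.rename, hP.1.2, hP.2⟩, fun n => by simp; tauto⟩
  | s_pull_1 y P Q R =>
    simp only [Proc.Good] at hP ⊢
    have := hP.1.2.rename (ρ := Nat.pred)
    rw [rename_pred_succ] at this
    exact ⟨⟨⟨hP.1.1.rename, hP.2.rename⟩, this⟩, fun n => by simp; tauto⟩
  | s_pull_2 B y P Q =>
    simp only [Proc.Good, good_plug] at hP ⊢
    have := hP.1.1.rename (ρ := Nat.pred)
    rw [Buffer.rename_pred_succ] at this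
    exact ⟨⟨this, hP.1.2, hP.2⟩, fun n => by simp; tauto⟩
  | s_pull_3 B x y P Q _ hx =>
    simp only [Proc.Good, good_plug] at hP ⊢
    refine ⟨⟨⟨hP.1.rename, hP.2.1⟩, hP.2.2⟩, fun n => ?_⟩
    simp
    rintro (h | h | h)
    · exact .inr (.inl (.inl h))
    · tauto
    · rw [h.1]; exact .inr (.inl (.inr (.inl hx)))
  | s_pull_4 B B' x y P =>
    simp only [good_plug] at hP ⊢
    exact ⟨⟨hP.2.1, hP.1, hP.2.2⟩, fun n => by simp; tauto⟩

end Good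

/-! ### Skeletons -/

/-- `Skel P Q`: the processes `P` and `Q` agree, except that the prefixes under which no reduction
takes place and the choices may differ in what they contain, but not in their free channels. -/
inductive Skel : Proc Tag Name → Proc Tag Name → Prop
  | link (x y) : Skel (.link x y) (.link x y)
  | close (x) : Skel (.close x) (.close x)
  | select (x a) {P P'} : Skel P P' → Skel (.select x a P) (.select x a P')
  | fork (x) {P P' Q Q'} : P.fn = P'.fn → Skel Q Q' → Skel (.fork x P Q) (.fork x P' Q')
  | choice (P P' Q Q') : (Proc.choice P Q).fn = (Proc.choice P' Q').fn →
      Skel (.choice P Q) (.choice P' Q')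
  | done : Skel .done .done
  | call (A xs) : Skel (.call A xs) (.call A xs)
  | wait (x) {P P'} : (Proc.wait x P).fn = (Proc.wait x P').fn → Skel (.wait x P) (.wait x P')
  | case (x) (I : Finset Tag) {P P' : I → Proc Tag Name} :
      (Proc.case x I P).fn = (Proc.case x I P').fn → Skel (.case x I P) (.case x I P')
  | join (x) {P P'} : (Proc.join x P).fn = (Proc.join x P').fn → Skel (.join x P) (.join x P')
  | cut {P P' Q Q'} : Skel P P' → Skel Q Q' → Skel (.cut P Q) (.cut P' Q')

/-- Agreement of buffers up to the contents of the processes they hold. -/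
inductive SkelBuffer : Buffer Tag Name → Buffer Tag Name → Prop
  | nil : SkelBuffer [] []
  | tag (a) {B B'} : SkelBuffer B B' → SkelBuffer (.tag a :: B) (.tag a :: B')
  | chan {R R' B B'} : R.fn = R'.fn → SkelBuffer B B' → SkelBuffer (.chan R :: B) (.chan R' :: B')

theorem Skel.refl (P : Proc Tag Name) : Skel P P := by
  induction P with
  | link => exact .link _ _
  | close => exact .close _
  | select _ _ _ ih => exact .select _ _ ih
  | fork _ _ _ _ ih => exact .fork _ rfl ih
  | choice => exact .choice _ _ _ _ rfl
  | done => exact .done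
  | call => exact .call _ _
  | wait => exact .wait _ rfl
  | case => exact .case _ _ rfl
  | join => exact .join _ rfl
  | cut _ _ ih₁ ih₂ => exact .cut ih₁ ih₂

theorem Skel.fn_eq {P Q : Proc Tag Name} (h : Skel P Q) : P.fn = Q.fn := by
  induction h with
  | link | close | done | call => rfl
  | choice _ _ _ _ h => exact h
  | wait _ h | join _ h | case _ _ h => exact h
  | select _ _ _ ih => simp only [Proc.fn, ih]
  | fork _ h _ ih => simp only [Proc.fn, h, ih]
  | cut _ _ ih₁ ih₂ => simp only [Proc.fn, ih₁, ih₂]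

theorem Skel.rename {P Q : Proc Tag Name} (h : Skel P Q) :
    ∀ ρ, Skel (P.rename ρ) (Q.rename ρ) := by
  have key : ∀ {P Q : Proc Tag Name} (ρ), P.fn = Q.fn → (P.rename ρ).fn = (Q.rename ρ).fn :=
    fun ρ h => by rw [Proc.fn_rename, Proc.fn_rename, h]
  induction h with
  | link => exact fun _ => .link _ _
  | close => exact fun _ => .close _
  | select _ _ _ ih => exact fun ρ => .select _ _ (ih ρ)
  | fork _ h _ ih => exact fun ρ => .fork _ (key _ h) (ih ρ)
  | choice _ _ _ _ h => exact fun ρ => .choice _ _ _ _ (key ρ h)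
  | done => exact fun _ => .done
  | call => exact fun _ => .call _ _
  | wait _ h => exact fun ρ => .wait _ (key ρ h)
  | case _ _ h => exact fun ρ => .case _ _ (key ρ h)
  | join _ h => exact fun ρ => .join _ (key ρ h)
  | cut _ _ ih₁ ih₂ => exact fun ρ => .cut (ih₁ _) (ih₂ _)

theorem SkelBuffer.fn_eq {B B' : Buffer Tag Name} (h : SkelBuffer B B') : B.fn = B'.fn := by
  induction h with
  | nil => rfl
  | tag _ _ ih => exact ih
  | chan h _ ih => simp only [Buffer.fn, h, ih]

theorem SkelBuffer.eq_nil_iff {B B' : Buffer Tag Name} (h : SkelBuffer B B') :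
    B = [] ↔ B' = [] := by
  cases h <;> simp

theorem SkelBuffer.rename {B B' : Buffer Tag Name} (h : SkelBuffer B B') (ρ) :
    SkelBuffer (B.rename ρ) (B'.rename ρ) := by
  induction h with
  | nil => exact .nil
  | tag _ _ ih => exact .tag _ ih
  | chan h _ ih => exact .chan (by rw [Proc.fn_rename, Proc.fn_rename, h]) ih

theorem SkelBuffer.plug {B B' : Buffer Tag Name} (h : SkelBuffer B B') (x) {P P'}
    (hP : Skel P P') : Skel (B.plug x P) (B'.plug x P') := by
  induction h with
  | nil => exact hP
  | tag _ _ ih => exact .select _ _ ih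
  | chan h _ ih => exact .fork _ h ih

theorem Skel.plug_inv {M : Proc Tag Name} {x : ℕ} {B : Buffer Tag Name} {P : Proc Tag Name}
    (h : Skel M (B.plug x P)) : ∃ B' P', M = B'.plug x P' ∧ SkelBuffer B' B ∧ Skel P' P := by
  induction B generalizing M with
  | nil => exact ⟨[], M, rfl, .nil, h⟩
  | cons b B ih =>
    cases b with
    | tag a =>
      cases h with
      | select _ _ h =>
        obtain ⟨B', P', rfl, hB, hP⟩ := ih h
        exact ⟨.tag a :: B', P', rfl, .tag a hB, hP⟩
    | chan R =>
      cases h with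
      | @fork _ R' _ _ _ hR h =>
        obtain ⟨B', P', rfl, hB, hP⟩ := ih h
        exact ⟨.chan R' :: B', P', rfl, .chan hR hB, hP⟩

/-! ### Typing contexts -/

namespace Ctx

/-- The context `Γ` under a binder whose channel is not in the context. -/
def shift (Γ : Ctx Tag) : Ctx Tag
  | 0 => none
  | n + 1 => Γ n

/-- The context `Γ` without its channel `0`, seen from outside the innermost binder. -/
def tail (Γ : Ctx Tag) : Ctx Tag := fun n => Γ (n + 1)

/-- The union of two contexts. It is biased to the left, but used for contexts with disjoint
domains. -/
def union (Γ Δ : Ctx Tag) : Ctx Tag := fun x => (Γ x).or (Δ x)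

@[simp, grind =] theorem empty_apply (z : ℕ) : (empty : Ctx Tag) z = none := rfl
@[grind =] theorem set_apply (Γ : Ctx Tag) (x z : ℕ) (S : SType Tag) :
    Γ.set x S z = if z = x then some S else Γ z := rfl
@[grind =] theorem erase_apply (Γ : Ctx Tag) (x z : ℕ) :
    Γ.erase x z = if z = x then none else Γ z := rfl
@[simp, grind =] theorem cons_zero (Γ : Ctx Tag) (S : SType Tag) : Γ.cons S 0 = some S := rfl
@[simp, grind =] theorem cons_succ (Γ : Ctx Tag) (S : SType Tag) (n : ℕ) :
    Γ.cons S (n + 1) = Γ n := rfl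
@[simp, grind =] theorem shift_zero (Γ : Ctx Tag) : Γ.shift 0 = none := rfl
@[simp, grind =] theorem shift_succ (Γ : Ctx Tag) (n : ℕ) : Γ.shift (n + 1) = Γ n := rfl
@[simp, grind =] theorem tail_apply (Γ : Ctx Tag) (n : ℕ) : Γ.tail n = Γ (n + 1) := rfl
@[simp, grind =] theorem union_apply (Γ Δ : Ctx Tag) (n : ℕ) :
    Γ.union Δ n = (Γ n).or (Δ n) := rfl

@[simp] theorem set_self (Γ : Ctx Tag) (x : ℕ) (S : SType Tag) : Γ.set x S x = some S := by
  simp [set]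
@[simp] theorem erase_self (Γ : Ctx Tag) (x : ℕ) : Γ.erase x x = none := by
  simp [erase]

theorem erase_set (Γ : Ctx Tag) (x : ℕ) (S : SType Tag) : (Γ.set x S).erase x = Γ.erase x := by
  funext z; grind
theorem set_erase {Γ : Ctx Tag} {x : ℕ} {S : SType Tag} (h : Γ x = some S) :
    (Γ.erase x).set x S = Γ := by
  funext z; grind
theorem set_erase_eq (Γ : Ctx Tag) (x : ℕ) (S : SType Tag) :
    (Γ.erase x).set x S = Γ.set x S := by
  funext z; grind
theorem erase_of_none {Γ : Ctx Tag} {x : ℕ} (h : Γ x = none) : Γ.erase x = Γ := by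
  funext z; grind

theorem Split.symm {Γ Γ₁ Γ₂ : Ctx Tag} (h : Γ.Split Γ₁ Γ₂) : Γ.Split Γ₂ Γ₁ :=
  fun x => (h x).symm.imp And.symm And.symm

theorem Split.assoc {Γ A B C D : Ctx Tag} (h₁ : Γ.Split A D) (h₂ : D.Split B C) :
    Γ.Split (A.union B) C ∧ (A.union B).Split A B := by
  constructor <;> intro z <;> have := h₁ z <;> have := h₂ z <;> grind

theorem Split.assoc' {Γ A B C D : Ctx Tag} (h₁ : Γ.Split D C) (h₂ : D.Split A B) :
    Γ.Split A (B.union C) ∧ (B.union C).Split B C := by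
  constructor <;> intro z <;> have := h₁ z <;> have := h₂ z <;> grind

theorem split_empty (Γ : Ctx Tag) : Γ.Split empty Γ := fun _ => .inr ⟨rfl, rfl⟩

theorem split_empty_iff {Γ Δ : Ctx Tag} : Γ.Split empty Δ ↔ Γ = Δ := by
  constructor
  · intro h; funext z; have := h z; grind
  · rintro rfl; exact split_empty _

theorem Regular.set {Γ : Ctx Tag} (h : Γ.Regular) {x : ℕ} {S : SType Tag} (hS : S.Regular) :
    (Γ.set x S).Regular := by
  intro z T hT
  rw [set_apply] at hT
  split_ifs at hT
  · cases hT; exact hS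
  · exact h z T hT

theorem Regular.erase {Γ : Ctx Tag} (h : Γ.Regular) {x : ℕ} : (Γ.erase x).Regular := by
  intro z T hT
  rw [erase_apply] at hT
  split_ifs at hT
  exact h z T hT

theorem Regular.cons {Γ : Ctx Tag} (h : Γ.Regular) {S : SType Tag} (hS : S.Regular) :
    (Γ.cons S).Regular := by
  rintro (_ | z) T hT
  · cases hT; exact hS
  · exact h z T hT

theorem Regular.head {Γ : Ctx Tag} {S : SType Tag} (h : (Γ.cons S).Regular) : S.Regular :=
  h 0 S rfl

theorem Regular.of_cons {Γ : Ctx Tag} {S : SType Tag} (h : (Γ.cons S).Regular) : Γ.Regular :=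
  fun z T hT => h (z + 1) T hT

theorem Split.regular {Γ Γ₁ Γ₂ : Ctx Tag} (h : Γ.Split Γ₁ Γ₂) (h₁ : Γ₁.Regular)
    (h₂ : Γ₂.Regular) : Γ.Regular := by
  intro z T hT
  rcases h z with ⟨h, _⟩ | ⟨_, h⟩
  · exact h₁ z T (h.trans hT)
  · exact h₂ z T (h.trans hT)

theorem Split.regular_left {Γ Γ₁ Γ₂ : Ctx Tag} (h : Γ.Split Γ₁ Γ₂) (hΓ : Γ.Regular) :
    Γ₁.Regular := by
  intro z T hT
  have := h z
  exact hΓ z T (by grind)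

theorem Split.regular_right {Γ Γ₁ Γ₂ : Ctx Tag} (h : Γ.Split Γ₁ Γ₂) (hΓ : Γ.Regular) :
    Γ₂.Regular := h.symm.regular_left hΓ

/-- Pointwise subtyping of contexts with the same domain. -/
def Sub (Γ Δ : Ctx Tag) : Prop :=
  ∀ x, (Γ x = none ∧ Δ x = none) ∨ ∃ S T, Γ x = some S ∧ Δ x = some T ∧ CaP.Sub S T

theorem Sub.refl (Γ : Ctx Tag) : Γ.Sub Γ := by
  intro x
  cases h : Γ x with
  | none => exact .inl ⟨rfl, rfl⟩
  | some S => exact .inr ⟨S, S, rfl, rfl, CaP.Sub.refl S⟩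

theorem Sub.trans {Γ Δ Θ : Ctx Tag} (h₁ : Γ.Sub Δ) (h₂ : Δ.Sub Θ) : Γ.Sub Θ := by
  intro x
  rcases h₁ x with ⟨h, h'⟩ | ⟨S, T, h, h', hs⟩ <;> rcases h₂ x with ⟨k, k'⟩ | ⟨T', U, k, k', hs'⟩
  · exact .inl ⟨h, k'⟩
  · simp [h'] at k
  · simp [h'] at k
  · rw [h'] at k
    cases k
    exact .inr ⟨S, U, h, k', hs.trans hs'⟩

theorem Sub.of_cons {Γ Δ : Ctx Tag} {S : SType Tag} (h : Γ.Sub (Δ.cons S)) :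
    ∃ S', CaP.Sub S' S ∧ Γ.tail.Sub Δ ∧ Γ = Γ.tail.cons S' := by
  rcases h 0 with ⟨_, h'⟩ | ⟨S', T, h1, h2, hs⟩
  · cases h'
  · cases h2
    refine ⟨S', hs, fun x => h (x + 1), ?_⟩
    funext z
    cases z with
    | zero => exact h1
    | succ z => rfl

theorem Sub.set {Γ Δ : Ctx Tag} {x : ℕ} {S T : SType Tag} (h : Γ.Sub Δ) (hS : CaP.Sub S T) :
    (Γ.set x S).Sub (Δ.set x T) := by
  intro z
  by_cases hz : z = x
  · subst hz; exact .inr ⟨S, T, by simp, by simp, hS⟩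
  · simpa [set_apply, hz] using h z

theorem Sub.erase {Γ Δ : Ctx Tag} (h : Γ.Sub Δ) (x : ℕ) : (Γ.erase x).Sub (Δ.erase x) := by
  intro z
  by_cases hz : z = x
  · subst hz; exact .inl ⟨by simp, by simp⟩
  · simpa [erase_apply, hz] using h z

theorem Sub.of_set {Γ Δ : Ctx Tag} {x : ℕ} {S : SType Tag} (h : Γ.Sub (Δ.set x S)) :
    ∃ S', Γ x = some S' ∧ CaP.Sub S' S := by
  rcases h x with ⟨_, h'⟩ | ⟨S', T, h1, h2, hs⟩
  · simp at h'
  · rw [set_self] at h2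
    cases h2
    exact ⟨S', h1, hs⟩

theorem Split.sub {Γ Γ₁ Γ₂ Δ₁ Δ₂ : Ctx Tag} (h : Γ.Split Γ₁ Γ₂) (h₁ : Δ₁.Sub Γ₁)
    (h₂ : Δ₂.Sub Γ₂) : (Δ₁.union Δ₂).Split Δ₁ Δ₂ ∧ (Δ₁.union Δ₂).Sub Γ := by
  constructor <;> intro z <;> have := h z <;> have := h₁ z <;> have := h₂ z <;> grind

/-- `Ren ρ Γ Δ`: the renaming `ρ` is injective on the domain of `Γ` and takes `Γ` to `Δ`. -/
structure Ren (ρ : ℕ → ℕ) (Γ Δ : Ctx Tag) : Prop where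
  inj : ∀ x y, Γ x ≠ none → Γ y ≠ none → ρ x = ρ y → x = y
  iff : ∀ z S, Δ z = some S ↔ ∃ x, ρ x = z ∧ Γ x = some S

theorem Ren.apply {ρ : ℕ → ℕ} {Γ Δ : Ctx Tag} (h : Ren ρ Γ Δ) {x S} (hx : Γ x = some S) :
    Δ (ρ x) = some S := (h.iff _ _).2 ⟨x, rfl, hx⟩

theorem Ren.unique {ρ : ℕ → ℕ} {Γ Δ Δ' : Ctx Tag} (h : Ren ρ Γ Δ) (h' : Ren ρ Γ Δ') :
    Δ = Δ' := by
  funext z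
  ext S
  rw [h.iff, h'.iff]

theorem Ren.regular {ρ : ℕ → ℕ} {Γ Δ : Ctx Tag} (h : Ren ρ Γ Δ) (hΓ : Γ.Regular) :
    Δ.Regular := by
  intro z S hz
  obtain ⟨x, -, hx⟩ := (h.iff z S).1 hz
  exact hΓ x S hx

theorem Ren.empty (ρ : ℕ → ℕ) : Ren ρ (empty : Ctx Tag) empty :=
  ⟨fun _ _ h => (h rfl).elim, fun z S => by simp⟩

theorem Ren.cons {ρ : ℕ → ℕ} {Γ Δ : Ctx Tag} (h : Ren ρ Γ Δ) (S : SType Tag) :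
    Ren (up ρ) (Γ.cons S) (Δ.cons S) := by
  constructor
  · rintro (_ | x) (_ | y) hx hy hxy
    · rfl
    · cases hxy
    · cases hxy
    · exact congrArg _ (h.inj x y hx hy (Nat.succ_injective hxy))
  · rintro (_ | z) T
    · constructor
      · intro hT; exact ⟨0, rfl, hT⟩
      · rintro ⟨_ | x, hx, hT⟩
        · exact hT
        · cases hx
    · rw [cons_succ, h.iff]
      constructor
      · rintro ⟨x, rfl, hT⟩; exact ⟨x + 1, rfl, hT⟩
      · rintro ⟨_ | x, hx, hT⟩
        · cases hx
        · exact ⟨x, Nat.succ_injective hx, hT⟩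

theorem Ren.set {ρ : ℕ → ℕ} {Γ Δ : Ctx Tag} (h : Ren ρ Γ Δ) {x : ℕ} (S : SType Tag)
    (hx : ∀ y, Γ y ≠ none → ρ y = ρ x → y = x) : Ren ρ (Γ.set x S) (Δ.set (ρ x) S) := by
  constructor
  · intro y z hy hz hyz
    rw [set_apply] at hy hz
    by_cases h1 : y = x <;> by_cases h2 : z = x
    · rw [h1, h2]
    · subst h1; rw [if_neg h2] at hz; exact (hx z hz hyz.symm).symm
    · subst h2; rw [if_neg h1] at hy; exact hx y hy hyz
    · rw [if_neg h1] at hy; rw [if_neg h2] at hz; exact h.inj y z hy hz hyz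
  · intro z T
    constructor
    · intro hT
      rw [set_apply] at hT
      split_ifs at hT with hz
      · exact ⟨x, hz.symm, by rw [set_self]; exact hT⟩
      · obtain ⟨y, rfl, hy⟩ := (h.iff _ _).1 hT
        exact ⟨y, rfl, by rw [set_apply, if_neg fun e => hz (congrArg ρ e), hy]⟩
    · rintro ⟨y, rfl, hy⟩
      rw [set_apply] at hy ⊢
      split_ifs at hy with h1
      · rw [if_pos (congrArg ρ h1), hy]
      · rw [if_neg, h.apply hy]
        exact fun e => h1 (hx y (by simp [hy]) e)

theorem Ren.erase {ρ : ℕ → ℕ} {Γ Δ : Ctx Tag} (h : Ren ρ Γ Δ) {x : ℕ} (hx : Γ x ≠ none) :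
    Ren ρ (Γ.erase x) (Δ.erase (ρ x)) := by
  constructor
  · intro y z hy hz
    rw [erase_apply] at hy hz
    split_ifs at hy hz with h1 h2
    · exact (hy rfl).elim
    · exact (hy rfl).elim
    · exact (hz rfl).elim
    · exact h.inj y z hy hz
  · intro z T
    constructor
    · intro hT
      rw [erase_apply] at hT
      split_ifs at hT with hz
      obtain ⟨y, rfl, hy⟩ := (h.iff _ _).1 hT
      exact ⟨y, rfl, by rw [erase_apply, if_neg fun e => hz (congrArg ρ e), hy]⟩
    · rintro ⟨y, rfl, hy⟩
      rw [erase_apply] at hy ⊢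
      split_ifs at hy with h1
      rw [if_neg, h.apply hy]
      exact fun e => h1 (h.inj y x (by simp [hy]) hx e)

theorem Ren.split {ρ : ℕ → ℕ} {Γ Δ Γ₁ Γ₂ : Ctx Tag} (h : Ren ρ Γ Δ) (hs : Γ.Split Γ₁ Γ₂) :
    ∃ Δ₁ Δ₂, Δ.Split Δ₁ Δ₂ ∧ Ren ρ Γ₁ Δ₁ ∧ Ren ρ Γ₂ Δ₂ := by
  classical
  have key : ∀ {Γ₁ Γ₂ : Ctx Tag}, Γ.Split Γ₁ Γ₂ →
      Ren ρ Γ₁ fun z => if ∃ x, ρ x = z ∧ Γ₁ x ≠ none then Δ z else none := by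
    intro Γ₁ Γ₂ hs
    have hle : ∀ {x S}, Γ₁ x = some S → Γ x = some S := by
      intro x S hx; have := hs x; grind
    constructor
    · intro x y hx hy
      obtain ⟨S, hx⟩ := Option.ne_none_iff_exists'.1 hx
      obtain ⟨T, hy⟩ := Option.ne_none_iff_exists'.1 hy
      exact h.inj x y (by simp [hle hx]) (by simp [hle hy])
    · intro z S
      constructor
      · intro hz
        split_ifs at hz with hx
        obtain ⟨x, rfl, hx⟩ := hx
        obtain ⟨T, hT⟩ := Option.ne_none_iff_exists'.1 hx
        have := h.apply (hle hT)
        exact ⟨x, rfl, by rw [hT, ← this, hz]⟩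
      · rintro ⟨x, rfl, hx⟩
        rw [if_pos ⟨x, rfl, by simp [hx]⟩]
        exact h.apply (hle hx)
  refine ⟨_, _, ?_, key hs, key hs.symm⟩
  intro z
  by_cases h1 : ∃ x, ρ x = z ∧ Γ₁ x ≠ none
  · refine .inl ⟨if_pos h1, if_neg ?_⟩
    rintro ⟨y, hy, hy'⟩
    obtain ⟨x, rfl, hx⟩ := h1
    have hsx := hs x
    have hsy := hs y
    have := h.inj x y (by grind) (by grind) hy.symm
    grind
  · refine .inr ⟨if_neg h1, ?_⟩
    by_cases h2 : ∃ x, ρ x = z ∧ Γ₂ x ≠ none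
    · exact if_pos h2
    · refine (if_neg h2).trans ?_
      by_contra hz
      obtain ⟨S, hz⟩ := Option.ne_none_iff_exists'.1 (Ne.symm hz)
      obtain ⟨x, hx, hxS⟩ := (h.iff z S).1 hz
      have := hs x
      grind

theorem Ren.of_leftInverse {ρ ρ' : ℕ → ℕ} {Γ Δ : Ctx Tag}
    (h₁ : ∀ x S, Γ x = some S → ρ' (ρ x) = x ∧ Δ (ρ x) = some S)
    (h₂ : ∀ x S, Δ x = some S → ρ (ρ' x) = x ∧ Γ (ρ' x) = some S) : Ren ρ Γ Δ := by
  constructor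
  · intro x y hx hy hxy
    obtain ⟨S, hx⟩ := Option.ne_none_iff_exists'.1 hx
    obtain ⟨T, hy⟩ := Option.ne_none_iff_exists'.1 hy
    rw [← (h₁ x S hx).1, ← (h₁ y T hy).1, hxy]
  · intro z S
    constructor
    · intro hz; exact ⟨ρ' z, h₂ z S hz⟩
    · rintro ⟨x, rfl, hx⟩; exact (h₁ x S hx).2

theorem Ren.succ (Γ : Ctx Tag) : Ren Nat.succ Γ Γ.shift := by
  refine Ren.of_leftInverse (ρ' := Nat.pred) (fun x S h => ⟨rfl, h⟩) ?_
  rintro (_ | x) S h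
  · cases h
  · exact ⟨rfl, h⟩

theorem Ren.pred {Γ : Ctx Tag} (h : Γ 0 = none) : Ren Nat.pred Γ Γ.tail := by
  refine Ren.of_leftInverse (ρ' := Nat.succ) ?_ fun x S h => ⟨rfl, h⟩
  rintro (_ | x) S hx
  · simp [h] at hx
  · exact ⟨rfl, hx⟩

theorem Ren.swap (Γ : Ctx Tag) : Ren CaP.swap Γ fun x => Γ (CaP.swap x) := by
  have : ∀ x, CaP.swap (CaP.swap x) = x := by rintro (_ | _ | x) <;> rfl
  exact Ren.of_leftInverse (ρ' := CaP.swap) (fun x S h => ⟨this x, by simpa only [this] using h⟩)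
    fun x S h => ⟨this x, h⟩

theorem Ren.inst {Γ : Ctx Tag} {y : ℕ} (h : Γ y = none) (S : SType Tag) :
    Ren (CaP.inst y) (Γ.cons S) (Γ.set y S) := by
  refine Ren.of_leftInverse (ρ' := fun z => if z = y then 0 else z + 1) ?_ ?_
  · rintro (_ | x) T hx
    · simpa using hx
    · have : x ≠ y := by rintro rfl; simp [h] at hx
      simpa [set_apply, this] using hx
  · intro z T hz
    by_cases hzy : z = y
    · subst hzy; simpa using hz
    · simpa [set_apply, hzy] using hz

end Ctx

/-! ### Typing derivations -/

section Typing

open Proc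

variable {prog : Program Tag Name}

theorem TypingRule.mono {R R' : ℕ → Proc Tag Name → Ctx Tag → Prop}
    (h : ∀ n P Γ, R n P Γ → R' n P Γ) {n P Γ} (hP : TypingRule prog R n P Γ) :
    TypingRule prog R' n P Γ := by
  cases hP with
  | done => exact .done _
  | link n x y S T h1 h2 h3 => exact .link n x y S T h1 h2 h3
  | call m n A xs Γ h1 h2 h3 h4 h5 => exact .call m n A xs Γ h1 h2 h3 (h _ _ _ h4) h5
  | choice_left m n P Q Γ h1 h2 => exact .choice_left m n P Q Γ (h _ _ _ h1) (h _ _ _ h2)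
  | choice_right m n P Q Γ h1 h2 => exact .choice_right m n P Q Γ (h _ _ _ h1) (h _ _ _ h2)
  | cut m n P Q S T Γ Γ₁ Γ₂ h1 h2 h3 h4 =>
    exact .cut m n P Q S T Γ Γ₁ Γ₂ h1 h2 (h _ _ _ h3) (h _ _ _ h4)
  | close n x h1 => exact .close n x h1
  | wait n x P Γ h1 h2 => exact .wait n x P Γ h1 (h _ _ _ h2)
  | select n x P Γ I hI m S k h1 h2 => exact .select n x P Γ I hI m S k h1 (h _ _ _ h2)
  | case n x Γ I J hI m S hIJ P h1 h2 h3 =>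
    exact .case n x Γ I J hI m S hIJ P h1 (fun i => h _ _ _ (h2 i)) h3
  | fork m n x P Q S T Γ Γ₁ Γ₂ h1 h2 h3 h4 =>
    exact .fork m n x P Q S T Γ Γ₁ Γ₂ h1 h2 (h _ _ _ h3) (h _ _ _ h4)
  | join n x P S T Γ h1 h2 => exact .join n x P S T Γ h1 (h _ _ _ h2)

theorem Typed.regular {n : ℕ} {P : Proc Tag Name} {Γ : Ctx Tag} (h : Typed prog n P Γ) :
    Γ.Regular := by
  obtain ⟨R, hR, h⟩ := h
  exact (hR _ _ _ h).1

theorem Typed.rule {n : ℕ} {P : Proc Tag Name} {Γ : Ctx Tag} (h : Typed prog n P Γ) :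
    TypingRule prog (Typed prog) n P Γ := by
  obtain ⟨R, hR, h⟩ := h
  exact (hR _ _ _ h).2.mono fun _ _ _ h' => ⟨R, hR, h'⟩

/-- The rules may be used to conclude `Typed`, since it is the greatest fixed point of the rules for
regular contexts; `Typed.rule` is the converse. -/
theorem Typed.intro {n : ℕ} {P : Proc Tag Name} {Γ : Ctx Tag} (hΓ : Γ.Regular)
    (h : TypingRule prog (Typed prog) n P Γ) : Typed prog n P Γ :=
  ⟨fun n P Γ => Γ.Regular ∧ TypingRule prog (Typed prog) n P Γ,
    fun _ _ _ h => ⟨h.1, h.2.mono fun _ _ _ h' => ⟨h'.regular, h'.rule⟩⟩, hΓ, h⟩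

theorem Typed.cut_inv {N : ℕ} {P Q : Proc Tag Name} {Γ : Ctx Tag}
    (h : Typed prog N (cut P Q) Γ) : ∃ m n S T Γ₁ Γ₂, N = m + n ∧ Γ.Split Γ₁ Γ₂ ∧ Correct S T ∧
      Typed prog m P (Γ₁.cons S) ∧ Typed prog n Q (Γ₂.cons T) := by
  cases h.rule with
  | cut m n P Q S T Γ Γ₁ Γ₂ h1 h2 h3 h4 => exact ⟨m, n, S, T, Γ₁, Γ₂, rfl, h1, h2, h3, h4⟩

theorem Typed.cut {m n : ℕ} {P Q : Proc Tag Name} {S T : SType Tag} {Γ Γ₁ Γ₂ : Ctx Tag}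
    (hs : Γ.Split Γ₁ Γ₂) (hc : Correct S T) (hP : Typed prog m P (Γ₁.cons S))
    (hQ : Typed prog n Q (Γ₂.cons T)) : Typed prog (m + n) (cut P Q) Γ :=
  .intro (hs.regular hP.regular.of_cons hQ.regular.of_cons) (.cut m n P Q S T Γ Γ₁ Γ₂ hs hc hP hQ)

theorem Typed.select_inv {N x : ℕ} {a : Tag} {P : Proc Tag Name} {Γ : Ctx Tag}
    (h : Typed prog N (select x a P) Γ) : ∃ (n : ℕ) (I : Finset Tag) (hI : I.Nonempty) (m : I → ℕ)
      (S : I → SType Tag) (ha : a ∈ I), N = 1 + m ⟨a, ha⟩ + n ∧ Γ x = some (.plus I hI m S) ∧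
      Typed prog n P (Γ.set x (S ⟨a, ha⟩)) := by
  generalize hR : Proc.select x a P = R at h
  cases h.rule with
  | select n x P Γ I hI m S k h1 h2 =>
    cases hR
    exact ⟨n, I, hI, m, S, k.2, rfl, h1, h2⟩
  | _ => cases hR

theorem Typed.fork_inv {N x : ℕ} {P Q : Proc Tag Name} {Γ : Ctx Tag}
    (h : Typed prog N (fork x P Q) Γ) : ∃ m n S T Γ₁ Γ₂, N = 1 + m + n ∧
      Γ x = some (.tensor S T) ∧ (Γ.erase x).Split Γ₁ Γ₂ ∧
      Typed prog m P (Γ₁.cons S) ∧ Typed prog n Q (Γ₂.set x T) := by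
  cases h.rule with
  | fork m n x P Q S T Γ Γ₁ Γ₂ h1 h2 h3 h4 => exact ⟨m, n, S, T, Γ₁, Γ₂, rfl, h1, h2, h3, h4⟩

theorem Typed.wait_inv {n x : ℕ} {P : Proc Tag Name} {Γ : Ctx Tag}
    (h : Typed prog n (wait x P) Γ) : Γ x = some .bot ∧ Typed prog n P (Γ.erase x) := by
  cases h.rule with
  | wait n x P Γ h1 h2 => exact ⟨h1, h2⟩

theorem Typed.join_inv {n x : ℕ} {P : Proc Tag Name} {Γ : Ctx Tag}
    (h : Typed prog n (join x P) Γ) :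
    ∃ S T, Γ x = some (.par S T) ∧ Typed prog n P ((Γ.set x T).cons S) := by
  cases h.rule with
  | join n x P S T Γ h1 h2 => exact ⟨S, T, h1, h2⟩

theorem Typed.case_inv {n x : ℕ} {J : Finset Tag} {P : J → Proc Tag Name} {Γ : Ctx Tag}
    (h : Typed prog n (case x J P) Γ) : ∃ (I : Finset Tag) (hI : I.Nonempty) (m : I → ℕ)
      (S : I → SType Tag) (hIJ : I ⊆ J), Γ x = some (.amp I hI m S) ∧
      (∀ i : I, Typed prog (n + m i) (P ⟨i, hIJ i.2⟩) (Γ.set x (S i))) ∧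
      ∀ j, (P j).fn ⊆ Γ.dom := by
  cases h.rule with
  | case n x Γ I J hI m S hIJ P h1 h2 h3 => exact ⟨I, hI, m, S, hIJ, h1, h2, h3⟩

theorem Typed.link_inv {n x y : ℕ} {Γ : Ctx Tag} (h : Typed prog n (link x y) Γ) :
    ∃ S T, 1 ≤ n ∧ x ≠ y ∧ Sub S.dual T ∧ Γ = (Ctx.empty.set x S).set y T := by
  cases h.rule with
  | link n x y S T h1 h2 h3 => exact ⟨S, T, h1, h2, h3, rfl⟩

theorem Typed.call_inv {n : ℕ} {A : Name} {xs : List ℕ} {Γ : Ctx Tag}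
    (h : Typed prog n (call A xs) Γ) : ∃ m ≤ n, xs.length = prog.arity A ∧ xs.Nodup ∧
      Typed prog m (prog.unfold A xs) Γ ∧ Γ.dom = {x | x ∈ xs} := by
  cases h.rule with
  | call m n A xs Γ h1 h2 h3 h4 h5 => exact ⟨m, h5, h1, h2, h4, h3⟩

/-- One of the two branches of a well-typed choice has a smaller measure than the choice. -/
theorem Typed.choice_inv {n : ℕ} {P Q : Proc Tag Name} {Γ : Ctx Tag}
    (h : Typed prog n (choice P Q) Γ) : ∃ m m', Typed prog m P Γ ∧ Typed prog m' Q Γ ∧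
      (m < n ∨ m' < n) := by
  cases h.rule with
  | choice_left m m' P Q Γ h1 h2 => exact ⟨m, m', h1, h2, .inl (by omega)⟩
  | choice_right m m' P Q Γ h1 h2 => exact ⟨m, m', h1, h2, .inr (by omega)⟩

/-- The domain of a context that types a process consists of the free channels of the process. -/
theorem Typed.mem_fn_iff {P : Proc Tag Name} :
    ∀ {n : ℕ} {Γ : Ctx Tag}, Typed prog n P Γ → ∀ {z : ℕ}, z ∈ P.fn ↔ Γ z ≠ none := by
  induction P with
  | link x y =>
    intro n Γ h z
    obtain ⟨S, T, -, -, -, rfl⟩ := h.link_inv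
    rw [mem_fn_link]
    grind
  | close x =>
    intro n Γ h z
    cases h.rule
    rw [mem_fn_close]
    grind
  | select x a P ih =>
    intro n Γ h z
    obtain ⟨n, I, hI, m, S, ha, -, hx, hP⟩ := h.select_inv
    rw [mem_fn_select, ih hP]
    grind
  | fork x P Q ihP ihQ =>
    intro n Γ h z
    obtain ⟨m, n, S, T, Γ₁, Γ₂, -, hx, hs, hP, hQ⟩ := h.fork_inv
    rw [mem_fn_fork, ihP hP, ihQ hQ]
    have := hs z
    grind
  | choice P Q ihP ihQ =>
    intro n Γ h z
    obtain ⟨m, m', hP, hQ, -⟩ := h.choice_inv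
    rw [mem_fn_choice, ihP hP, ihQ hQ, or_self]
  | done =>
    intro n Γ h z
    cases h.rule
    simp
  | call A xs =>
    intro n Γ h z
    obtain ⟨m, -, -, -, -, hd⟩ := h.call_inv
    rw [mem_fn_call]
    exact (Set.ext_iff.1 hd z).symm
  | wait x P ih =>
    intro n Γ h z
    obtain ⟨hx, hP⟩ := h.wait_inv
    rw [mem_fn_wait, ih hP]
    grind
  | case x J P ih =>
    intro n Γ h z
    obtain ⟨I, hI, m, S, hIJ, hx, hP, hd⟩ := h.case_inv
    rw [mem_fn_case]
    constructor
    · rintro (rfl | ⟨j, hj⟩)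
      · simp [hx]
      · exact hd j hj
    · intro hz
      obtain ⟨i, hi⟩ := hI
      refine .inr ⟨⟨i, hIJ hi⟩, (ih _ (hP ⟨i, hi⟩)).2 ?_⟩
      grind
  | join x P ih =>
    intro n Γ h z
    obtain ⟨S, T, hx, hP⟩ := h.join_inv
    rw [mem_fn_join, ih hP]
    grind
  | cut P Q ihP ihQ =>
    intro n Γ h z
    obtain ⟨m, n, S, T, Γ₁, Γ₂, -, hs, -, hP, hQ⟩ := h.cut_inv
    rw [mem_fn_cut, ihP hP, ihQ hQ]
    have := hs z
    grind

/-- Typing is preserved by renamings that are injective on the context. -/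
theorem Typed.rename {n : ℕ} {P : Proc Tag Name} {Γ Δ : Ctx Tag} {ρ : ℕ → ℕ}
    (h : Typed prog n P Γ) (hρ : Ctx.Ren ρ Γ Δ) : Typed prog n (P.rename ρ) Δ := by
  refine ⟨fun n Q Δ => ∃ P Γ ρ, Q = P.rename ρ ∧ Typed prog n P Γ ∧ Ctx.Ren ρ Γ Δ, ?_,
    P, Γ, ρ, rfl, h, hρ⟩
  clear h hρ
  rintro n _ Δ ⟨P, Γ, ρ, rfl, h, hρ⟩
  refine ⟨hρ.regular h.regular, ?_⟩
  cases h.rule with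
  | done => rw [hρ.unique (Ctx.Ren.empty ρ)]; exact .done _
  | link n x y S T h1 h2 h3 =>
    have hxy : ρ x ≠ ρ y := fun e => h2 (hρ.inj x y (by grind) (by grind) e)
    rw [hρ.unique (((Ctx.Ren.empty ρ).set S (x := x) (by simp)).set T (x := y) ?_)]
    · exact .link n _ _ S T h1 hxy h3
    · intro z hz e
      have : z = x := by grind
      exact (hxy (this ▸ e)).elim
  | call m n A xs Γ h1 h2 h3 h4 h5 =>
    have hdom : ∀ x, Γ x ≠ none ↔ x ∈ xs := fun x => Set.ext_iff.1 h3 x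
    refine .call m n A _ Δ (by simpa using h1) ?_ ?_
      ⟨_, Γ, ρ, (prog.unfold_rename A xs ρ h1).symm, h4, hρ⟩ h5
    · exact h2.map_on fun x hx y hy e => hρ.inj x y ((hdom x).2 hx) ((hdom y).2 hy) e
    · ext z
      change Δ z ≠ none ↔ z ∈ xs.map ρ
      rw [List.mem_map]
      constructor
      · intro hz
        obtain ⟨S, hz⟩ := Option.ne_none_iff_exists'.1 hz
        obtain ⟨x, hx, hxS⟩ := (hρ.iff z S).1 hz
        exact ⟨x, (hdom x).1 (by simp [hxS]), hx⟩
      · rintro ⟨x, hx, rfl⟩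
        obtain ⟨S, hx⟩ := Option.ne_none_iff_exists'.1 ((hdom x).2 hx)
        simp [hρ.apply hx]
  | choice_left m n P Q Γ h1 h2 =>
    exact .choice_left m n _ _ Δ ⟨P, Γ, ρ, rfl, h1, hρ⟩ ⟨Q, Γ, ρ, rfl, h2, hρ⟩
  | choice_right m n P Q Γ h1 h2 =>
    exact .choice_right m n _ _ Δ ⟨P, Γ, ρ, rfl, h1, hρ⟩ ⟨Q, Γ, ρ, rfl, h2, hρ⟩
  | cut m n P Q S T Γ Γ₁ Γ₂ h1 h2 h3 h4 =>
    obtain ⟨Δ₁, Δ₂, hs, hρ₁, hρ₂⟩ := hρ.split h1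
    exact .cut m n _ _ S T Δ Δ₁ Δ₂ hs h2 ⟨P, _, _, rfl, h3, hρ₁.cons S⟩
      ⟨Q, _, _, rfl, h4, hρ₂.cons T⟩
  | close n x h1 =>
    rw [hρ.unique ((Ctx.Ren.empty ρ).set .one (x := x) (by simp))]
    exact .close n _ h1
  | wait n x P Γ h1 h2 =>
    exact .wait n _ _ Δ (hρ.apply h1) ⟨P, _, ρ, rfl, h2, hρ.erase (by simp [h1])⟩
  | select n x P Γ I hI m S k h1 h2 =>
    exact .select n _ _ Δ I hI m S k (hρ.apply h1) ⟨P, _, ρ, rfl, h2,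
      hρ.set _ fun y hy e => hρ.inj y x hy (by simp [h1]) e⟩
  | case n x Γ I J hI m S hIJ P h1 h2 h3 =>
    refine .case n _ Δ I J hI m S hIJ _ (hρ.apply h1) (fun i => ⟨_, _, ρ, rfl, h2 i,
      hρ.set _ fun y hy e => hρ.inj y x hy (by simp [h1]) e⟩) fun j z hz => ?_
    obtain ⟨y, hy, rfl⟩ := (mem_fn_rename _).1 hz
    obtain ⟨U, hU⟩ := Option.ne_none_iff_exists'.1 (h3 j hy)
    change Δ _ ≠ none
    simp [hρ.apply hU]
  | fork m n x P Q S T Γ Γ₁ Γ₂ h1 h2 h3 h4 =>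
    obtain ⟨Δ₁, Δ₂, hs, hρ₁, hρ₂⟩ := (hρ.erase (x := x) (by simp [h1])).split h2
    refine .fork m n _ _ _ S T Δ Δ₁ Δ₂ (hρ.apply h1) hs ⟨P, _, _, rfl, h3, hρ₁.cons S⟩
      ⟨Q, _, _, rfl, h4, hρ₂.set _ fun y hy e => hρ.inj y x ?_ (by simp [h1]) e⟩
    have := h2 y
    grind
  | join n x P S T Γ h1 h2 =>
    exact .join n _ _ S T Δ (hρ.apply h1) ⟨P, _, _, rfl, h2,
      (hρ.set _ fun y hy e => hρ.inj y x hy (by simp [h1]) e).cons S⟩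

/-- The definition of `A` is well typed, for some choice of distinct parameters. -/
def TypedName (prog : Program Tag Name) (A : Name) : Prop :=
  ∃ (xs : List ℕ) (n : ℕ) (Γ : Ctx Tag), xs.length = prog.arity A ∧ xs.Nodup ∧
    Typed prog n (prog.unfold A xs) Γ

/-- Well-typed processes are good. The good branch of a case is any branch for a tag of its type:
there is one because types have at least one branch, and its free channels are all the channels of
the context. -/
theorem Typed.good {P : Proc Tag Name} : ∀ {n : ℕ} {Γ : Ctx Tag}, Typed prog n P Γ →
    P.Good prog (TypedName prog) := by
  induction P with
  | link | close | done => intros; trivial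
  | select x a P ih =>
    intro n Γ h
    obtain ⟨n, I, hI, m, S, ha, -, hx, hP⟩ := h.select_inv
    exact ih hP
  | fork x P Q ihP ihQ =>
    intro n Γ h
    obtain ⟨m, n, S, T, Γ₁, Γ₂, -, hx, hs, hP, hQ⟩ := h.fork_inv
    exact ⟨ihP hP, ihQ hQ⟩
  | choice P Q ihP ihQ =>
    intro n Γ h
    obtain ⟨m, m', hP, hQ, -⟩ := h.choice_inv
    exact ⟨ihP hP, ihQ hQ⟩
  | call A xs =>
    intro n Γ h
    obtain ⟨m, -, hA, hxs, hP, -⟩ := h.call_inv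
    exact ⟨⟨xs, m, Γ, hA, hxs, hP⟩, hA⟩
  | wait x P ih => exact fun h => ih h.wait_inv.2
  | case x J P ih =>
    intro n Γ h
    obtain ⟨I, ⟨i, hi⟩, m, S, hIJ, hx, hP, hd⟩ := h.case_inv
    refine ⟨⟨i, hIJ hi⟩, ih _ (hP ⟨i, hi⟩), fun j z hz => .inr ?_⟩
    rw [(hP ⟨i, hi⟩).mem_fn_iff]
    have : Γ z ≠ none := hd j hz
    grind
  | join x P ih =>
    intro n Γ h
    obtain ⟨S, T, hx, hP⟩ := h.join_inv
    exact ih hP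
  | cut P Q ihP ihQ =>
    intro n Γ h
    obtain ⟨m, n, S, T, Γ₁, Γ₂, -, hs, -, hP, hQ⟩ := h.cut_inv
    exact ⟨ihP hP, ihQ hQ⟩

theorem TypedName.good_body {A : Name} (h : TypedName prog A) :
    (prog.body A).Good prog (TypedName prog) := by
  obtain ⟨xs, n, Γ, hA, hxs, h⟩ := h
  have := h.good.rename (ρ := fun z => xs.idxOf z)
  rwa [Program.unfold, rename_rename, rename_eq_self] at this
  intro i hi
  rw [prog.fn_body] at hi
  have hi : i < xs.length := hA ▸ hi
  simp [hi, hxs.idxOf_getElem]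

end Typing

open Proc

variable {prog : Program Tag Name}

/-! ### Typing of buffers -/

/-- `BufTyped prog B n S S' Γ`: the messages of the buffer `B` take a channel from type `S` to type
`S'`; they have measure `n`, and `Γ` types the channels that occur in them. -/
inductive BufTyped (prog : Program Tag Name) :
    Buffer Tag Name → ℕ → SType Tag → SType Tag → Ctx Tag → Prop
  | nil (S) : BufTyped prog [] 0 S S .empty
  | tag {I : Finset Tag} {hI : I.Nonempty} {m : I → ℕ} {S : I → SType Tag} {a : Tag} (ha : a ∈ I)
      {B n S' Γ} : BufTyped prog B n (S ⟨a, ha⟩) S' Γ →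
      BufTyped prog (.tag a :: B) (1 + m ⟨a, ha⟩ + n) (.plus I hI m S) S' Γ
  | chan {R : Proc Tag Name} {B m n S T S' Γ Γ₁ Γ₂} : Γ.Split Γ₁ Γ₂ → Typed prog m R (Γ₁.cons S) →
      BufTyped prog B n T S' Γ₂ → BufTyped prog (.chan R :: B) (1 + m + n) (.tensor S T) S' Γ

/-- The typing of a filled buffer splits into a typing of the buffer and one of the process in the
hole, where the channel of the buffer has the type left by its messages. `BufTyped.plug` is the
converse. -/
theorem Typed.plug_inv {x : ℕ} {B : Buffer Tag Name} {P : Proc Tag Name} {S : SType Tag} :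
    ∀ {N : ℕ} {Γ : Ctx Tag}, Typed prog N (B.plug x P) Γ → Γ x = some S →
    ∃ n m S' Γ₁ Γ₂, N = n + m ∧ BufTyped prog B n S S' Γ₁ ∧ (Γ.erase x).Split Γ₁ Γ₂ ∧
      Typed prog m P (Γ₂.set x S') := by
  induction B generalizing S with
  | nil =>
    intro N Γ h hx
    refine ⟨0, N, S, .empty, Γ.erase x, (Nat.zero_add N).symm, .nil S, Ctx.split_empty _, ?_⟩
    rw [Ctx.set_erase hx]
    exact h
  | cons b B ih =>
    intro N Γ h hx
    cases b with
    | tag a =>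
      obtain ⟨n, I, hI, m, S₀, ha, rfl, hx', hP⟩ := Typed.select_inv h
      rw [hx] at hx'
      cases hx'
      obtain ⟨n', m', S', Γ₁, Γ₂, rfl, hB, hs, hP'⟩ := ih hP (Ctx.set_self ..)
      rw [Ctx.erase_set] at hs
      exact ⟨_, m', S', Γ₁, Γ₂, by omega, .tag ha hB, hs, hP'⟩
    | chan R =>
      obtain ⟨m, n, S₁, T, Δ₁, Δ₂, rfl, hx', hs, hR, hP⟩ := Typed.fork_inv h
      rw [hx] at hx'
      cases hx'
      obtain ⟨n', m', S', Γ₁, Γ₂, rfl, hB, hs', hP'⟩ := ih hP (Ctx.set_self ..)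
      have hx₂ : Δ₂ x = none := by have := hs x; grind
      rw [Ctx.erase_set, Ctx.erase_of_none hx₂] at hs'
      obtain ⟨h1, h2⟩ := hs.assoc hs'
      exact ⟨_, m', S', _, Γ₂, by omega, .chan h2 hR hB, h1, hP'⟩

theorem BufTyped.plug {B : Buffer Tag Name} {n S S' Γ₁} (hB : BufTyped prog B n S S' Γ₁) :
    ∀ {x m : ℕ} {P : Proc Tag Name} {Γ Γ₂ : Ctx Tag}, Γ.Regular → Γ x = some S →
    (Γ.erase x).Split Γ₁ Γ₂ → Typed prog m P (Γ₂.set x S') →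
    Typed prog (n + m) (B.plug x P) Γ := by
  induction hB with
  | nil S =>
    intro x m P Γ Γ₂ hΓ hx hs hP
    rw [← Ctx.split_empty_iff.1 hs, Ctx.set_erase hx] at hP
    rw [Nat.zero_add]
    exact hP
  | @tag I hI m S a ha B n S' Γ₁ _ ih =>
    intro x m' P Γ Γ₂ hΓ hx hs hP
    rw [Nat.add_assoc]
    have hr := (hΓ x _ hx).child (SType.child_plus I hI m S ⟨a, ha⟩)
    refine .intro hΓ (.select _ x _ Γ I hI m S ⟨a, ha⟩ hx (ih (hΓ.set hr) (Ctx.set_self ..) ?_ hP))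
    rwa [Ctx.erase_set]
  | @chan R B m n S T S' Γ₁ Δ₁ Δ₂ hs hR _ ih =>
    intro x m' P Γ Γ₂ hΓ hx hs' hP
    rw [Nat.add_assoc]
    obtain ⟨h1, h2⟩ := hs'.assoc' hs
    have hr := (hΓ x _ hx).child (SType.child_tensor_right S T)
    have hx₂ : (Δ₂.union Γ₂) x = none := by have := h1 x; grind
    refine .intro hΓ (.fork m _ x R _ S T Γ _ _ hx h1 hR (ih ?_ (Ctx.set_self ..) ?_ hP))
    · exact (h1.regular_right hΓ.erase).set hr
    · rwa [Ctx.erase_set, Ctx.erase_of_none hx₂]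

theorem BufTyped.mem_fn_iff {B : Buffer Tag Name} {n S S' Γ} (h : BufTyped prog B n S S' Γ) :
    ∀ {z : ℕ}, z ∈ B.fn ↔ Γ z ≠ none := by
  induction h with
  | nil => intro z; simp
  | tag _ _ ih => exact ih
  | chan hs hR _ ih =>
    intro z
    rw [Buffer.mem_fn_chan, ih, hR.mem_fn_iff]
    have := hs z
    grind

theorem BufTyped.rename {B : Buffer Tag Name} {n S S' Γ} (h : BufTyped prog B n S S' Γ) :
    ∀ {ρ Δ}, Ctx.Ren ρ Γ Δ → BufTyped prog (B.rename ρ) n S S' Δ := by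
  induction h with
  | nil => intro ρ Δ hρ; rw [hρ.unique (Ctx.Ren.empty ρ)]; exact .nil _
  | tag ha _ ih => intro ρ Δ hρ; exact .tag ha (ih hρ)
  | chan hs hR _ ih =>
    intro ρ Δ hρ
    obtain ⟨Δ₁, Δ₂, hs', hρ₁, hρ₂⟩ := hρ.split hs
    exact .chan hs' (hR.rename (hρ₁.cons _)) (ih hρ₂)

/-- An input of the type at the entrance of a buffer is an input of the type at its exit. -/
theorem BufTyped.trans_inp {B : Buffer Tag Name} {n S S' Γ} (h : BufTyped prog B n S S' Γ) {σ} :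
    ∀ {T}, Trans S (.inp σ) T → ∃ T', Trans S' (.inp σ) T' ∧ BufTyped prog B n T T' Γ := by
  induction h with
  | nil => exact fun hT => ⟨_, hT, .nil _⟩
  | tag ha _ ih =>
    intro T hT
    obtain ⟨U, hU, rfl⟩ := trans_plus_inp_iff.1 hT
    obtain ⟨T', h1, h2⟩ := ih (hU _)
    exact ⟨T', h1, .tag ha h2⟩
  | chan hs hR _ ih =>
    intro T hT
    obtain ⟨U, hU, rfl⟩ := trans_tensor_inp_iff.1 hT
    obtain ⟨T', h1, h2⟩ := ih hU
    exact ⟨T', h1, .chan hs hR h2⟩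

/-! ### Congruence of typing for smaller contexts -/

theorem Typed.cut_sub {m n : ℕ} {P Q : Proc Tag Name} {S T : SType Tag} {Γ Γ₁ Γ₂ Δ₁ Δ₂ : Ctx Tag}
    (hs : Γ.Split Γ₁ Γ₂) (hc : Correct S T) (hT : T.Regular) (hP : Typed prog m P Δ₁)
    (h₁ : Δ₁.Sub (Γ₁.cons S)) (hQ : Typed prog n Q Δ₂) (h₂ : Δ₂.Sub (Γ₂.cons T)) :
    ∃ Δ, Typed prog (m + n) (.cut P Q) Δ ∧ Δ.Sub Γ := by
  obtain ⟨S', hS, h1, e1⟩ := h₁.of_cons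
  obtain ⟨T', hT', h2, e2⟩ := h₂.of_cons
  obtain ⟨h3, h4⟩ := hs.sub h1 h2
  rw [e1] at hP
  rw [e2] at hQ
  exact ⟨_, .cut h3 (hc.mono hS hT' hP.regular.head hT) hP hQ, h4⟩

/-- The new type of `x` has `a` as its only tag, since nothing is known about the other branches of
the old one. It is a subtype of the old type because the old type has the same output. -/
theorem Typed.select_sub {n x : ℕ} {a : Tag} {P : Proc Tag Name} {I : Finset Tag}
    {hI : I.Nonempty} {m : I → ℕ} {S : I → SType Tag} {ha : a ∈ I} {Γ Δ : Ctx Tag}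
    (hx : Γ x = some (.plus I hI m S)) (hP : Typed prog n P Δ)
    (h : Δ.Sub (Γ.set x (S ⟨a, ha⟩))) :
    ∃ Δ', Typed prog (1 + m ⟨a, ha⟩ + n) (.select x a P) Δ' ∧ Δ'.Sub Γ := by
  obtain ⟨S', hx', hS⟩ := h.of_set
  have hreg := hP.regular x S' hx'
  refine ⟨Δ.set x (.plus {a} (Finset.singleton_nonempty a) (fun _ => m ⟨a, ha⟩) fun _ => S'),
    .intro (hP.regular.set (SType.regular_singleton_plus hreg))
      (.select n x P _ {a} _ (fun _ => m ⟨a, ha⟩) (fun _ => S')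
        ⟨a, Finset.mem_singleton_self a⟩ (Ctx.set_self ..) ?_), ?_⟩
  · rwa [← Ctx.set_erase_eq, Ctx.erase_set, Ctx.set_erase hx']
  · have := (h.erase x).set (x := x)
      (sub_of_trans_tag (trans_plus_out_iff.2 ⟨⟨a, ha⟩, rfl, rfl⟩ :
        Trans (.plus I hI m S) (.out (.tag (m ⟨a, ha⟩) a)) _) hS)
    rwa [Ctx.erase_set, Ctx.set_erase hx, Ctx.set_erase_eq] at this

theorem Typed.fork_sub {m n x : ℕ} {P Q : Proc Tag Name} {S T : SType Tag} {Γ Γ₁ Γ₂ Δ : Ctx Tag}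
    (hx : Γ x = some (.tensor S T)) (hs : (Γ.erase x).Split Γ₁ Γ₂)
    (hP : Typed prog m P (Γ₁.cons S)) (hQ : Typed prog n Q Δ) (h : Δ.Sub (Γ₂.set x T)) :
    ∃ Δ', Typed prog (1 + m + n) (.fork x P Q) Δ' ∧ Δ'.Sub Γ := by
  obtain ⟨T', hx', hT⟩ := h.of_set
  have hx₁ : Γ₁ x = none := by have := hs x; grind
  have hx₂ : Γ₂ x = none := by have := hs x; grind
  have h1 := h.erase x
  rw [Ctx.erase_set, Ctx.erase_of_none hx₂] at h1
  obtain ⟨h2, h3⟩ := hs.sub (Ctx.Sub.refl _) h1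
  have h4 : (Γ₁.union (Δ.erase x)) x = none := by simp [hx₁]
  refine ⟨(Γ₁.union (Δ.erase x)).set x (.tensor S T'), .intro ?_
    (.fork m n x P Q S T' _ Γ₁ (Δ.erase x) (Ctx.set_self ..) ?_ hP ?_), ?_⟩
  · exact (h2.regular hP.regular.of_cons hQ.regular.erase).set
      (SType.regular_tensor hP.regular.head (hQ.regular x T' hx'))
  · rwa [Ctx.erase_set, Ctx.erase_of_none h4]
  · rwa [Ctx.set_erase hx']
  · have := h3.set (x := x) (sub_of_trans_chan (trans_tensor_out_iff.2 ⟨rfl, rfl⟩ :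
        Trans (.tensor S T) (.out (.chan S)) T) (Sub.refl S) hT)
    rwa [Ctx.set_erase hx] at this

/-! ### Typing and structural pre-congruence -/

theorem Typed.link_symm {n x y : ℕ} {Γ : Ctx Tag} (h : Typed prog n (link x y) Γ) :
    Typed prog n (link y x) Γ := by
  obtain ⟨S, T, hn, hxy, hs, rfl⟩ := h.link_inv
  have hT : T.Regular := h.regular y T (by simp)
  refine .intro h.regular ?_
  have : (Ctx.empty.set x S).set y T = (Ctx.empty.set y T).set x S := by funext z; grind
  rw [this]
  exact .link n y x T S hn hxy.symm (hs.dual_symm hT)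

theorem Typed.cut_comm {n : ℕ} {P Q : Proc Tag Name} {Γ : Ctx Tag}
    (h : Typed prog n (Proc.cut P Q) Γ) :
    Typed prog n (Proc.cut Q P) Γ := by
  obtain ⟨m, n, S, T, Γ₁, Γ₂, rfl, hs, hc, hP, hQ⟩ := h.cut_inv
  rw [Nat.add_comm]
  exact .cut hs.symm hc.symm hQ hP

theorem Typed.cut_plug_wait {n y : ℕ} {B : Buffer Tag Name} {P Q : Proc Tag Name} {Γ : Ctx Tag}
    (h : Typed prog n (Proc.cut (B.plug 0 (wait (y + 1) P)) Q) Γ) :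
    Typed prog n (wait y (Proc.cut (B.plug 0 P) Q)) Γ := by
  obtain ⟨m, n, S, T, Γ₁, Γ₂, rfl, hs, hc, hP, hQ⟩ := h.cut_inv
  obtain ⟨k, m, S', Δ₁, Δ₂, rfl, hB, hs', hP'⟩ := hP.plug_inv (Ctx.cons_zero ..)
  obtain ⟨hy, hP'⟩ := hP'.wait_inv
  have hy₁ : Γ₁ y = some .bot := by have := hs' (y + 1); grind
  have hy₂ : Γ y = some .bot := by have := hs y; grind
  refine .intro h.regular (.wait _ y _ Γ hy₂ (.cut (S := S) (T := T) (Γ₁ := Γ₁.erase y) ?_ hc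
    (hB.plug ?_ (Ctx.cons_zero ..) (Γ₂ := Δ₂.erase (y + 1)) ?_ ?_) hQ))
  · intro z; have := hs z; grind
  · exact hP.regular.of_cons.erase.cons hP.regular.head
  · rintro (_ | z)
    · have := hs' 0; grind
    · have := hs' (z + 1); grind
  · convert hP' using 1
    funext z; grind

theorem Typed.cut_plug_case {n y : ℕ} {B : Buffer Tag Name} {J : Finset Tag}
    {P : J → Proc Tag Name} {Q : Proc Tag Name} {Γ : Ctx Tag}
    (h : Typed prog n (Proc.cut (B.plug 0 (case (y + 1) J P)) Q) Γ) :
    Typed prog n (case y J fun i => Proc.cut (B.plug 0 (P i)) Q) Γ := by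
  obtain ⟨m, n, S, T, Γ₁, Γ₂, rfl, hs, hc, hP, hQ⟩ := h.cut_inv
  obtain ⟨k, m, S', Δ₁, Δ₂, rfl, hB, hs', hP'⟩ := hP.plug_inv (Ctx.cons_zero ..)
  obtain ⟨I, hI, μ, U, hIJ, hy, hP', hd⟩ := hP'.case_inv
  have hy₁ : Γ₁ y = some (.amp I hI μ U) := by have := hs' (y + 1); grind
  have hy₂ : Γ y = some (.amp I hI μ U) := by have := hs y; grind
  refine .intro h.regular (.case _ y Γ I J hI μ U hIJ _ hy₂ (fun i => ?_) fun j z hz => ?_)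
  · have : k + m + n + μ i = k + (m + μ i) + n := by omega
    rw [this]
    refine .cut (S := S) (T := T) (Γ₁ := Γ₁.set y (U i)) ?_ hc
      (hB.plug ?_ (Ctx.cons_zero ..) (Γ₂ := Δ₂.set (y + 1) (U i)) ?_ ?_) hQ
    · intro z; have := hs z; grind
    · refine Ctx.Regular.cons (hP.regular.of_cons.set ?_) hP.regular.head
      exact (h.regular y _ hy₂).child (SType.child_amp ..)
    · rintro (_ | z)
      · have := hs' 0; grind
      · have := hs' (z + 1); grind
    · convert hP' i using 1
      funext z; grind
  · change Γ z ≠ none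
    rw [← h.mem_fn_iff]
    simp only [mem_fn_cut, Buffer.mem_fn_plug, mem_fn_case] at hz ⊢
    rcases hz with (h | h | h) | h
    · exact .inl (.inl h)
    · exact .inl (.inr (.inl (.inr ⟨j, h⟩)))
    · exact .inl (.inr (.inr h))
    · exact .inr h

theorem Typed.cut_plug_join {n y : ℕ} {B : Buffer Tag Name} {P Q : Proc Tag Name} {Γ : Ctx Tag}
    (h : Typed prog n (Proc.cut (B.plug 0 (join (y + 1) P)) Q) Γ) :
    Typed prog n (join y (Proc.cut ((B.rename (up Nat.succ)).plug 0 (P.rename swap))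
      (Q.rename (up Nat.succ)))) Γ := by
  obtain ⟨m, n, S, T, Γ₁, Γ₂, rfl, hs, hc, hP, hQ⟩ := h.cut_inv
  obtain ⟨k, m, S', Δ₁, Δ₂, rfl, hB, hs', hP'⟩ := hP.plug_inv (Ctx.cons_zero ..)
  obtain ⟨U, V, hy, hP'⟩ := hP'.join_inv
  have hy₁ : Γ₁ y = some (.par U V) := by have := hs' (y + 1); grind
  have hy₂ : Γ y = some (.par U V) := by have := hs y; grind
  have hr := h.regular y _ hy₂
  have h0 : Δ₁ 0 = none := by have := hs' 0; grind
  have hB' : BufTyped prog (B.rename (up Nat.succ)) k S S' Δ₁.tail.shift.shift := by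
    refine hB.rename (Ctx.Ren.of_leftInverse (ρ' := up Nat.pred) ?_ ?_)
    · rintro (_ | x) W hx
      · simp [h0] at hx
      · exact ⟨rfl, hx⟩
    · rintro (_ | _ | x) W hx
      · simp at hx
      · simp at hx
      · exact ⟨rfl, hx⟩
  refine .intro h.regular (.join _ y _ U V Γ hy₂ (.cut (S := S) (T := T)
    (Γ₁ := (Γ₁.set y V).cons U) (Γ₂ := Γ₂.shift) ?_ hc (hB'.plug ?_ (Ctx.cons_zero ..)
    (Γ₂ := ((Δ₂.tail.set y V).cons U).shift) ?_ ?_) (hQ.rename ((Ctx.Ren.succ Γ₂).cons T))))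
  · rintro (_ | z)
    · exact .inl ⟨rfl, rfl⟩
    · have := hs z; grind
  · exact ((hP.regular.of_cons.set (hr.child (SType.child_par_right ..))).cons
      (hr.child (SType.child_par_left ..))).cons hP.regular.head
  · rintro (_ | _ | z)
    · grind
    · grind
    · have := hs' (z + 1); grind
  · convert hP'.rename (Ctx.Ren.swap _) using 1
    funext z
    rcases z with _ | _ | z
    · simp; grind
    · rfl
    · simp; grind

theorem Typed.cut_fork {n y : ℕ} {P Q R : Proc Tag Name} {Γ : Ctx Tag}
    (h : Typed prog n (Proc.cut (fork (y + 1) P (Q.rename Nat.succ)) R) Γ) (h₁ : 1 ∈ P.fn) :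
    Typed prog n (fork y (Proc.cut (P.rename swap) (R.rename (up Nat.succ))) Q) Γ := by
  obtain ⟨m, r, S, T, Γ₁, Γ₂, rfl, hs, hc, hP, hR⟩ := h.cut_inv
  obtain ⟨m, n, U, V, Δ₁, Δ₂, rfl, hy, hs', hP', hQ⟩ := hP.fork_inv
  rw [hP'.mem_fn_iff] at h₁
  have h0 : Δ₁ 0 = some S ∧ Δ₂ 0 = none := by have := hs' 0; grind
  have hy₂ : Γ y = some (.tensor U V) := by have := hs y; grind
  have hQ' : Typed prog n Q (Δ₂.tail.set y V) := by
    have := hQ.rename (ρ := Nat.pred) (Ctx.Ren.pred (by grind))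
    rw [rename_pred_succ] at this
    convert this using 1
    funext z; grind
  have : 1 + m + n + r = 1 + (m + r) + n := by omega
  rw [this]
  refine .intro h.regular (.fork _ n y _ Q U V Γ (Δ₁.tail.union Γ₂) Δ₂.tail hy₂ ?_
    (.cut (S := S) (T := T) (Γ₁ := Δ₁.tail.cons U) (Γ₂ := Γ₂.shift) ?_ hc ?_
    (hR.rename ((Ctx.Ren.succ Γ₂).cons T))) hQ')
  · intro z; have := hs z; have := hs' (z + 1); grind
  · rintro (_ | z)
    · grind
    · have := hs z; have := hs' (z + 1); grind
  · convert hP'.rename (Ctx.Ren.swap _) using 1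
    funext z
    rcases z with _ | _ | z
    · simp [h0.1]
    · simp
    · simp

theorem Typed.cut_plug_pull {n y : ℕ} {B : Buffer Tag Name} {P Q : Proc Tag Name} {Γ : Ctx Tag}
    (h : Typed prog n (Proc.cut ((B.rename Nat.succ).plug (y + 1) P) Q) Γ) :
    Typed prog n (B.plug y (Proc.cut P Q)) Γ := by
  rcases B.eq_nil_or_concat' with rfl | hB₀
  · exact h
  have hne : B ≠ [] := by rintro rfl; simp at hB₀
  clear hB₀
  obtain ⟨m, r, S, T, Γ₁, Γ₂, rfl, hs, hc, hP, hQ⟩ := h.cut_inv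
  have hy : (Γ₁.cons S) (y + 1) ≠ none := by
    rw [← hP.mem_fn_iff, Buffer.mem_fn_plug]
    exact .inr (.inr ⟨rfl, by simpa using hne⟩)
  obtain ⟨U, hy⟩ := Option.ne_none_iff_exists'.1 hy
  obtain ⟨k, m, U', Δ₁, Δ₂, rfl, hB, hs', hP'⟩ := hP.plug_inv hy
  have h0 : Δ₁ 0 = none := by
    by_contra h0
    have := hB.mem_fn_iff.2 h0
    simp at this
  have hB' := hB.rename (Ctx.Ren.pred h0)
  rw [Buffer.rename_pred_succ] at hB'
  have hy₂ : Γ y = some U := by have := hs y; grind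
  rw [Nat.add_assoc]
  refine hB'.plug h.regular hy₂ (Γ₂ := Δ₂.tail.union Γ₂) ?_ (.cut (S := S) (T := T)
    (Γ₁ := Δ₂.tail.set y U') ?_ hc ?_ hQ)
  · intro z; have := hs z; have := hs' (z + 1); grind
  · intro z; have := hs z; have := hs' (z + 1); grind
  · convert hP' using 1
    funext z
    rcases z with _ | z
    · have := hs' 0; grind
    · grind

theorem Typed.plug_fork {n x y : ℕ} {B : Buffer Tag Name} {P Q : Proc Tag Name} {Γ : Ctx Tag}
    (h : Typed prog n (B.plug x (fork y P Q)) Γ) (hxy : x ≠ y) (hx : x + 1 ∈ P.fn) :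
    Typed prog n (fork y ((B.rename Nat.succ).plug (x + 1) P) Q) Γ := by
  have hxΓ : Γ x ≠ none := by
    rw [← h.mem_fn_iff, Buffer.mem_fn_plug, mem_fn_fork]
    exact .inr (.inl (.inr (.inl hx)))
  obtain ⟨S, hxΓ⟩ := Option.ne_none_iff_exists'.1 hxΓ
  obtain ⟨k, n, S', Γ₁, Γ₂, rfl, hB, hs, h'⟩ := h.plug_inv hxΓ
  obtain ⟨m, n, U, V, Δ₁, Δ₂, rfl, hy, hs', hP, hQ⟩ := h'.fork_inv
  rw [hP.mem_fn_iff] at hx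
  have hyΓ : Γ y = some (.tensor U V) := by have := hs y; grind
  have : k + (1 + m + n) = 1 + (k + m) + n := by omega
  rw [this]
  refine .intro h.regular (.fork _ n y _ Q U V Γ (Γ₁.union (Δ₁.set x S)) Δ₂ hyΓ ?_
    ((hB.rename (Ctx.Ren.succ _)).plug ?_ (S := S) (Γ₂ := (Δ₁.erase x).cons U) ?_ ?_ ?_) hQ)
  · intro z; have := hs z; have := hs' z; grind
  · refine Ctx.Regular.cons ?_ hP.regular.head
    intro z W hz
    have := hs z; have := hs' z; have := h.regular z W
    grind
  · have := hs x; grind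
  · rintro (_ | z)
    · grind
    · have := hs z; have := hs' z; grind
  · convert hP using 1
    funext z
    rcases z with _ | z
    · grind
    · have := hs' z; grind

theorem Typed.plug_plug {n x y : ℕ} {B B' : Buffer Tag Name} {P : Proc Tag Name} {Γ : Ctx Tag}
    (h : Typed prog n (B.plug x (B'.plug y P)) Γ) (hxy : x ≠ y) (hx : x ∈ P.fn) :
    Typed prog n (B'.plug y (B.plug x P)) Γ := by
  by_cases hB' : B' = []
  · subst hB'; exact h
  have hxΓ : Γ x ≠ none := by
    rw [← h.mem_fn_iff, Buffer.mem_fn_plug, Buffer.mem_fn_plug]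
    exact .inr (.inl (.inr (.inl hx)))
  obtain ⟨S, hxΓ⟩ := Option.ne_none_iff_exists'.1 hxΓ
  obtain ⟨k, n, S', Γ₁, Γ₂, rfl, hB, hs, h'⟩ := h.plug_inv hxΓ
  have hy : (Γ₂.set x S') y ≠ none := by
    rw [← h'.mem_fn_iff, Buffer.mem_fn_plug]
    exact .inr (.inr ⟨rfl, hB'⟩)
  obtain ⟨T, hy⟩ := Option.ne_none_iff_exists'.1 hy
  obtain ⟨k', n, T', Δ₁, Δ₂, rfl, hB', hs', hP⟩ := h'.plug_inv hy
  rw [hP.mem_fn_iff] at hx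
  have hyΓ : Γ y = some T := by have := hs y; grind
  have : k + (k' + n) = k' + (k + n) := by omega
  rw [this]
  refine hB'.plug h.regular hyΓ (Γ₂ := Γ₁.union (Δ₂.set x S)) ?_
    (hB.plug ?_ (S := S) (Γ₂ := (Δ₂.erase x).set y T') ?_ ?_ ?_)
  · intro z; have := hs z; have := hs' z; grind
  · refine Ctx.Regular.set ?_ (hP.regular y T' (by simp))
    intro z W hz
    have := hs z; have := hs' z; have := h.regular z W
    grind
  · have := hs x; grind
  · intro z; have := hs z; have := hs' z; grind
  · convert hP using 1
    funext z; have := hs' z; grind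

/-- A buffer on one end of a session moves through a link at the other end: the type of the other
channel of the link anticipates the outputs of the buffer. -/
theorem BufTyped.forward {B : Buffer Tag Name} {k S S' Γ} (h : BufTyped prog B k S S' Γ)
    {B' : Buffer Tag Name} {k' Δ} : ∀ {T T'}, BufTyped prog B' k' T T' Δ → Correct S T →
    S.Regular → T.Regular → T'.Regular → ∃ U T₁ T₁', BufTyped prog B k U T₁'.dual Γ ∧
      Sub U T'.dual ∧ Correct S' T₁ ∧ BufTyped prog B' k' T₁ T₁' Δ ∧ U.Regular ∧ S'.Regular ∧
      T₁.Regular ∧ T₁'.Regular := by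
  have hcc := isCorrectComposition_correct (Tag := Tag)
  induction h with
  | nil S =>
    intro T T' hB' hc hS hT hT'
    exact ⟨_, T, T', .nil _, Sub.refl _, hc, hB', hT'.dual, hS, hT, hT'⟩
  | @tag I hI m S a ha B n S' Γ _ ih =>
    intro T T' hB' hc hS hT hT'
    obtain ⟨T₀, h1, h2⟩ := hcc.out_inp _ _ hc (.tag (m ⟨a, ha⟩) a) _ (fun _ e => by cases e)
      (trans_plus_out_iff.2 ⟨⟨a, ha⟩, rfl, rfl⟩)
    obtain ⟨T₀', h3, h4⟩ := hB'.trans_inp h1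
    obtain ⟨U, T₁, T₁', h5, h6, h7, h8, h9, h10, h11, h12⟩ := ih h4 h2
      (hS.child (SType.child_plus ..)) (h1.regular hT) (h3.regular hT')
    exact ⟨.plus {a} (Finset.singleton_nonempty a) (fun _ => m ⟨a, ha⟩) fun _ => U, T₁, T₁',
      .tag (I := {a}) (m := fun _ => m ⟨a, ha⟩) (S := fun _ => U) (Finset.mem_singleton_self a) h5,
      sub_of_trans_tag h3.dual h6, h7, h8,
      SType.regular_singleton_plus h9, h10, h11, h12⟩
  | @chan R B m n S₁ S₂ S' Γ Γ₁ Γ₂ hs hR _ ih =>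
    intro T T' hB' hc hS hT hT'
    obtain ⟨V, T₀, h1, hV, h2⟩ := hcc.out_inp_chan _ _ hc S₁ S₂
      (trans_tensor_out_iff.2 ⟨rfl, rfl⟩)
    obtain ⟨T₀', h3, h4⟩ := hB'.trans_inp h1
    obtain ⟨U, T₁, T₁', h5, h6, h7, h8, h9, h10, h11, h12⟩ := ih h4 h2
      (hS.child (SType.child_tensor_right ..)) (h1.regular hT) (h3.regular hT')
    exact ⟨.tensor S₁ U, T₁, T₁', .chan hs hR h5, sub_of_trans_chan h3.dual hV.sub_dual h6, h7, h8,
      SType.regular_tensor (hS.child (SType.child_tensor_left ..)) h9, h10, h11, h12⟩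

/-- Passing through a link is the only structural step that changes the context: the type that the
link gives to `y` is replaced by a smaller one, which starts with the messages of the buffer. -/
theorem Typed.cut_plug_link {n y : ℕ} {B B' : Buffer Tag Name} {P : Proc Tag Name} {Γ : Ctx Tag}
    (h : Typed prog n (Proc.cut (B.plug 0 P) (B'.plug 0 (link 0 (y + 1)))) Γ) :
    ∃ Δ, Typed prog n ((B.rename (inst y)).plug y (Proc.cut P (B'.plug 0 (link 0 (y + 1))))) Δ ∧
      Δ.Sub Γ := by
  obtain ⟨m, n, S, T, Γ₁, Γ₂, rfl, hs, hc, hP, hQ⟩ := h.cut_inv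
  obtain ⟨k, m, S', Δ₁, Δ₂, rfl, hB, hs₁, hP'⟩ := hP.plug_inv (Ctx.cons_zero ..)
  obtain ⟨k', n, T', Θ₁, Θ₂, rfl, hB', hs₂, hL⟩ := hQ.plug_inv (Ctx.cons_zero ..)
  obtain ⟨T'', V, hn, -, hsub, hctx⟩ := hL.link_inv
  have hctx0 := congrFun hctx 0
  have hctxs := fun z => congrFun hctx (z + 1)
  obtain rfl : T' = T'' := by grind
  obtain ⟨U, T₁, T₁', h5, h6, h7, h8, h9, h10, h11, h12⟩ := hB.forward hB' hc hP.regular.head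
    hQ.regular.head (hL.regular 0 T' (by simp))
  have hy₂ : Γ₂ y = some V := by have := hs₂ (y + 1); have := hctxs y; grind
  have hy₁ : Γ y = some V ∧ Γ₁ y = none := by have := hs y; grind
  have h0 : Δ₁ 0 = none := by have := hs₁ 0; grind
  have hBr : BufTyped prog (B.rename (inst y)) k U T₁'.dual Δ₁.tail := by
    refine h5.rename (Ctx.Ren.of_leftInverse (ρ' := Nat.succ) ?_ fun x W hx => ⟨rfl, hx⟩)
    rintro (_ | x) W hx
    · simp [h0] at hx
    · exact ⟨rfl, hx⟩
  refine ⟨Γ.set y U, ?_, ?_⟩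
  · rw [Nat.add_assoc]
    have hΓ₂ : (Γ₂.erase y).Regular := hQ.regular.of_cons.erase
    refine hBr.plug (h.regular.set h9) (Ctx.set_self ..) (Γ₂ := Δ₂.tail.union (Γ₂.erase y)) ?_
      (.cut (S := S') (T := T₁) (Γ₁ := Δ₂.tail) (Γ₂ := Γ₂.set y T₁'.dual) ?_ h7 ?_
      (h8.plug ?_ (Ctx.cons_zero ..) (Γ₂ := Ctx.empty.set (y + 1) T₁'.dual) ?_ (.intro ?_ ?_)))
    · intro z; have := hs z; have := hs₁ (z + 1); grind
    · intro z; have := hs z; have := hs₁ (z + 1); grind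
    · convert hP' using 1
      funext z
      rcases z with _ | z
      · grind
      · grind
    · refine Ctx.Regular.cons ?_ h11
      rw [← Ctx.set_erase_eq]
      exact hΓ₂.set h12.dual
    · rintro (_ | z)
      · have := hs₂ 0; grind
      · have := hs₂ (z + 1); have := hctxs z; grind
    · exact Ctx.Regular.set (Ctx.Regular.set (fun z W hz => by simp at hz) h12.dual) h12
    · rw [show (Ctx.empty.set (y + 1) T₁'.dual).set 0 T₁' =
          (Ctx.empty.set 0 T₁').set (y + 1) T₁'.dual
        by funext z; grind]
      exact .link n 0 (y + 1) T₁' _ hn (by simp) (Sub.refl _)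
  · have := (Ctx.Sub.refl Γ).set (x := y) (h6.trans hsub)
    rwa [show Γ.set y V = Γ by funext z; grind] at this

/-! ### Simulation of structural pre-congruence on well-typed processes -/

theorem Proc.mem_fn_wait_cut_plug {n y : ℕ} {B : Buffer Tag Name} {P Q : Proc Tag Name} :
    n ∈ (wait y (Proc.cut (B.plug 0 P) Q)).fn ↔
      n + 1 ∈ B.fn ∨ n + 1 ∈ (wait (y + 1) P).fn ∨ n + 1 ∈ Q.fn := by
  simp; tauto

theorem Proc.mem_fn_join_cut_plug {n y : ℕ} {B : Buffer Tag Name} {P Q : Proc Tag Name} :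
    n ∈ (join y (Proc.cut ((B.rename (up Nat.succ)).plug 0 (P.rename swap))
        (Q.rename (up Nat.succ)))).fn ↔
      n + 1 ∈ B.fn ∨ n + 1 ∈ (join (y + 1) P).fn ∨ n + 1 ∈ Q.fn := by
  simp; tauto

/-- Moving a case out of a cut preserves the free channels, provided that the case has a branch. -/
theorem Proc.mem_fn_case_cut_plug {n y : ℕ} {I : Finset Tag} [Nonempty I] {B : Buffer Tag Name}
    {P : I → Proc Tag Name} {Q : Proc Tag Name} :
    n ∈ (case y I fun i => Proc.cut (B.plug 0 (P i)) Q).fn ↔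
      n + 1 ∈ B.fn ∨ n + 1 ∈ (case (y + 1) I P).fn ∨ n + 1 ∈ Q.fn := by
  simp only [mem_fn_case, mem_fn_cut, Buffer.mem_fn_plug, Nat.add_right_cancel_iff,
    Nat.add_eq_zero_iff, one_ne_zero, and_false, false_and, or_false, exists_or, exists_const]
  constructor
  · rintro (h | (h | h) | h)
    exacts [.inr (.inl (.inl h)), .inl h, .inr (.inl (.inr h)), .inr (.inr h)]
  · rintro (h | (h | h) | h)
    exacts [.inr (.inl (.inl h)), .inl h, .inr (.inl (.inr h)), .inr (.inr h)]

/-- A well-typed process with the skeleton of a good process `P` can follow every structural step of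
`P` and stay well typed. The typing of the branches of choices and of cases plays no role, since
the skeleton does not look into them. -/
theorem PreCong.simulate {P Q : Proc Tag Name} (h : PreCong prog P Q) :
    P.Good prog (TypedName prog) → ∀ {M : Proc Tag Name} {n : ℕ} {Γ : Ctx Tag}, Skel M P →
    Typed prog n M Γ → ∃ M' n' Γ', PreCong prog M M' ∧ Skel M' Q ∧ Typed prog n' M' Γ' ∧ n' ≤ n ∧
      Γ'.Sub Γ := by
  induction h with
  | refl => exact fun _ M n Γ hM hT => ⟨M, n, Γ, .refl M, hM, hT, le_rfl, Ctx.Sub.refl Γ⟩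
  | trans h _ ih₁ ih₂ =>
    intro hg M n Γ hM hT
    obtain ⟨M₁, n₁, Γ₁, h1, h2, h3, h4, h5⟩ := ih₁ hg hM hT
    obtain ⟨M₂, n₂, Γ₂, h6, h7, h8, h9, h10⟩ :=
      ih₂ (h.good (fun _ => TypedName.good_body) hg).1 h2 h3
    exact ⟨M₂, n₂, Γ₂, h1.trans h6, h7, h8, h9.trans h4, h10.trans h5⟩
  | cong_select x a _ ih =>
    intro hg M n Γ hM hT
    cases hM with
    | select _ _ hM =>
      obtain ⟨n, I, hI, m, S, ha, rfl, hx, hP⟩ := hT.select_inv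
      obtain ⟨M', n', Γ', h1, h2, h3, h4, h5⟩ := ih hg hM hP
      obtain ⟨Δ, h6, h7⟩ := Typed.select_sub hx h3 h5
      exact ⟨_, _, Δ, .cong_select x a h1, .select x a h2, h6, by omega, h7⟩
  | cong_fork x h _ _ ih =>
    intro hg M n Γ hM hT
    have hfn := (h.good (fun _ => TypedName.good_body) hg.1).2
    cases hM with
    | fork _ hR hM =>
      obtain ⟨m, n, S, T, Γ₁, Γ₂, rfl, hx, hs, hP, hQ⟩ := hT.fork_inv
      obtain ⟨M', n', Γ', h1, h2, h3, h4, h5⟩ := ih hg.2 hM hQ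
      obtain ⟨Δ, h6, h7⟩ := Typed.fork_sub hx hs hP h3 h5
      exact ⟨_, _, Δ, .cong_fork x (.refl _) h1, .fork x (hR.trans hfn.symm) h2, h6, by omega, h7⟩
  | cong_choice h₁ h₂ =>
    intro hg M n Γ hM hT
    have hfn := ((cong_choice h₁ h₂).good (fun _ => TypedName.good_body) hg).2
    cases hM with
    | choice _ _ _ _ hM =>
      exact ⟨_, n, Γ, .refl _, .choice _ _ _ _ (hM.trans hfn.symm), hT, le_rfl, Ctx.Sub.refl Γ⟩
  | cong_wait x h =>
    intro hg M n Γ hM hT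
    have hfn := ((cong_wait x h).good (fun _ => TypedName.good_body) hg).2
    cases hM with
    | wait _ hM => exact ⟨_, n, Γ, .refl _, .wait _ (hM.trans hfn.symm), hT, le_rfl, Ctx.Sub.refl Γ⟩
  | cong_case x I h =>
    intro hg M n Γ hM hT
    have hfn := ((cong_case x I h).good (fun _ => TypedName.good_body) hg).2
    cases hM with
    | case _ _ hM =>
      exact ⟨_, n, Γ, .refl _, .case _ _ (hM.trans hfn.symm), hT, le_rfl, Ctx.Sub.refl Γ⟩
  | cong_join x h =>
    intro hg M n Γ hM hT
    have hfn := ((cong_join x h).good (fun _ => TypedName.good_body) hg).2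
    cases hM with
    | join _ hM => exact ⟨_, n, Γ, .refl _, .join _ (hM.trans hfn.symm), hT, le_rfl, Ctx.Sub.refl Γ⟩
  | cong_cut _ _ ih₁ ih₂ =>
    intro hg M n Γ hM hT
    cases hM with
    | cut hM₁ hM₂ =>
      obtain ⟨m, n, S, T, Γ₁, Γ₂, rfl, hs, hc, hP, hQ⟩ := hT.cut_inv
      obtain ⟨M₁, n₁, Δ₁, h1, h2, h3, h4, h5⟩ := ih₁ hg.1 hM₁ hP
      obtain ⟨M₂, n₂, Δ₂, h6, h7, h8, h9, h10⟩ := ih₂ hg.2 hM₂ hQ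
      obtain ⟨Δ, h11, h12⟩ := Typed.cut_sub hs hc hQ.regular.head h3 h5 h8 h10
      exact ⟨_, _, Δ, .cong_cut h1 h6, .cut h2 h7, h11, by omega, h12⟩
  | s_call A xs hA =>
    intro hg M n Γ hM hT
    cases hM
    obtain ⟨m, hm, -, -, h, -⟩ := hT.call_inv
    exact ⟨_, m, Γ, .s_call A xs hA, .refl _, h, hm, Ctx.Sub.refl Γ⟩
  | s_link x y =>
    intro hg M n Γ hM hT
    cases hM
    exact ⟨_, n, Γ, .s_link x y, .refl _, hT.link_symm, le_rfl, Ctx.Sub.refl Γ⟩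
  | s_comm P Q =>
    intro hg M n Γ hM hT
    cases hM with
    | cut hM₁ hM₂ =>
      exact ⟨_, n, Γ, .s_comm _ _, .cut hM₂ hM₁, hT.cut_comm, le_rfl, Ctx.Sub.refl Γ⟩
  | s_wait B y P Q =>
    intro hg M n Γ hM hT
    cases hM with
    | cut hM₁ hM₂ =>
      obtain ⟨B', M', rfl, hB, hM₁⟩ := hM₁.plug_inv
      cases hM₁ with
      | @wait _ P' _ hM₁ =>
        refine ⟨_, n, Γ, .s_wait B' y P' _, .wait _ ?_, hT.cut_plug_wait, le_rfl, Ctx.Sub.refl Γ⟩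
        ext z
        rw [mem_fn_wait_cut_plug, mem_fn_wait_cut_plug, hM₁, hB.fn_eq, hM₂.fn_eq]
  | s_case B y I P Q =>
    intro hg M n Γ hM hT
    cases hM with
    | cut hM₁ hM₂ =>
      obtain ⟨B', M', rfl, hB, hM₁⟩ := hM₁.plug_inv
      cases hM₁ with
      | @case _ _ P' _ hM₁ =>
        refine ⟨_, n, Γ, .s_case B' y I P' _, .case _ _ ?_, hT.cut_plug_case, le_rfl,
          Ctx.Sub.refl Γ⟩
        obtain ⟨j, -⟩ := (good_plug.1 hg.1).2
        have : Nonempty I := ⟨j⟩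
        ext z
        rw [mem_fn_case_cut_plug, mem_fn_case_cut_plug, hM₁, hB.fn_eq, hM₂.fn_eq]
  | s_join B y P Q =>
    intro hg M n Γ hM hT
    cases hM with
    | cut hM₁ hM₂ =>
      obtain ⟨B', M', rfl, hB, hM₁⟩ := hM₁.plug_inv
      cases hM₁ with
      | @join _ P' _ hM₁ =>
        refine ⟨_, n, Γ, .s_join B' y P' _, .join _ ?_, hT.cut_plug_join, le_rfl, Ctx.Sub.refl Γ⟩
        ext z
        rw [mem_fn_join_cut_plug, mem_fn_join_cut_plug, hM₁, hB.fn_eq, hM₂.fn_eq]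
  | s_pull_0 B B' y P =>
    intro hg M n Γ hM hT
    cases hM with
    | cut hM₁ hM₂ =>
      obtain ⟨B₁, M', rfl, hB, hM₁⟩ := hM₁.plug_inv
      obtain ⟨B₁', M'', rfl, hB', hM₂⟩ := hM₂.plug_inv
      cases hM₂
      obtain ⟨Δ, h1, h2⟩ := hT.cut_plug_link
      exact ⟨_, n, Δ, .s_pull_0 B₁ B₁' y M', (hB.rename _).plug _ (.cut hM₁ (hB'.plug _ (.refl _))),
        h1, le_rfl, h2⟩
  | s_pull_1 y P Q R hP =>
    intro hg M n Γ hM hT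
    cases hM with
    | cut hM₁ hM₂ =>
      cases hM₁ with
      | @fork _ P' _ Q' _ hP' hQ' =>
        have h0 : 0 ∉ Q'.fn := by simp [hQ'.fn_eq]
        rw [← rename_succ_pred h0] at hT ⊢
        rw [← hP'] at hP
        have hQ := hQ'.rename Nat.pred
        rw [rename_pred_succ] at hQ
        refine ⟨_, n, Γ, .s_pull_1 y P' _ _ hP, .fork _ ?_ hQ, hT.cut_fork hP, le_rfl,
          Ctx.Sub.refl Γ⟩
        simp only [Proc.fn, Proc.fn_rename, hP', hM₂.fn_eq]
  | s_pull_2 B y P Q =>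
    intro hg M n Γ hM hT
    cases hM with
    | cut hM₁ hM₂ =>
      obtain ⟨B', M', rfl, hB, hM₁⟩ := hM₁.plug_inv
      have h0 : 0 ∉ B'.fn := by simp [hB.fn_eq]
      rw [← Buffer.rename_succ_pred h0] at hT ⊢
      have hB' := hB.rename Nat.pred
      rw [Buffer.rename_pred_succ] at hB'
      exact ⟨_, n, Γ, .s_pull_2 _ y _ _, hB'.plug _ (.cut hM₁ hM₂), hT.cut_plug_pull, le_rfl,
        Ctx.Sub.refl Γ⟩
  | s_pull_3 B x y P Q hxy hx =>
    intro hg M n Γ hM hT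
    obtain ⟨B', M', rfl, hB, hM⟩ := hM.plug_inv
    cases hM with
    | fork _ hP hQ =>
      rw [← hP] at hx
      refine ⟨_, n, Γ, .s_pull_3 B' x y _ _ hxy hx, .fork _ ?_ hQ, hT.plug_fork hxy hx, le_rfl,
        Ctx.Sub.refl Γ⟩
      ext z
      rw [Buffer.mem_fn_plug, Buffer.mem_fn_plug, hP, (hB.rename _).fn_eq, Ne,
        (hB.rename _).eq_nil_iff]
  | s_pull_4 B B' x y P hxy hx =>
    intro hg M n Γ hM hT
    obtain ⟨B₁, M, rfl, hB, hM⟩ := hM.plug_inv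
    obtain ⟨B₁', M, rfl, hB', hM⟩ := hM.plug_inv
    rw [← hM.fn_eq] at hx
    exact ⟨_, n, Γ, .s_pull_4 B₁ B₁' x y M hxy hx, hB'.plug _ (hB.plug _ hM), hT.plug_plug hxy hx,
      le_rfl, Ctx.Sub.refl Γ⟩

/-! ### Reduction of well-typed processes -/

/-- If every typing of `P` has a decreasing reduction, then so has every typing of `P` in the hole
of a buffer. -/
theorem Typed.plug_sub {B : Buffer Tag Name} {x : ℕ} {P : Proc Tag Name}
    (ih : ∀ {n : ℕ} {Γ : Ctx Tag}, Typed prog n P Γ →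
      ∃ P' n' Γ', Red prog P P' ∧ Typed prog n' P' Γ' ∧ n' < n ∧ Γ'.Sub Γ) :
    ∀ {n : ℕ} {Γ : Ctx Tag}, Typed prog n (B.plug x P) Γ →
      ∃ P' n' Γ', Red prog P P' ∧ Typed prog n' (B.plug x P') Γ' ∧ n' < n ∧ Γ'.Sub Γ := by
  induction B with
  | nil => exact ih
  | cons b B ihB =>
    intro n Γ h
    cases b with
    | tag a =>
      obtain ⟨n, I, hI, m, S, ha, rfl, hx, hP⟩ := Typed.select_inv h
      obtain ⟨P', n', Γ', h1, h2, h3, h4⟩ := ihB hP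
      obtain ⟨Δ, h5, h6⟩ := Typed.select_sub hx h2 h4
      exact ⟨P', _, Δ, h1, h5, by omega, h6⟩
    | chan R =>
      obtain ⟨m, n, S, T, Γ₁, Γ₂, rfl, hx, hs, hR, hP⟩ := Typed.fork_inv h
      obtain ⟨P', n', Γ', h1, h2, h3, h4⟩ := ihB hP
      obtain ⟨Δ, h5, h6⟩ := Typed.fork_sub hx hs hR h2 h4
      exact ⟨P', _, Δ, h1, h5, by omega, h6⟩

/-- The process that takes over `y` uses it at a smaller type than the link did. -/
theorem Typed.red_link {n y : ℕ} {P : Proc Tag Name} {Γ : Ctx Tag}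
    (h : Typed prog n (Proc.cut (link 0 (y + 1)) P) Γ) :
    ∃ n' Γ', Typed prog n' (P.rename (inst y)) Γ' ∧ n' < n ∧ Γ'.Sub Γ := by
  obtain ⟨m, n, S, U, Γ₁, Γ₂, rfl, hs, hc, hL, hP⟩ := h.cut_inv
  obtain ⟨S', T, hm, -, hST, hctx⟩ := hL.link_inv
  have hctx0 := congrFun hctx 0
  have hctxs := fun z => congrFun hctx (z + 1)
  obtain rfl : S = S' := by grind
  have hy : Γ y = some T ∧ Γ₂ y = none := by have := hs y; have := hctxs y; grind
  refine ⟨n, _, hP.rename (Ctx.Ren.inst hy.2 U), by omega, ?_⟩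
  have hU : Sub U T := hc.symm.sub_dual.trans hST
  have := (Ctx.Sub.refl Γ₂).set (x := y) hU
  convert this using 1
  funext z; have := hs z; have := hctxs z; grind

/-- Since `P` is typed in a context without the closed channel, it does not mention that channel. -/
theorem Typed.red_close {n : ℕ} {P : Proc Tag Name} {Γ : Ctx Tag}
    (h : Typed prog n (Proc.cut (close 0) (wait 0 P)) Γ) :
    ∃ P' n', P = P'.rename Nat.succ ∧ Typed prog n' P' Γ ∧ n' < n := by
  obtain ⟨m, n, S, U, Γ₁, Γ₂, rfl, hs, hc, hL, hP⟩ := h.cut_inv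
  obtain ⟨hx, hP⟩ := hP.wait_inv
  generalize hΔ : Γ₁.cons S = Δ at hL
  cases hL.rule with
  | close m _ hm =>
    have h0 : 0 ∉ P.fn := by rw [hP.mem_fn_iff]; grind
    refine ⟨P.rename Nat.pred, n, (rename_succ_pred h0).symm, ?_, by omega⟩
    convert hP.rename (Ctx.Ren.pred (by simp)) using 1
    funext z
    have := hs z
    have := congrFun hΔ (z + 1)
    grind

theorem Typed.red_select {n : ℕ} {B : Buffer Tag Name} {P : Proc Tag Name} {J : Finset Tag}
    {Q : J → Proc Tag Name} {k : J} {Γ : Ctx Tag}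
    (h : Typed prog n (Proc.cut (select 0 k P) (B.plug 0 (case 0 J Q))) Γ) :
    ∃ n' < n, Typed prog n' (Proc.cut P (B.plug 0 (Q k))) Γ := by
  obtain ⟨m, n, S, T, Γ₁, Γ₂, rfl, hs, hc, hP, hQ⟩ := h.cut_inv
  obtain ⟨m, I, hI, μ, S, hk, rfl, hx, hP⟩ := hP.select_inv
  obtain rfl := Option.some.inj hx
  obtain ⟨l, n, T', Δ₁, Δ₂, rfl, hB, hs', hQ'⟩ := hQ.plug_inv (Ctx.cons_zero ..)
  obtain ⟨I', hI', μ', T, hIJ, hx', hQ', -⟩ := hQ'.case_inv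
  rw [Ctx.set_self] at hx'
  obtain rfl := Option.some.inj hx'
  obtain ⟨T₁, h1, h2⟩ := isCorrectComposition_correct.out_inp _ _ hc (.tag (μ ⟨k, hk⟩) k) _
    (fun _ e => by cases e) (trans_plus_out_iff.2 ⟨⟨k, hk⟩, rfl, rfl⟩)
  obtain ⟨T₁', h3, h4⟩ := hB.trans_inp h1
  obtain ⟨k', hk', rfl⟩ := trans_amp_inp_iff.1 h3
  obtain ⟨hμ, hkk⟩ := Msg.tag.inj hk'
  have hkk : (⟨k', hIJ k'.2⟩ : J) = k := Subtype.ext hkk.symm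
  have hQk := hQ' k'
  rw [hkk, ← hμ] at hQk
  refine ⟨m + (l + (n + μ ⟨k, hk⟩)), by omega, .cut (Γ₁ := Γ₁) (Γ₂ := Γ₂) hs h2 ?_
    (h4.plug ?_ (Ctx.cons_zero ..) (Γ₂ := Δ₂) ?_ ?_)⟩
  · convert hP using 1
    funext z; rcases z with _ | z <;> grind
  · exact hQ.regular.of_cons.cons (h1.regular hQ.regular.head)
  · rintro (_ | z)
    · have := hs' 0; grind
    · have := hs' (z + 1); grind
  · convert hQk using 1
    funext z; grind

theorem Typed.red_fork {n : ℕ} {B : Buffer Tag Name} {P Q R : Proc Tag Name} {Γ : Ctx Tag}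
    (h : Typed prog n (Proc.cut (fork 0 P Q) (B.plug 0 (join 0 R))) Γ) :
    ∃ P' n', P = P'.rename (up Nat.succ) ∧ n' < n ∧ Typed prog n' (Proc.cut P'
      (Proc.cut (Q.rename (up Nat.succ)) ((B.rename (up Nat.succ)).plug 0 (R.rename swap)))) Γ := by
  obtain ⟨m, n, S, T, Γ₁, Γ₂, rfl, hs, hc, hP, hQ⟩ := h.cut_inv
  obtain ⟨p, q, S₁, S₂, Δ₁, Δ₂, rfl, hx, hs₁, hP', hQ'⟩ := hP.fork_inv
  obtain rfl := Option.some.inj hx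
  obtain ⟨l, n, T', Θ₁, Θ₂, rfl, hB, hs₂, hR⟩ := hQ.plug_inv (Ctx.cons_zero ..)
  obtain ⟨U, V, hx', hR⟩ := hR.join_inv
  rw [Ctx.set_self] at hx'
  obtain rfl := Option.some.inj hx'
  obtain ⟨T₁, T₂, h1, h2, h3⟩ := isCorrectComposition_correct.out_inp_chan _ _ hc S₁ S₂
    (trans_tensor_out_iff.2 ⟨rfl, rfl⟩)
  obtain ⟨T₁', h4, h5⟩ := hB.trans_inp h1
  obtain ⟨e, rfl⟩ := trans_par_inp_iff.1 h4
  obtain rfl := Msg.chan.inj e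
  have h0 : Δ₁ 0 = none ∧ Δ₂ 0 = none := by have := hs₁ 0; grind
  have hΘ : Θ₁ 0 = none ∧ Θ₂ 0 = none := by have := hs₂ 0; grind
  have hfn : 1 ∉ P.fn := by rw [hP'.mem_fn_iff]; simp [h0.1]
  have hB' : BufTyped prog (B.rename (up Nat.succ)) l T₂ T₁' Θ₁.tail.shift.shift := by
    refine h5.rename (Ctx.Ren.of_leftInverse (ρ' := up Nat.pred) ?_ ?_)
    · rintro (_ | x) W hx
      · simp [hΘ.1] at hx
      · exact ⟨rfl, hx⟩
    · rintro (_ | _ | x) W hx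
      · simp at hx
      · simp at hx
      · exact ⟨rfl, hx⟩
  refine ⟨P.rename (up Nat.pred), p + (q + (l + n)), (rename_up_succ_pred hfn).symm, by omega,
    .cut (S := S₁) (T := T₁) (Γ₁ := Δ₁.tail) (Γ₂ := Δ₂.tail.union Γ₂) ?_ h2
    (hP'.rename ((Ctx.Ren.pred h0.1).cons S₁))
    (.cut (S := S₂) (T := T₂) (Γ₁ := Δ₂.tail.shift) (Γ₂ := Γ₂.cons T₁) ?_ h3 ?_
      (hB'.plug ?_ (Ctx.cons_zero ..) (Γ₂ := (Θ₂.tail.cons T₁).shift) ?_ ?_))⟩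
  · intro z; have := hs z; have := hs₁ (z + 1); grind
  · rintro (_ | z)
    · grind
    · have := hs z; have := hs₁ (z + 1); grind
  · refine hQ'.rename ?_
    convert (Ctx.Ren.succ Δ₂.tail).cons S₂ using 1
    funext z; rcases z with _ | z <;> grind
  · exact (hQ.regular.of_cons.cons (h1.regular_msg hQ.regular.head)).cons
      (h1.regular hQ.regular.head)
  · rintro (_ | _ | z)
    · grind
    · grind
    · have := hs₂ (z + 1); grind
  · convert hR.rename (Ctx.Ren.swap _) using 1
    funext z
    rcases z with _ | _ | z
    · simp
    · rfl
    · simp; grind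

/-- A well-typed process whose skeleton reduces has a reduction to a well-typed process with a
smaller measure. In a choice the branch is the one that the measure of the choice counts, not
necessarily the one taken by the given reduction. -/
theorem Red.simulate {P Q : Proc Tag Name} (h : Red prog P Q) :
    P.Good prog (TypedName prog) → ∀ {M : Proc Tag Name} {n : ℕ} {Γ : Ctx Tag}, Skel M P →
    Typed prog n M Γ → ∃ M' n' Γ', Red prog M M' ∧ Typed prog n' M' Γ' ∧ n' < n ∧ Γ'.Sub Γ := by
  have hchoice : ∀ {P Q M : Proc Tag Name} {n : ℕ} {Γ : Ctx Tag}, Skel M (choice P Q) →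
      Typed prog n M Γ →
      ∃ M' n' Γ', Red prog M M' ∧ Typed prog n' M' Γ' ∧ n' < n ∧ Γ'.Sub Γ := by
    intro P Q M n Γ hM hT
    cases hM with
    | choice P' _ Q' _ _ =>
      obtain ⟨m, m', h1, h2, h3 | h3⟩ := hT.choice_inv
      · exact ⟨P', m, Γ, .r_choice_left _ _, h1, h3, Ctx.Sub.refl Γ⟩
      · exact ⟨Q', m', Γ, .r_choice_right _ _, h2, h3, Ctx.Sub.refl Γ⟩
  induction h with
  | r_choice_left | r_choice_right => exact fun _ _ _ _ => hchoice
  | r_link y P =>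
    intro _ M n Γ hM hT
    cases hM with
    | cut hM₁ hM₂ =>
      cases hM₁
      obtain ⟨n', Γ', h1, h2, h3⟩ := hT.red_link
      exact ⟨_, n', Γ', .r_link y _, h1, h2, h3⟩
  | r_close P =>
    intro _ M n Γ hM hT
    cases hM with
    | cut hM₁ hM₂ =>
      cases hM₁
      cases hM₂
      obtain ⟨P', n', rfl, h1, h2⟩ := hT.red_close
      exact ⟨P', n', Γ, .r_close P', h1, h2, Ctx.Sub.refl Γ⟩
  | r_select B P I Q k =>
    intro _ M n Γ hM hT
    cases hM with
    | cut hM₁ hM₂ =>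
      obtain ⟨B', M', rfl, hB, hM₂⟩ := hM₂.plug_inv
      cases hM₁
      cases hM₂
      obtain ⟨n', h1, h2⟩ := hT.red_select
      exact ⟨_, n', Γ, .r_select B' _ I _ k, h2, h1, Ctx.Sub.refl Γ⟩
  | r_fork B P Q R =>
    intro _ M n Γ hM hT
    cases hM with
    | cut hM₁ hM₂ =>
      obtain ⟨B', M', rfl, hB, hM₂⟩ := hM₂.plug_inv
      cases hM₁
      cases hM₂
      obtain ⟨P', n', rfl, h1, h2⟩ := hT.red_fork
      exact ⟨_, n', Γ, .r_fork B' P' _ _, h2, h1, Ctx.Sub.refl Γ⟩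
  | r_cut R _ ih =>
    intro hg M n Γ hM hT
    cases hM with
    | cut hM₁ hM₂ =>
      obtain ⟨m, n, S, T, Γ₁, Γ₂, rfl, hs, hc, hP, hQ⟩ := hT.cut_inv
      obtain ⟨M', n', Γ', h1, h2, h3, h4⟩ := ih hg.1 hM₁ hP
      obtain ⟨Δ, h5, h6⟩ := Typed.cut_sub hs hc hQ.regular.head h2 h4 hQ (Ctx.Sub.refl _)
      exact ⟨_, _, Δ, .r_cut _ h1, h5, by omega, h6⟩
  | r_buffer x B _ ih =>
    intro hg M n Γ hM hT
    obtain ⟨B', M', rfl, hB, hM⟩ := hM.plug_inv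
    obtain ⟨P', n', Γ', h1, h2, h3, h4⟩ :=
      Typed.plug_sub (fun h => ih (good_plug.1 hg).2 hM h) hT
    exact ⟨_, n', Γ', .r_buffer x B' h1, h2, h3, h4⟩
  | r_str h _ ih =>
    intro hg M n Γ hM hT
    obtain ⟨M₁, n₁, Γ₁, h1, h2, h3, h4, h5⟩ := h.simulate hg hM hT
    obtain ⟨M₂, n₂, Γ₂, h6, h7, h8, h9⟩ := ih (h.good (fun _ => TypedName.good_body) hg).1 h2 h3
    exact ⟨M₂, n₂, Γ₂, .r_str h1 h6, h7, by omega, h9.trans h5⟩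

end CaP

theorem mainTheorem4 {Tag Name : Type} (prog : CaP.Program Tag Name) (n : ℕ)
    (P : CaP.Proc Tag Name) (Γ : CaP.Ctx Tag) (hP : CaP.Typed prog n P Γ) :
    ∃ (k : ℕ) (run : ℕ → CaP.Proc Tag Name) (μ : ℕ → ℕ) (Δ : ℕ → CaP.Ctx Tag),
      CaP.IsFiniteRun prog P k run ∧
      μ 0 = n ∧ Δ 0 = Γ ∧
      (∀ i ≤ k, CaP.Typed prog (μ i) (run i) (Δ i)) ∧
      (∀ i < k, μ (i + 1) < μ i) := by
  induction n using Nat.strong_induction_on generalizing P Γ with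
  | _ n ih =>
  by_cases h : ∃ Q, CaP.Red prog P Q
  · obtain ⟨Q, hQ⟩ := h
    obtain ⟨P', n', Γ', h1, h2, h3, -⟩ := hQ.simulate hP.good (.refl P) hP
    obtain ⟨k, run, μ, Δ, ⟨hr, hred, hend⟩, hμ, hΔ, hT, hlt⟩ := ih n' h3 P' Γ' h2
    refine ⟨k + 1, fun i => Nat.casesOn i P run, fun i => Nat.casesOn i n μ,
      fun i => Nat.casesOn i Γ Δ, ⟨rfl, ?_, hend⟩, rfl, rfl, ?_, ?_⟩
    · rintro (_ | i) hi
      · change CaP.Red prog P (run 0)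
        rwa [hr]
      · exact hred i (Nat.lt_of_succ_lt_succ hi)
    · rintro (_ | i) hi
      · exact hP
      · exact hT i (Nat.le_of_succ_le_succ hi)
    · rintro (_ | i) hi
      · change μ 0 < n
        rwa [hμ]
      · exact hlt i (Nat.lt_of_succ_lt_succ hi)
  · exact ⟨0, fun _ => P, fun _ => n, fun _ => Γ,
      ⟨rfl, fun i hi => (Nat.not_lt_zero i hi).elim, fun Q hQ => h ⟨Q, hQ⟩⟩, rfl, rfl,
      fun _ _ => hP, fun i hi => (Nat.not_lt_zero i hi).elim⟩
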